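/- **Setting.** Let $(\rho,\psi,z)$ be orthogonal curvilinear coordinates in $\mathbb{R}^3$, with $\rho\ge 0$ radial and $\psi$ angular in each surface of constant $z$; that is, the position is $\mathbf r(\rho,\psi,z)=\Phi(\rho\cos\psi,\rho\sin\psi,z)$ with $\Phi$ a $C^\infty$ diffeomorphism between open sets of $\mathbb{R}^3$, and $\partial_\rho\mathbf r,\partial_\psi\mathbf r,\partial_z\mathbf r$ are mutually orthogonal for $\rho>0$. Write $\mathbf e_\rho,\mathbf e_z$ for the unit vectors along $\partial_\rho\mathbf r,\partial_z\mathbf r$, and $A_\rho=\mathbf A\cdot\mathbf e_\rho$, $B_z=\mathbf B\cdot\mathbf e_z$. A flux tube $V$ is a compact set bounded by the surfaces $z=0$ and $z=1$ and by a side boundary, namely the image of the solid cylinder $\{y_1^2+y_2^2\le1,\ 0\le y_3\le1\}$ under a $C^\infty$ diffeomorphism, defined on a neighbourhood of the cylinder, under which $z=y_3$; the side boundary is the image of $\{y_1^2+y_2^2=1\}$. The cross-sections $D_z$, $0\le z\le1$, are thus closed discs, and they contain the axis $\rho=0$ in their interiors. All vector fields are $C^1$ on a neighbourhood of $V$; $\mathbf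 n$ is a normal vector to $\partial V$. A *magnetic braid* on $V$ is a divergence-free field $\mathbf B$ with $B_z>0$ on $V$ and $\mathbf B\cdot\mathbf n=0$ on the side boundary. For $x_0\in D_0$ let $z\mapsto f(x_0;z)\in D_z$, $0\le z\le 1$, be its field line (the curve tangent to $\mathbf B$) starting at $x_0$, and let $F:D_0\to D_1$, $F(x_0)=f(x_0;1)$, be its *field line mapping*. Let $\mathbf A^{\rm ref}$ be a vector potential of a reference field $\mathbf B^{\rm ref}=\nabla\times\mathbf A^{\rm ref}$ with $\mathbf B^{\rm ref}\cdot\mathbf n=\mathbf B\cdot\mathbf n$ on $\partial V$. The *topological flux function* of $\mathbf B$ with reference $\mathbf A^{\rm ref}$ is $$\mathcal A:D_0\to\mathbb{R},\qquad \mathcal A(x_0)=\int_{x_0}^{F(x_0)}\mathbf A\cdot d\mathbf l\quad\text{along the field line } f(x_0;\cdot),$$ where $\mathbf A$ is any vector potential of $\mathbf B$ on $V$ with $\mathbf n\times\mathbf A=\mathbf n\times\mathbf A^{\rm ref}$ on $\partial V$. **Theorem.** Let $\mathbf B,\widetilde{\mathbf B}$ be two magnetic braids on $V$ whose field line mappings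 $F,\widetilde F$ agree on $\partial D_0$ with the same winding number, i.e. for each $x_0\in\partial D_0$ the field lines of $\mathbf B$ and of $\widetilde{\mathbf B}$ starting at $x_0$, which lie on the side boundary, wind round the tube through the same total angle (measured by the angle of $(y_1,y_2)$). Let $\mathcal A,\widetilde{\mathcal A}$ be their topological flux functions with the same reference potential $\mathbf A^{\rm ref}$, where $A^{\rm ref}_\rho=0$ at the points of $D_0$ and $D_1$ off the axis (in particular this holds if $A^{\rm ref}_\rho=0$ everywhere). Then $\mathcal A=\widetilde{\mathcal A}$ on $D_0$ if and only if $F=\widetilde F$ on $D_0$. -/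

import Mathlib

open Set
open scoped ContDiff

noncomputable section

/-- Physical space, with its Euclidean inner product. -/
abbrev E3 : Type := EuclideanSpace ℝ (Fin 3)

namespace E3

/-- The vector product of two vectors of Euclidean space. -/
def cross (a b : E3) : E3 := WithLp.toLp 2 (crossProduct a.ofLp b.ofLp)

/-- The partial derivative `∂ A_j / ∂ x_i` at `x`. -/
def partialDeriv (A : E3 → E3) (i j : Fin 3) (x : E3) : ℝ :=
  (fderiv ℝ A x (EuclideanSpace.single i 1)) j

/-- The curl of a vector field. -/
def curl (A : E3 → E3) (x : E3) : E3 :=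
  !₂[partialDeriv A 1 2 x - partialDeriv A 2 1 x,
     partialDeriv A 2 0 x - partialDeriv A 0 2 x,
     partialDeriv A 0 1 x - partialDeriv A 1 0 x]

/-- The divergence of a vector field. -/
def div (B : E3 → E3) (x : E3) : ℝ := ∑ i, partialDeriv B i i x

/-- The solid cylinder `{y₀² + y₁² ≤ 1, 0 ≤ y₂ ≤ 1}`. -/
def solidCylinder : Set E3 := {y | y 0 ^ 2 + y 1 ^ 2 ≤ 1 ∧ y 2 ∈ Icc (0 : ℝ) 1}

/-- The point with cylindrical coordinates `ρ, ψ, z`. -/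
def cyl (ρ ψ z : ℝ) : E3 := !₂[ρ * Real.cos ψ, ρ * Real.sin ψ, z]

end E3

open E3

/-- A flux tube in space with orthogonal curvilinear coordinates `(ρ, ψ, z)`, where `ρ` is radial,
`ψ` is angular and `0 ≤ z ≤ 1`.  The coordinates are given by the position map
`r(ρ, ψ, z) = coord (ρ cos ψ, ρ sin ψ, z)`, with `coord` a diffeomorphism between open sets
(so that the coordinates are regular, up to the usual polar singularity on the axis `ρ = 0`).
The tube is the image of the solid cylinder under a second diffeomorphism `tube`, which respects
the height `z`; its cross-sections are thus arbitrary smoothly varying closed discs, and they are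
required to contain the axis in their interiors. -/
structure FluxTube where
  coord : OpenPartialHomeomorph E3 E3
  coord_smooth : ContDiffOn ℝ ∞ coord coord.source
  coord_symm_smooth : ContDiffOn ℝ ∞ coord.symm coord.target
  tube : OpenPartialHomeomorph E3 E3
  tube_smooth : ContDiffOn ℝ ∞ tube tube.source
  tube_symm_smooth : ContDiffOn ℝ ∞ tube.symm tube.target
  cylinder_subset : solidCylinder ⊆ tube.source
  tube_subset : tube '' solidCylinder ⊆ coord.target
  height_tube : ∀ y ∈ solidCylinder, (coord.symm (tube y)) 2 = y 2
  axis : ∀ z ∈ Icc (0 : ℝ) 1, !₂[0, 0, z] ∈ coord.source ∧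
    coord !₂[0, 0, z] ∈ tube '' {y | y 0 ^ 2 + y 1 ^ 2 < 1 ∧ y 2 = z}
  orthogonal : ∀ ρ ψ z : ℝ, 0 < ρ → cyl ρ ψ z ∈ coord.source →
    coord (cyl ρ ψ z) ∈ tube '' solidCylinder →
      inner ℝ (deriv (fun s => coord (cyl s ψ z)) ρ) (deriv (fun s => coord (cyl ρ s z)) ψ) = 0 ∧
      inner ℝ (deriv (fun s => coord (cyl s ψ z)) ρ) (deriv (fun s => coord (cyl ρ ψ s)) z) = 0 ∧
      inner ℝ (deriv (fun s => coord (cyl ρ s z)) ψ) (deriv (fun s => coord (cyl ρ ψ s)) z) = 0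

namespace FluxTube

variable (T : FluxTube)

/-- The region `V` occupied by the tube. -/
def V : Set E3 := T.tube '' solidCylinder

/-- The position vector as a function of the curvilinear coordinates. -/
def pos (ρ ψ z : ℝ) : E3 := T.coord (cyl ρ ψ z)

/-- `(ρ, ψ, z)` are curvilinear coordinates of a point of `V` (on the axis, `ψ` is arbitrary). -/
def IsCoord (ρ ψ z : ℝ) : Prop := 0 ≤ ρ ∧ cyl ρ ψ z ∈ T.coord.source ∧ T.pos ρ ψ z ∈ T.V

/-- The coordinate `z` of a point. -/
def height (x : E3) : ℝ := (T.coord.symm x) 2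

/-- The cross-section of the tube at height `z`; the two ends are `D 0` and `D 1`. -/
def D (z : ℝ) : Set E3 := {x | x ∈ T.V ∧ T.height x = z}

/-- The unit vector `e_ρ = (∂r/∂ρ) / h_ρ`, with `h_ρ = ‖∂r/∂ρ‖`. -/
def eRho (ρ ψ z : ℝ) : E3 :=
  ‖deriv (fun s => T.pos s ψ z) ρ‖⁻¹ • deriv (fun s => T.pos s ψ z) ρ

/-- The unit vector `e_z = (∂r/∂z) / h_z`, with `h_z = ‖∂r/∂z‖`. -/
def eZ (ρ ψ z : ℝ) : E3 :=
  ‖deriv (fun s => T.pos ρ ψ s) z‖⁻¹ • deriv (fun s => T.pos ρ ψ s) z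

/-- The parametrization of the side boundary by an angle `θ` and the height `t`. -/
def side (θ t : ℝ) : E3 := T.tube (cyl 1 θ t)

/-- The boundary curve of the cross-section at height `z`. -/
def boundaryD (z : ℝ) : Set E3 := range fun θ => T.side θ z

/-- A normal vector (not normalised) to the side boundary at `side θ t`. -/
def sideNormal (θ t : ℝ) : E3 :=
  cross (deriv (fun s => T.side s t) θ) (deriv (fun s => T.side θ s) t)

/-- `n` is a (nonzero, not normalised or oriented) normal vector at `x` to one of the three faces
of `∂V`: the side boundary and the two ends. -/
def IsNormal (x n : E3) : Prop :=
  (∃ θ t : ℝ, t ∈ Icc (0 : ℝ) 1 ∧ x = T.side θ t ∧ n = T.sideNormal θ t) ∨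
  (∃ ρ ψ z : ℝ, T.IsCoord ρ ψ z ∧ (z = 0 ∨ z = 1) ∧ x = T.pos ρ ψ z ∧ n = T.eZ ρ ψ z)

/-- A vector field is continuously differentiable on a neighbourhood of `V`. -/
def IsC1 (W : E3 → E3) : Prop := ∀ x ∈ T.V, ContDiffAt ℝ 1 W x

/-- A magnetic braid: a divergence-free field on `V` with `B_z > 0` everywhere and `B · n = 0` on
the side boundary. -/
structure IsMagneticBraid (B : E3 → E3) : Prop where
  contDiff : T.IsC1 B
  div_eq_zero : ∀ x ∈ T.V, div B x = 0
  z_pos : ∀ ρ ψ z : ℝ, T.IsCoord ρ ψ z → 0 < inner ℝ (B (T.pos ρ ψ z)) (T.eZ ρ ψ z)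
  tangent_side : ∀ θ t : ℝ, t ∈ Icc (0 : ℝ) 1 → inner ℝ (B (T.side θ t)) (T.sideNormal θ t) = 0

/-- `γ` is the magnetic field line of `B` rooted at `x₀`, parametrized by the height `z ∈ [0, 1]`:
a curve in `V` that is everywhere tangent to `B`. -/
structure IsFieldLine (B : E3 → E3) (x₀ : E3) (γ : ℝ → E3) : Prop where
  start : γ 0 = x₀
  mem : ∀ z ∈ Icc (0 : ℝ) 1, γ z ∈ T.V
  height_eq : ∀ z ∈ Icc (0 : ℝ) 1, T.height (γ z) = z
  tangent : ∀ z ∈ Icc (0 : ℝ) 1, ∃ c : ℝ, HasDerivWithinAt γ (c • B (γ z)) (Icc 0 1) z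

/-- The field line `f(x₀; z)` of `B` rooted at `x₀`. -/
def fieldLine (B : E3 → E3) (x₀ : E3) : ℝ → E3 := Classical.epsilon (T.IsFieldLine B x₀)

/-- The field line mapping `F(x₀) = f(x₀; 1)`. -/
def fieldLineMap (B : E3 → E3) (x₀ : E3) : E3 := T.fieldLine B x₀ 1

/-- `A` is a vector potential of `B` on `V`. -/
structure IsVectorPotential (A B : E3 → E3) : Prop where
  contDiff : T.IsC1 A
  curl_eq : ∀ x ∈ T.V, curl A x = B x

/-- `Aref` is the vector potential of a reference field `Bref = curl Aref` which matches `B · n`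
on `∂V`. -/
structure IsReferencePotential (Aref B : E3 → E3) : Prop where
  contDiff : T.IsC1 Aref
  normal_eq : ∀ x n : E3, T.IsNormal x n → inner ℝ n (curl Aref x) = inner ℝ n (B x)

/-- The gauge condition `n × A = n × Aref` on `∂V`. -/
def MatchesOnBoundary (A Aref : E3 → E3) : Prop :=
  ∀ x n : E3, T.IsNormal x n → cross n (A x) = cross n (Aref x)

/-- The canonical gauge condition `A_ρ = 0` on the two ends of the tube. -/
def IsCanonicalOnEnds (A : E3 → E3) : Prop :=
  ∀ ρ ψ z : ℝ, 0 < ρ → T.IsCoord ρ ψ z → (z = 0 ∨ z = 1) →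
    inner ℝ (A (T.pos ρ ψ z)) (T.eRho ρ ψ z) = 0

/-- The line integral of `A` along the field line of `B` rooted at `x₀`, which is the topological
flux function when `A` is a vector potential of `B` satisfying the boundary gauge condition. -/
def topologicalFlux (B A : E3 → E3) (x₀ : E3) : ℝ :=
  ∫ z in (0 : ℝ)..1, inner ℝ (A (T.fieldLine B x₀ z)) (derivWithin (T.fieldLine B x₀) (Icc 0 1) z)

/-- The curve `γ`, parametrized by height, lies on the side boundary, and `w` is its (real-valued)
winding number round the tube: the total change of a continuous angle along `γ`, over `2π`. -/
def HasWindingNumber (γ : ℝ → E3) (w : ℝ) : Prop :=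
  ∃ θ : ℝ → ℝ, ContinuousOn θ (Icc 0 1) ∧ (∀ z ∈ Icc (0 : ℝ) 1, γ z = T.side (θ z) z) ∧
    w = (θ 1 - θ 0) / (2 * Real.pi)

/-- From each point of `∂D₀`, the field lines of `B` and `B'` wind equally often round the tube. -/
def SameWinding (B B' : E3 → E3) : Prop :=
  ∀ x₀ ∈ T.boundaryD 0, ∃ w : ℝ,
    T.HasWindingNumber (T.fieldLine B x₀) w ∧ T.HasWindingNumber (T.fieldLine B' x₀) w

end FluxTube

end

/-! Straightening the tube to the solid cylinder turns a braid into a field `u` with unit vertical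
component, tangent to the side, and its potential into a one-form `a` with `ι_u da = 0`, because
`da` is the flux form of the field. Moving the foot of a field line therefore changes the integral
of `a` along it by end terms only (`IsTransverseField.variation`): `d𝒜 = F^* a₁ - a₀`, where `a₀`,
`a₁` are the restrictions of `a` to the two end discs. The gauge condition makes these restrictions,
and the one to the side, the same for both braids.

If the field line mappings agree, the difference of the flux functions has zero derivative along a
segment from any point to a boundary point (`lineIntegral_eq_of_flowMap_eq`). On the side `a` is
closed, since the field is tangent to it, so `a` has a primitive on the strip of angles and heights,
common to both braids. Equal winding gives equal end points in the strip, not merely modulo full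
turns, so the difference vanishes on the boundary (`lineIntegral_eq_of_sameWinding`).

If the flux functions agree, then `F^* a₁ = F'^* a₁`. Hence `G = F' ∘ F⁻¹`, written in the
curvilinear coordinates of the end `z = 1`, preserves the one-form `θ` given there by `a₁`, and
fixes the boundary. The form `θ` has no radial component because `A_ρ = 0`, and `dθ` vanishes
nowhere because `B_z > 0`. These facts force `G = id` (`RadialForm.eqOn_id`). Let `α(p) = θ_p(ip)`
be the angular component. Along a ray, `α(se)` has derivative `s dθ(e, ie)`, so `α` is injective on
every interval of a ray inside the domain. Where `α ≠ 0` the kernel of `θ` is the radial line, so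
`G` carries radial directions to radial directions; following the ray to the boundary, where `G` is
the identity, gives `G p = r p`. Comparing `θ` on angular directions gives `α(rp) = α(p)`, whence `r
= 1`. The zeros of `α` have dense complement, and continuity concludes. The domain need not be
star-shaped, so `exists_ray_to_boundary` selects a direction along the ray that reaches the boundary
before any zero of `α`. -/

section

open Metric Filter
open scoped Topology NNReal

/-! ### Differential equations: global solutions in a ball, dependence on initial values -/

namespace ODEBall

theorem hasDerivWithinAt_Ici {E : Type*} [NormedAddCommGroup E] [NormedSpace ℝ E]
    {f : ℝ → E} {f' : E} {t : ℝ} (h : HasDerivWithinAt f f' (Icc 0 1) t) (ht : t ∈ Ico (0 : ℝ) 1) :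
    HasDerivWithinAt f f' (Ici t) t :=
  h.mono_of_mem_nhdsWithin (mem_of_superset (Icc_mem_nhdsGE ht.2) (Icc_subset_Icc_left ht.1))

section Retraction

variable {E : Type*} [NormedAddCommGroup E] [NormedSpace ℝ E]

/-- The radial retraction onto the closed unit ball. -/
noncomputable def retract (x : E) : E := (max 1 ‖x‖)⁻¹ • x

theorem retract_of_norm_le {x : E} (hx : ‖x‖ ≤ 1) : retract x = x := by
  simp [retract, max_eq_left hx]

theorem norm_retract_le (x : E) : ‖retract x‖ ≤ 1 := by
  have h : 0 < max 1 ‖x‖ := lt_of_lt_of_le one_pos (le_max_left _ _)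
  rw [retract, norm_smul, norm_inv, Real.norm_of_nonneg h.le, inv_mul_le_one₀ h]
  exact le_max_right _ _

theorem norm_retract_of_one_le {x : E} (hx : 1 ≤ ‖x‖) : ‖retract x‖ = 1 := by
  have h : ‖x‖ ≠ 0 := by positivity
  rw [retract, norm_smul, norm_inv, max_eq_right hx, norm_norm, inv_mul_cancel₀ h]

/-- The difference splits into a multiple of `x - y` and a change of the scaling factor; each is at
most `‖x - y‖`, whence the constant 2. -/
theorem lipschitzWith_retract : LipschitzWith 2 (retract : E → E) := by
  refine LipschitzWith.of_dist_le_mul fun x y => ?_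
  rw [dist_eq_norm, dist_eq_norm]
  set m := max 1 ‖x‖ with hm
  set n := max 1 ‖y‖ with hn
  have hm1 : 1 ≤ m := le_max_left _ _
  have hn1 : 1 ≤ n := le_max_left _ _
  have hyn : ‖y‖ ≤ n := le_max_right _ _
  have hmn : |n - m| ≤ ‖x - y‖ := by
    have h1 : |n - m| ≤ |‖y‖ - ‖x‖| := by
      simpa only [hm, hn, max_comm] using abs_max_sub_max_le_abs ‖y‖ ‖x‖ 1
    refine h1.trans ?_
    rw [norm_sub_rev]
    exact abs_norm_sub_norm_le _ _
  have hx : retract x - retract y = m⁻¹ • (x - y) + ((n - m) * (m⁻¹ * n⁻¹)) • y := by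
    have : (n - m) * (m⁻¹ * n⁻¹) = m⁻¹ - n⁻¹ := by
      field_simp
    rw [this, sub_smul, smul_sub]
    simp only [retract, ← hm, ← hn]
    abel
  have hmi : m⁻¹ ≤ 1 := inv_le_one_of_one_le₀ hm1
  have hb : m⁻¹ * n⁻¹ * ‖y‖ ≤ 1 := by
    rw [mul_assoc]
    have : n⁻¹ * ‖y‖ ≤ 1 := by
      rw [inv_mul_le_one₀ (by linarith)]; exact hyn
    exact mul_le_one₀ hmi (by positivity) this
  rw [hx]
  calc _ ≤ ‖m⁻¹ • (x - y)‖ + ‖((n - m) * (m⁻¹ * n⁻¹)) • y‖ := norm_add_le _ _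
    _ = m⁻¹ * ‖x - y‖ + |n - m| * (m⁻¹ * n⁻¹ * ‖y‖) := by
      rw [norm_smul, norm_smul, Real.norm_of_nonneg (by positivity), norm_mul,
        Real.norm_of_nonneg (by positivity : 0 ≤ m⁻¹ * n⁻¹), Real.norm_eq_abs, mul_assoc]
    _ ≤ 1 * ‖x - y‖ + ‖x - y‖ * 1 := by gcongr
    _ = _ := by push_cast; ring

end Retraction

/-- At speed at most `L`, a solution stays for unit time in the ball of radius `L` about its start,
so a single application of Picard–Lindelöf covers `[0, 1]`. -/
theorem exists_solution_of_bounded {E : Type*} [NormedAddCommGroup E] [NormedSpace ℝ E]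
    [CompleteSpace E] {f : ℝ → E → E} {K L : ℝ≥0}
    (hlip : ∀ t ∈ Icc (0 : ℝ) 1, LipschitzWith K (f t))
    (hcont : ∀ x, ContinuousOn (f · x) (Icc 0 1))
    (hbound : ∀ t ∈ Icc (0 : ℝ) 1, ∀ x, ‖f t x‖ ≤ L) (x : E) :
    ∃ γ : ℝ → E, γ 0 = x ∧ ∀ t ∈ Icc (0 : ℝ) 1, HasDerivWithinAt γ (f t (γ t)) (Icc 0 1) t :=
  IsPicardLindelof.exists_eq_forall_mem_Icc_hasDerivWithinAt₀ (f := f)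
    (t₀ := ⟨0, by simp⟩) (x₀ := x) (a := L) (L := L) (K := K)
    { lipschitzOnWith := fun t ht => (hlip t ht).lipschitzOnWith
      continuousOn := fun x _ => hcont x
      norm_le := fun t ht x _ => hbound t ht x
      mul_max_le := by simp }

/-- Squaring smooths the corner at 0, which makes this a differentiable penalty for leaving the
ball. -/
theorem hasDerivAt_sq_max (s : ℝ) : HasDerivAt (fun s : ℝ => max s 0 ^ 2) (2 * max s 0) s := by
  rcases lt_trichotomy s 0 with h | rfl | h
  · have : (fun s : ℝ => max s 0 ^ 2) =ᶠ[𝓝 s] fun _ => 0 := by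
      filter_upwards [Iio_mem_nhds h] with r hr
      simp [max_eq_right (le_of_lt (mem_Iio.1 hr))]
    rw [max_eq_right h.le, mul_zero]
    exact (hasDerivAt_const s (0 : ℝ)).congr_of_eventuallyEq this
  · rw [max_self, mul_zero, hasDerivAt_iff_isLittleO]
    have : (fun x : ℝ => max x 0 ^ 2 - max 0 0 ^ 2 - (x - 0) • (0 : ℝ)) =O[𝓝 0]
        fun x : ℝ => x ^ 2 := by
      refine Asymptotics.IsBigO.of_bound 1 (Eventually.of_forall fun x => ?_)
      simp only [max_self, smul_zero, sub_zero, norm_pow, one_mul, Real.norm_eq_abs, ne_eq,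
        OfNat.ofNat_ne_zero, not_false_eq_true, zero_pow]
      rcases le_total x 0 with h | h
      · rw [max_eq_right h]; simpa using sq_nonneg x
      · rw [max_eq_left h]
    refine this.trans_isLittleO ?_
    simpa using Asymptotics.isLittleO_pow_id (𝕜 := ℝ) (n := 2) (by norm_num)
  · have : (fun s : ℝ => max s 0 ^ 2) =ᶠ[𝓝 s] fun s => s ^ 2 := by
      filter_upwards [Ioi_mem_nhds h] with r hr
      simp [max_eq_left (le_of_lt (mem_Ioi.1 hr))]
    rw [max_eq_left h.le]
    simpa using (hasDerivAt_pow 2 s).congr_of_eventuallyEq this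

/-- A vector field on the closed unit ball which does not point outwards on the sphere has global
solutions. -/
theorem exists_solution_of_inward {E : Type*} [NormedAddCommGroup E] [InnerProductSpace ℝ E]
    [CompleteSpace E] {f : ℝ → E → E} {K L : ℝ≥0}
    (hlip : ∀ t ∈ Icc (0 : ℝ) 1, LipschitzOnWith K (f t) (closedBall 0 1))
    (hcont : ∀ x ∈ closedBall (0 : E) 1, ContinuousOn (f · x) (Icc 0 1))
    (hbound : ∀ t ∈ Icc (0 : ℝ) 1, ∀ x ∈ closedBall (0 : E) 1, ‖f t x‖ ≤ L)
    (hin : ∀ t ∈ Icc (0 : ℝ) 1, ∀ x : E, ‖x‖ = 1 → inner ℝ x (f t x) ≤ 0)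
    {x : E} (hx : x ∈ closedBall 0 1) :
    ∃ γ : ℝ → E, γ 0 = x ∧ ∀ t ∈ Icc (0 : ℝ) 1, γ t ∈ closedBall 0 1 ∧
      HasDerivWithinAt γ (f t (γ t)) (Icc 0 1) t := by
  have hr : ∀ y : E, retract y ∈ closedBall (0 : E) 1 := fun y => by
    simpa using norm_retract_le y
  obtain ⟨γ, h0, hγ⟩ := exists_solution_of_bounded (f := fun t y => f t (retract y)) (K := K * 2)
    (L := L)
    (fun t ht => by
      rw [← lipschitzOnWith_univ]
      exact (hlip t ht).comp lipschitzWith_retract.lipschitzOnWith fun y _ => hr y)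
    (fun y => hcont _ (hr y)) (fun t ht y => hbound t ht _ (hr y)) x
  have hle : ∀ t ∈ Icc (0 : ℝ) 1, ‖γ t‖ ≤ 1 := by
    have hd : ∀ t ∈ Icc (0 : ℝ) 1, HasDerivWithinAt (fun t => max (‖γ t‖ ^ 2 - 1) 0 ^ 2)
        (2 * max (‖γ t‖ ^ 2 - 1) 0 * (2 * inner ℝ (γ t) (f t (retract (γ t))))) (Icc 0 1) t :=
      fun t ht => (hasDerivAt_sq_max _).comp_hasDerivWithinAt t ((hγ t ht).norm_sq.sub_const 1)
    -- Outside the ball the field is evaluated at a point of the sphere, of which `γ t` is a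
    -- positive multiple; there it does not point outwards, so the penalty cannot grow.
    have hanti : AntitoneOn (fun t => max (‖γ t‖ ^ 2 - 1) 0 ^ 2) (Icc (0 : ℝ) 1) := by
      refine antitoneOn_of_hasDerivWithinAt_nonpos (convex_Icc 0 1)
        (fun t ht => (hd t ht).continuousWithinAt)
        (fun t ht => (hd t (interior_subset ht)).mono interior_subset) fun t ht => ?_
      have ht := interior_subset ht
      rcases le_total (‖γ t‖) 1 with h | h
      · have : ‖γ t‖ ^ 2 - 1 ≤ 0 := by nlinarith [norm_nonneg (γ t)]
        simp [max_eq_right this]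
      · have h2 := hin t ht _ (norm_retract_of_one_le h)
        have h3 : inner ℝ (γ t) (f t (retract (γ t))) ≤ 0 := by
          rw [show inner ℝ (retract (γ t)) (f t (retract (γ t))) =
            (max 1 ‖γ t‖)⁻¹ * inner ℝ (γ t) (f t (retract (γ t))) by
              conv_lhs => arg 2; rw [retract]
              rw [real_inner_smul_left]] at h2
          have : 0 < (max 1 ‖γ t‖)⁻¹ := by positivity
          nlinarith
        have : 0 ≤ max (‖γ t‖ ^ 2 - 1) 0 := le_max_right _ _
        nlinarith [mul_nonneg this (neg_nonneg.2 h3)]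
    intro t ht
    have h1 := hanti (left_mem_Icc.2 zero_le_one) ht ht.1
    have h2 : ‖γ 0‖ ^ 2 - 1 ≤ 0 := by
      rw [h0]; have : ‖x‖ ≤ 1 := by simpa using hx
      nlinarith [norm_nonneg x]
    simp only [max_eq_right h2] at h1
    have h3 : max (‖γ t‖ ^ 2 - 1) 0 = 0 := by
      have : 0 ≤ max (‖γ t‖ ^ 2 - 1) 0 := le_max_right _ _
      nlinarith
    have h4 : ‖γ t‖ ^ 2 - 1 ≤ 0 := (le_max_left _ _).trans h3.le
    nlinarith [norm_nonneg (γ t)]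
  refine ⟨γ, h0, fun t ht => ⟨by simpa using hle t ht, ?_⟩⟩
  have := hγ t ht
  rwa [retract_of_norm_le (hle t ht)] at this

/-- Linear differential equations have global solutions. -/
theorem exists_solution_linear {E : Type*} [NormedAddCommGroup E] [InnerProductSpace ℝ E]
    [CompleteSpace E] {M : ℝ → E →L[ℝ] E} (hM : ContinuousOn M (Icc 0 1)) (v : E) :
    ∃ w : ℝ → E, w 0 = v ∧ ∀ t ∈ Icc (0 : ℝ) 1, HasDerivWithinAt w (M t (w t)) (Icc 0 1) t := by
  obtain ⟨K, hK⟩ := isCompact_Icc.exists_bound_of_continuousOn hM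
  have hK0 : 0 ≤ K := (norm_nonneg _).trans (hK 0 (by simp))
  -- Subtracting `K` makes the linear field inward on the unit sphere; the factor `exp (K * t)`
  -- undoes this at the end, and `‖v‖ + 1` undoes the scaling of `v` into the ball.
  set f : ℝ → E → E := fun t x => M t x - K • x with hf
  have hlin : ∀ t ∈ Icc (0 : ℝ) 1, ∀ x, ‖f t x‖ ≤ 2 * K * ‖x‖ := fun t ht x => by
    calc _ ≤ ‖M t x‖ + ‖K • x‖ := norm_sub_le _ _
      _ ≤ K * ‖x‖ + K * ‖x‖ := by
        rw [norm_smul, Real.norm_of_nonneg hK0]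
        gcongr
        exact (M t).le_of_opNorm_le (hK t ht) x
      _ = _ := by ring
  set v' : E := (‖v‖ + 1)⁻¹ • v
  have hv' : v' ∈ closedBall (0 : E) 1 := by
    rw [mem_closedBall_zero_iff, norm_smul, norm_inv, Real.norm_of_nonneg (by positivity),
      inv_mul_le_one₀ (by positivity)]
    linarith
  obtain ⟨γ, h0, hγ⟩ := exists_solution_of_inward (f := f) (K := ⟨2 * K, by positivity⟩)
    (L := ⟨2 * K, by positivity⟩)
    (fun t ht => LipschitzOnWith.of_dist_le_mul fun x _ y _ => by
      rw [dist_eq_norm, dist_eq_norm]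
      have : f t x - f t y = f t (x - y) := by simp only [hf, map_sub, smul_sub]; abel
      rw [this]
      exact hlin t ht _)
    (fun x _ => (hM.clm_apply continuousOn_const).sub continuousOn_const)
    (fun t ht x hx => (hlin t ht x).trans (by
      have : ‖x‖ ≤ 1 := by simpa using hx
      exact mul_le_of_le_one_right (by positivity) this))
    (fun t ht x hx => by
      simp only [hf, inner_sub_right, real_inner_smul_right, real_inner_self_eq_norm_sq, hx]
      have h1 : inner ℝ x (M t x) ≤ ‖x‖ * ‖M t x‖ := real_inner_le_norm _ _
      have h2 := (M t).le_of_opNorm_le (hK t ht) x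
      rw [hx] at h1 h2
      linarith) hv'
  refine ⟨fun t => ((‖v‖ + 1) * Real.exp (K * t)) • γ t, ?_, fun t ht => ?_⟩
  · simp [h0, v', smul_smul, mul_inv_cancel₀ (by positivity : ‖v‖ + 1 ≠ 0)]
  · have h1 : HasDerivAt (fun t => (‖v‖ + 1) * Real.exp (K * t))
        ((‖v‖ + 1) * (Real.exp (K * t) * K)) t := by
      simpa using (((hasDerivAt_id t).const_mul K).exp).const_mul (‖v‖ + 1)
    have := h1.hasDerivWithinAt.smul (hγ t ht).2
    refine this.congr_deriv ?_
    simp only [hf, smul_sub, map_smul, smul_smul]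
    rw [sub_add_eq_add_sub, add_sub_assoc]
    have h : ((‖v‖ + 1) * (Real.exp (K * t) * K)) • γ t =
      ((‖v‖ + 1) * Real.exp (K * t) * K) • γ t := by ring_nf
    rw [h]; abel

/-- Homogeneity lets the factor `‖s - s₀‖` be pulled out of the Grönwall estimate for the remainder.
-/
theorem gronwallBound_mul (r δ K ε x : ℝ) :
    gronwallBound (r * δ) K (r * ε) x = r * gronwallBound δ K ε x := by
  unfold gronwallBound
  split_ifs <;> ring

/-- Solutions of a differential equation depend differentiably on the initial value, the derivative
being the solution of the linearized equation. -/
theorem hasDerivWithinAt_solution {E : Type*} [NormedAddCommGroup E] [NormedSpace ℝ E]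
    {f : E → E} {f' : E → E →L[ℝ] E} {C : Set E} {K : ℝ≥0}
    (hlip : LipschitzOnWith K f C) (hbound : ∀ x ∈ C, ‖f' x‖ ≤ K)
    (hunif : ∀ ε > 0, ∃ δ > 0, ∀ x ∈ C, ∀ y ∈ C, ‖x - y‖ < δ →
      ‖f x - f y - f' y (x - y)‖ ≤ ε * ‖x - y‖)
    {S : Set ℝ} {s₀ : ℝ} (hs₀ : s₀ ∈ S) {y : ℝ → ℝ → E}
    (hC : ∀ s ∈ S, ∀ t ∈ Icc (0 : ℝ) 1, y s t ∈ C)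
    (hy : ∀ s ∈ S, ∀ t ∈ Icc (0 : ℝ) 1, HasDerivWithinAt (y s) (f (y s t)) (Icc 0 1) t)
    {w : ℝ → E}
    (hw : ∀ t ∈ Icc (0 : ℝ) 1, HasDerivWithinAt w (f' (y s₀ t) (w t)) (Icc 0 1) t)
    (h0 : HasDerivWithinAt (fun s => y s 0) (w 0) S s₀) {t : ℝ} (ht : t ∈ Icc (0 : ℝ) 1) :
    HasDerivWithinAt (fun s => y s t) (w t) S s₀ := by
  have hIco : ∀ {t : ℝ}, t ∈ Ico (0 : ℝ) 1 → t ∈ Icc (0 : ℝ) 1 := fun h => ⟨h.1, h.2.le⟩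
  rw [hasDerivWithinAt_iff_isLittleO, Asymptotics.isLittleO_iff] at h0 ⊢
  intro c hc
  set G := gronwallBound 1 K 1 1 with hG
  have hmono := gronwallBound_mono (δ := 1) (ε := 1) zero_le_one zero_le_one K.coe_nonneg
  have hG1 : 1 ≤ G := by
    simpa [gronwallBound_x0] using hmono (zero_le_one' ℝ)
  set M := (‖w 0‖ + 1) * Real.exp K with hM
  have hM0 : 0 < M := by positivity
  set c₁ := c / G with hc₁
  have hc₁0 : 0 < c₁ := by positivity
  -- Trajectories stay within `‖s - s₀‖ * M` of the base one, so accuracy `c₁ / M` bounds the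
  -- linearization error by `‖s - s₀‖ * c₁`; the choice `c₁ = c / G` absorbs the Grönwall factor.
  obtain ⟨δ, hδ, hd⟩ := hunif (c₁ / M) (by positivity)
  have hsmall : ∀ᶠ s in 𝓝[S] s₀, ‖s - s₀‖ * M < δ := by
    have : Tendsto (fun s : ℝ => ‖s - s₀‖ * M) (𝓝[S] s₀) (𝓝 0) := by
      have : Continuous (fun s : ℝ => ‖s - s₀‖ * M) := by fun_prop
      simpa using (this.tendsto s₀).mono_left nhdsWithin_le_nhds
    exact this.eventually (gt_mem_nhds hδ)
  filter_upwards [h0 hc₁0, h0 one_pos, hsmall, self_mem_nhdsWithin] with s h1 h2 h3 hs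
  have hinit : dist (y s 0) (y s₀ 0) ≤ ‖s - s₀‖ * (‖w 0‖ + 1) := by
    rw [dist_eq_norm]
    calc ‖y s 0 - y s₀ 0‖ = ‖(y s 0 - y s₀ 0 - (s - s₀) • w 0) + (s - s₀) • w 0‖ := by simp
      _ ≤ 1 * ‖s - s₀‖ + ‖s - s₀‖ * ‖w 0‖ := by
        refine (norm_add_le _ _).trans (add_le_add h2 ?_)
        rw [norm_smul]
      _ = _ := by ring
  have hdist : ∀ t ∈ Icc (0 : ℝ) 1, ‖y s t - y s₀ t‖ ≤ ‖s - s₀‖ * M := fun t ht => by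
    have := dist_le_of_trajectories_ODE_of_mem (v := fun _ => f) (s := fun _ => C) (K := K)
      (a := 0) (b := 1) (fun _ _ => hlip)
      (fun t ht => (hy s hs t ht).continuousWithinAt)
      (fun t ht => hasDerivWithinAt_Ici (hy s hs t (hIco ht)) ht)
      (fun t ht => hC s hs t (hIco ht))
      (fun t ht => (hy s₀ hs₀ t ht).continuousWithinAt)
      (fun t ht => hasDerivWithinAt_Ici (hy s₀ hs₀ t (hIco ht)) ht)
      (fun t ht => hC s₀ hs₀ t (hIco ht)) hinit t ht
    rw [dist_eq_norm] at this
    refine this.trans ?_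
    rw [hM, ← mul_assoc]
    gcongr
    nlinarith [ht.2, K.coe_nonneg]
  have key := norm_le_gronwallBound_of_norm_deriv_right_le
    (f := fun t => y s t - y s₀ t - (s - s₀) • w t)
    (f' := fun t => f (y s t) - f (y s₀ t) - (s - s₀) • f' (y s₀ t) (w t))
    (δ := ‖s - s₀‖ * c₁) (K := K) (ε := ‖s - s₀‖ * c₁) (a := 0) (b := 1)
    (fun t ht => (((hy s hs t ht).sub (hy s₀ hs₀ t ht)).sub
      ((hw t ht).const_smul (s - s₀))).continuousWithinAt)
    (fun t ht => hasDerivWithinAt_Ici (((hy s hs t (hIco ht)).sub (hy s₀ hs₀ t (hIco ht))).sub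
      ((hw t (hIco ht)).const_smul (s - s₀))) ht)
    (by rw [mul_comm]; exact h1)
    (fun t ht => by
      have ht := hIco ht
      have e : f (y s t) - f (y s₀ t) - (s - s₀) • f' (y s₀ t) (w t) =
          f' (y s₀ t) (y s t - y s₀ t - (s - s₀) • w t) +
          (f (y s t) - f (y s₀ t) - f' (y s₀ t) (y s t - y s₀ t)) := by
        simp only [map_sub, map_smul]; abel
      rw [e]
      refine (norm_add_le _ _).trans (add_le_add ?_ ?_)
      · exact (f' (y s₀ t)).le_of_opNorm_le (hbound _ (hC s₀ hs₀ t ht)) _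
      · refine (hd _ (hC s hs t ht) _ (hC s₀ hs₀ t ht)
          ((hdist t ht).trans_lt h3)).trans ?_
        calc _ ≤ c₁ / M * (‖s - s₀‖ * M) := by gcongr; exact hdist t ht
          _ = _ := by field_simp) t ht
  refine key.trans ?_
  rw [sub_zero, show c₁ = c₁ * 1 by ring, gronwallBound_mul, gronwallBound_mul]
  have := hmono ht.2
  calc _ ≤ ‖s - s₀‖ * (c₁ * G) := by gcongr
    _ = c * ‖s - s₀‖ := by rw [hc₁]; field_simp

end ODEBall

/-! ### Uniform estimates for continuously differentiable maps on compact convex sets -/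

section CompactConvex

variable {E F : Type*} [NormedAddCommGroup E] [NormedSpace ℝ E] [NormedAddCommGroup F]
  [NormedSpace ℝ F] {C : Set E} {g : E → F}

theorem continuousOn_fderiv_of_contDiffAt (hg : ∀ x ∈ C, ContDiffAt ℝ 1 g x) :
    ContinuousOn (fderiv ℝ g) C := fun x hx =>
  ((hg x hx).continuousAt_fderiv one_ne_zero).continuousWithinAt

theorem exists_lipschitzOnWith_of_contDiffAt (hC : IsCompact C) (hconv : Convex ℝ C)
    (hg : ∀ x ∈ C, ContDiffAt ℝ 1 g x) :
    ∃ K : ℝ≥0, (∀ x ∈ C, ‖fderiv ℝ g x‖ ≤ K) ∧ LipschitzOnWith K g C := by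
  obtain ⟨K, hK⟩ := hC.exists_bound_of_continuousOn (continuousOn_fderiv_of_contDiffAt hg)
  have hK' : ∀ x ∈ C, ‖fderiv ℝ g x‖₊ ≤ K.toNNReal := fun x hx => by
    rw [← NNReal.coe_le_coe]
    exact (hK x hx).trans (Real.le_coe_toNNReal K)
  exact ⟨K.toNNReal, hK', hconv.lipschitzOnWith_of_nnnorm_fderiv_le
    (fun x hx => (hg x hx).differentiableAt one_ne_zero) hK'⟩

/-- The derivative is uniformly continuous on the compact set; the mean value inequality is applied
on its convex intersection with a small ball. -/
theorem uniform_differentiability (hC : IsCompact C) (hconv : Convex ℝ C)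
    (hg : ∀ x ∈ C, ContDiffAt ℝ 1 g x) {ε : ℝ} (hε : 0 < ε) :
    ∃ δ > 0, ∀ x ∈ C, ∀ y ∈ C, ‖x - y‖ < δ →
      ‖g x - g y - fderiv ℝ g y (x - y)‖ ≤ ε * ‖x - y‖ := by
  have huc := hC.uniformContinuousOn_of_continuous (continuousOn_fderiv_of_contDiffAt hg)
  obtain ⟨δ, hδ, h⟩ := Metric.uniformContinuousOn_iff.1 huc ε hε
  refine ⟨δ, hδ, fun x hx y hy hxy => ?_⟩
  have hcv : Convex ℝ (C ∩ ball y δ) := hconv.inter (convex_ball y δ)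
  refine hcv.norm_image_sub_le_of_norm_hasFDerivWithin_le' (f' := fderiv ℝ g)
    (fun z hz => ((hg z hz.1).differentiableAt one_ne_zero).hasFDerivAt.hasFDerivWithinAt)
    (fun z hz => ?_) ⟨hy, mem_ball_self hδ⟩ ⟨hx, by rwa [mem_ball, dist_eq_norm]⟩
  rw [← dist_eq_norm]
  exact (h z hz.1 y hy hz.2).le

end CompactConvex

/-! ### Planar one-forms without radial component and the maps preserving them -/

namespace RadialForm

open Complex

theorem apply_mul (l : ℂ →L[ℝ] ℝ) (c z : ℂ) : l (c * z) = c.re * l z + c.im * l (I * z) := by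
  have : c * z = c.re • z + c.im • (I * z) := by
    conv_lhs => rw [← re_add_im c]
    simp only [real_smul]; ring
  rw [this, map_add, map_smul, map_smul, smul_eq_mul, smul_eq_mul]

theorem apply_I_mul_ne_zero {l : ℂ →L[ℝ] ℝ} {z v : ℂ} (hz : z ≠ 0) (h : l z = 0) (hv : l v ≠ 0) :
    l (I * z) ≠ 0 := fun h' => hv <| by
  rw [← div_mul_cancel₀ v hz, apply_mul, h, h']; simp

theorem exists_smul_of_apply_eq_zero {l : ℂ →L[ℝ] ℝ} {z g : ℂ} (hz : z ≠ 0) (h : l z = 0)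
    (h' : l (I * z) ≠ 0) (hg : l g = 0) : ∃ r : ℝ, g = r • z := by
  rw [← div_mul_cancel₀ g hz, apply_mul, h, mul_zero, zero_add] at hg
  have him : (g / z).im = 0 := (mul_eq_zero.1 hg).resolve_right h'
  refine ⟨(g / z).re, ?_⟩
  have : ((g / z).re : ℂ) = g / z := by
    apply Complex.ext <;> simp [him]
  rw [real_smul, this, div_mul_cancel₀ _ hz]

/-- If the derivative of a curve is radial, then its direction is stationary. -/
theorem hasDerivAt_direction {h : ℝ → ℂ} {r s : ℝ} (hd : HasDerivAt h (r • h s) s) (h0 : h s ≠ 0) :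
    HasDerivAt (fun s => ‖h s‖⁻¹ • h s) 0 s := by
  have hn : ‖h s‖ ≠ 0 := norm_ne_zero_iff.2 h0
  have h1 : HasDerivAt (fun s => ‖h s‖) (r * ‖h s‖) s := by
    have h2 := (hd.norm_sq).sqrt (by positivity)
    simp only [Real.sqrt_sq (norm_nonneg _)] at h2
    refine h2.congr_deriv ?_
    rw [real_inner_smul_right, real_inner_self_eq_norm_sq]
    field_simp
  refine ((h1.inv hn).smul hd).congr_deriv ?_
  rw [smul_smul, ← add_smul]
  have : ‖h s‖⁻¹ * r + -(r * ‖h s‖) / ‖h s‖ ^ 2 = 0 := by field_simp; ring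
  exact (congrArg (· • h s) this).trans (zero_smul _ _)

variable {Ω U : Set ℂ} {G : ℂ → ℂ} {θ : ℂ → ℂ →L[ℝ] ℝ}

/-- This is the derivative of the identity `θ_p(p) = 0`, taken in the open set and extended to its
closure by continuity. -/
theorem apply_add_fderiv_eq_zero (hU : IsOpen U) (hUΩ : U ⊆ Ω) (hcl : Ω ⊆ closure U)
    (hθ : ∀ p ∈ Ω, ContDiffAt ℝ 1 θ p) (hrad : ∀ p ∈ Ω, θ p p = 0) {p : ℂ} (hp : p ∈ Ω) (v : ℂ) :
    θ p v + fderiv ℝ θ p v p = 0 := by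
  have hon : EqOn (fun p => θ p v + fderiv ℝ θ p v p) (fun _ => 0) U := fun q hq => by
    have h1 : HasFDerivAt (fun q => θ q q) _ q :=
      ((hθ q (hUΩ hq)).differentiableAt one_ne_zero).hasFDerivAt.clm_apply (hasFDerivAt_id q)
    have h2 : HasFDerivAt (fun q => θ q q) (0 : ℂ →L[ℝ] ℝ) q :=
      (hasFDerivAt_const (0 : ℝ) q).congr_of_eventuallyEq
        (eventually_of_mem (hU.mem_nhds hq) fun x hx => hrad x (hUΩ hx))
    simpa using DFunLike.congr_fun (h1.unique h2) v
  refine hon.of_subset_closure ?_ continuousOn_const hUΩ hcl hp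
  have hc : ContinuousOn θ Ω := fun q hq => (hθ q hq).continuousAt.continuousWithinAt
  exact (hc.clm_apply continuousOn_const).add
    (((continuousOn_fderiv_of_contDiffAt hθ).clm_apply continuousOn_const).clm_apply continuousOn_id)

/-- The term `θ(ie)` produced by the product rule is traded, through `hrad'`, for a derivative of
`θ`; what remains is `s` times the exterior derivative on `e`, `ie`. -/
theorem hasDerivAt_ray (hθ : ∀ p ∈ Ω, ContDiffAt ℝ 1 θ p)
    (hrad' : ∀ p ∈ Ω, ∀ v, θ p v + fderiv ℝ θ p v p = 0) {e : ℂ} {s : ℝ} (hs : s • e ∈ Ω) :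
    HasDerivAt (fun s : ℝ => θ (s • e) (I * (s • e)))
      (s * (fderiv ℝ θ (s • e) e (I * e) - fderiv ℝ θ (s • e) (I * e) e)) s := by
  have h1 : HasDerivAt (fun s : ℝ => s • e) e s := by
    simpa using (hasDerivAt_id s).smul_const e
  have h2 : HasDerivAt (fun s : ℝ => θ (s • e)) (fderiv ℝ θ (s • e) e) s :=
    ((hθ _ hs).differentiableAt one_ne_zero).hasFDerivAt.comp_hasDerivAt s h1
  refine (h2.clm_apply (h1.const_mul I)).congr_deriv ?_
  have h3 := hrad' _ hs (I * e)
  rw [map_smul, smul_eq_mul] at h3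
  rw [mul_smul_comm, map_smul, smul_eq_mul]
  linarith

/-- By Rolle, equal values would give a zero of `s dθ(e, ie)` at some `s > s₁ ≥ 0`. -/
theorem ray_injective (hθ : ∀ p ∈ Ω, ContDiffAt ℝ 1 θ p)
    (hrad' : ∀ p ∈ Ω, ∀ v, θ p v + fderiv ℝ θ p v p = 0)
    (hω : ∀ p ∈ Ω, ∀ v ≠ 0, fderiv ℝ θ p v (I * v) ≠ fderiv ℝ θ p (I * v) v)
    {e : ℂ} (he : e ≠ 0) {s₁ s₂ : ℝ} (h0 : 0 ≤ s₁) (h12 : s₁ < s₂)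
    (hs : ∀ s ∈ Icc s₁ s₂, s • e ∈ Ω) :
    θ (s₁ • e) (I * (s₁ • e)) ≠ θ (s₂ • e) (I * (s₂ • e)) := fun h => by
  obtain ⟨s, hs', h'⟩ := exists_hasDerivAt_eq_zero h12
    (fun s h => (hasDerivAt_ray hθ hrad' (hs s h)).continuousAt.continuousWithinAt) h
    (fun s h => hasDerivAt_ray hθ hrad' (hs s (Ioo_subset_Icc_self h)))
  rcases mul_eq_zero.1 h' with h' | h'
  · linarith [hs'.1]
  · exact hω _ (hs s (Ioo_subset_Icc_self hs')) e he (sub_eq_zero.1 h')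

/-- If `G p` were the origin, `hrad'` there would give `θ = 0`, against preservation of the nonzero
value `θ_p(ip)`; away from the origin the kernel at `G p` is exactly the radial line. -/
theorem ne_zero_of_map (hGΩ : MapsTo G Ω Ω) (hUΩ : U ⊆ Ω) (hrad : ∀ p ∈ Ω, θ p p = 0)
    (hrad' : ∀ p ∈ Ω, ∀ v, θ p v + fderiv ℝ θ p v p = 0)
    (hG : ∀ p ∈ U, ∀ v, ∃ g, HasDerivAt (fun s : ℝ => G (p + s • v)) g 0 ∧ θ (G p) g = θ p v)
    {p : ℂ} (hp : p ∈ U) (ha : θ p (I * p) ≠ 0) :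
    G p ≠ 0 ∧ θ (G p) (I * G p) ≠ 0 := by
  obtain ⟨g, -, hg⟩ := hG p hp (I * p)
  have hm := hGΩ (hUΩ hp)
  have h0 : G p ≠ 0 := fun h => by
    have := hrad' _ hm g
    rw [h] at this hg
    rw [map_zero, add_zero] at this
    exact ha (hg.symm.trans this)
  exact ⟨h0, apply_I_mul_ne_zero h0 (hrad _ hm) (hg ▸ ha)⟩

/-- Following a ray to the boundary, where `G` is the identity, shows that `G` preserves rays. -/
theorem exists_smul_of_ray (hGc : ContinuousOn G Ω) (hGΩ : MapsTo G Ω Ω)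
    (hUΩ : U ⊆ Ω) (hGb : ∀ p ∈ Ω \ U, G p = p) (hrad : ∀ p ∈ Ω, θ p p = 0)
    (hrad' : ∀ p ∈ Ω, ∀ v, θ p v + fderiv ℝ θ p v p = 0)
    (hG : ∀ p ∈ U, ∀ v, ∃ g, HasDerivAt (fun s : ℝ => G (p + s • v)) g 0 ∧ θ (G p) g = θ p v)
    {p : ℂ} (hp0 : p ≠ 0) {m : ℝ} (hm0 : 0 < m) (hm : m • p ∈ Ω \ U)
    (hseg : ∀ t ∈ Ico (0 : ℝ) 1, (1 + t * (m - 1)) • p ∈ U)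
    (ha : ∀ t ∈ Ico (0 : ℝ) 1, θ ((1 + t * (m - 1)) • p) (I * ((1 + t * (m - 1)) • p)) ≠ 0) :
    ∃ r : ℝ, 0 < r ∧ G p = r • p ∧ ∀ s ∈ uIcc 1 r, s • p ∈ Ω := by
  set σ : ℝ → ℂ := fun t => (1 + t * (m - 1)) • p with hσ
  have hσ0 : σ 0 = p := by simp [hσ]
  have hσ1 : σ 1 = m • p := by simp [hσ]
  have hσc : Continuous σ := by fun_prop
  have hσΩ : ∀ t ∈ Icc (0 : ℝ) 1, σ t ∈ Ω := fun t ht => by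
    rcases ht.2.eq_or_lt with h | h
    · rw [h, hσ1]; exact hm.1
    · exact hUΩ (hseg t ⟨ht.1, h⟩)
  have hc : ContinuousOn (fun t => G (σ t)) (Icc 0 1) := hGc.comp hσc.continuousOn hσΩ
  have hne : ∀ t ∈ Icc (0 : ℝ) 1, G (σ t) ≠ 0 := fun t ht => by
    rcases ht.2.eq_or_lt with h | h
    · rw [h, hσ1, hGb _ hm]; exact smul_ne_zero hm0.ne' hp0
    · exact (ne_zero_of_map hGΩ hUΩ hrad hrad' hG (hseg t ⟨ht.1, h⟩) (ha t ⟨ht.1, h⟩)).1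
  have hder : ∀ t ∈ Ico (0 : ℝ) 1, ∃ r : ℝ, HasDerivAt (fun t => G (σ t)) (r • G (σ t)) t := by
    intro t ht
    obtain ⟨g, hg, hg'⟩ := hG _ (hseg t ht) ((m - 1) • p)
    have h1 := (ne_zero_of_map hGΩ hUΩ hrad hrad' hG (hseg t ht) (ha t ht))
    have htΩ := hUΩ (hseg t ht)
    have h2 : θ (σ t) ((m - 1) • p) = 0 := by
      by_contra hcon
      have hs : (m - 1) • θ (σ t) p ≠ 0 := by rwa [map_smul] at hcon
      have : (1 + t * (m - 1)) • θ (σ t) p = 0 := by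
        rw [← map_smul]; exact hrad _ htΩ
      have hpos : (1 + t * (m - 1)) ≠ 0 := by nlinarith [ht.1, ht.2]
      rcases smul_eq_zero.1 this with h | h
      · exact hpos h
      · exact hs (by rw [h, smul_zero])
    obtain ⟨r, hr⟩ := exists_smul_of_apply_eq_zero h1.1 (hrad _ (hGΩ htΩ)) h1.2 (hg'.trans h2)
    refine ⟨r, ?_⟩
    rw [← hr]
    have h3 := HasDerivAt.comp_sub_const t t (f := fun s : ℝ => G (σ t + s • (m - 1) • p))
      (f' := g) (by rwa [sub_self])
    refine h3.congr_of_eventuallyEq (Eventually.of_forall fun x => ?_)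
    simp only [hσ]
    congr 1
    rw [smul_smul, ← add_smul]
    congr 1; ring
  -- The direction of `G` along the segment is constant up to `t = 1`, where `G` is the identity, so
  -- it is the direction of `p`.
  have hdir := constant_of_has_deriv_right_zero (f := fun t => ‖G (σ t)‖⁻¹ • G (σ t))
    (a := 0) (b := 1)
    ((hc.norm.inv₀ fun t ht => norm_ne_zero_iff.2 (hne t ht)).smul hc)
    (fun t ht => by
      obtain ⟨r, hr⟩ := hder t ht
      exact (hasDerivAt_direction hr (hne t ⟨ht.1, ht.2.le⟩)).hasDerivWithinAt)
  have hpn : 0 < ‖p‖ := norm_pos_iff.2 hp0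
  have hray : ∀ t ∈ Icc (0 : ℝ) 1, G (σ t) = (‖G (σ t)‖ * ‖p‖⁻¹) • p := fun t ht => by
    have h1 := (hdir t ht).trans (hdir 1 (by simp)).symm
    simp only [hσ1, hGb _ hm, norm_smul, Real.norm_of_nonneg hm0.le] at h1
    have hn : ‖G (σ t)‖ ≠ 0 := norm_ne_zero_iff.2 (hne t ht)
    calc G (σ t) = ‖G (σ t)‖ • ‖G (σ t)‖⁻¹ • G (σ t) := by rw [smul_inv_smul₀ hn]
      _ = _ := by
        rw [h1, smul_smul, smul_smul]
        congr 1; field_simp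
  refine ⟨‖G p‖ * ‖p‖⁻¹, ?_, ?_, ?_⟩
  · have := hne 0 (by simp)
    rw [hσ0] at this
    positivity
  · have := hray 0 (by simp)
    rwa [hσ0] at this
  · have hm1 : ∀ s ∈ uIcc 1 m, s • p ∈ Ω := fun s hs => by
      rw [← segment_eq_uIcc, segment_eq_image'] at hs
      obtain ⟨t, ht, rfl⟩ := hs
      simpa [hσ] using hσΩ t ht
    -- The image of the segment under `G` lies in `Ω` and on the ray, and by the intermediate value
    -- theorem it sweeps everything between `G p` and the boundary point.
    have hm2 : ∀ s ∈ uIcc (‖G p‖ * ‖p‖⁻¹) m, s • p ∈ Ω := fun s hs => by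
      have hcr : ContinuousOn (fun t => ‖G (σ t)‖ * ‖p‖⁻¹) (uIcc 0 1) := by
        rw [uIcc_of_le zero_le_one]
        exact hc.norm.mul continuousOn_const
      have := intermediate_value_uIcc hcr
      simp only [hσ0, hσ1, hGb _ hm, norm_smul, Real.norm_of_nonneg hm0.le] at this
      rw [mul_assoc, mul_inv_cancel₀ hpn.ne', mul_one] at this
      obtain ⟨t, ht, rfl⟩ := this hs
      rw [uIcc_of_le zero_le_one] at ht
      simp only
      rw [← hray t ht]
      exact hGΩ (hσΩ t ht)
    intro s hs
    rcases (uIcc_subset_uIcc_union_uIcc (b := m)) hs with h | h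
    · exact hm1 s h
    · exact hm2 s (by rwa [uIcc_comm])

/-- From a point of `U` that is not a zero of the angular component, one of the two directions of
the ray leads to the boundary without meeting a zero. -/
theorem exists_ray_to_boundary (hΩ : IsCompact Ω) (hU : IsOpen U) (hUΩ : U ⊆ Ω) (h0 : (0 : ℂ) ∈ U)
    (hθ : ∀ p ∈ Ω, ContDiffAt ℝ 1 θ p)
    (hrad' : ∀ p ∈ Ω, ∀ v, θ p v + fderiv ℝ θ p v p = 0)
    (hω : ∀ p ∈ Ω, ∀ v ≠ 0, fderiv ℝ θ p v (I * v) ≠ fderiv ℝ θ p (I * v) v)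
    {p : ℂ} (hp : p ∈ U) (hp0 : p ≠ 0) (hap : θ p (I * p) ≠ 0) :
    ∃ m : ℝ, 0 < m ∧ m • p ∈ Ω \ U ∧ (∀ t ∈ Ico (0 : ℝ) 1, (1 + t * (m - 1)) • p ∈ U) ∧
      ∀ t ∈ Ico (0 : ℝ) 1, θ ((1 + t * (m - 1)) • p) (I * ((1 + t * (m - 1)) • p)) ≠ 0 := by
  have hclU : closure U ⊆ Ω := closure_minimal hUΩ hΩ.isClosed
  have hcont : Continuous fun s : ℝ => s • p := by fun_prop
  have hclosed : IsClosed {s : ℝ | s • p ∉ U} := (hU.preimage hcont).isClosed_compl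
  have hpn : 0 < ‖p‖ := norm_pos_iff.2 hp0
  obtain ⟨R, hR⟩ := hΩ.isBounded.exists_norm_le
  have hinj := fun {s₁ s₂ : ℝ} (h0 : 0 ≤ s₁) (h12 : s₁ < s₂) hs =>
    ray_injective hθ hrad' hω hp0 (s₁ := s₁) (s₂ := s₂) h0 h12 hs
  -- the first exit from `U` along the outward ray
  obtain ⟨m, hm1, hmU, hmseg⟩ : ∃ m : ℝ, 1 < m ∧ m • p ∉ U ∧ ∀ s ∈ Ico 1 m, s • p ∈ U := by
    set A := {s : ℝ | s • p ∉ U} ∩ Ici 1 with hA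
    have hAc : IsClosed A := hclosed.inter isClosed_Ici
    have hAne : A.Nonempty := by
      refine ⟨max 1 ((R + 1) / ‖p‖), fun h => ?_, mem_Ici.2 (le_max_left _ _)⟩
      have h1 := hR _ (hUΩ h)
      have h2 : (R + 1) / ‖p‖ ≤ max 1 ((R + 1) / ‖p‖) := le_max_right _ _
      rw [div_le_iff₀ hpn] at h2
      rw [norm_smul, Real.norm_of_nonneg (by positivity)] at h1
      linarith
    have hAb : BddBelow A := ⟨1, fun s hs => hs.2⟩
    have hmem := hAc.csInf_mem hAne hAb
    refine ⟨sInf A, lt_of_le_of_ne hmem.2 fun h => ?_, hmem.1, fun s hs => ?_⟩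
    · have := hmem.1
      rw [← h] at this
      simp [hp] at this
    · by_contra hcon
      exact absurd (csInf_le hAb ⟨hcon, hs.1⟩) (not_le.2 hs.2)
  have hexit : ∀ {a b : ℝ} {m : ℝ}, m ∈ closure (Ioo a b) → (∀ s ∈ Ioo a b, s • p ∈ U) →
      m • p ∈ Ω := fun hm h =>
    hclU (map_mem_closure (f := fun s : ℝ => s • p) hcont hm h)
  have hmΩ : m • p ∈ Ω := hexit (a := 1) (b := m) (by
    rw [closure_Ioo hm1.ne]; exact right_mem_Icc.2 hm1.le) fun s hs => hmseg s ⟨hs.1.le, hs.2⟩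
  by_cases hz : ∀ s ∈ Ico 1 m, θ (s • p) (I * (s • p)) ≠ 0
  · have hI : ∀ t ∈ Ico (0 : ℝ) 1, 1 + t * (m - 1) ∈ Ico 1 m := fun t ht =>
      ⟨by nlinarith [ht.1], by nlinarith [ht.2]⟩
    exact ⟨m, by linarith, ⟨hmΩ, hmU⟩, fun t ht => hmseg _ (hI t ht), fun t ht => hz _ (hI t ht)⟩
  push Not at hz
  obtain ⟨s₁, hs₁, hz₁⟩ := hz
  have hs₁' : 1 < s₁ := lt_of_le_of_ne hs₁.1 fun h => by
    rw [← h, one_smul] at hz₁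
    exact hap hz₁
  have hup : ∀ s ∈ Icc 1 s₁, s • p ∈ U := fun s hs => hmseg s ⟨hs.1, hs.2.trans_lt hs₁.2⟩
  -- the first exit from `U` along the inward ray
  obtain ⟨n, hn0, hn1, hnU, hnseg⟩ : ∃ n : ℝ, 0 < n ∧ n < 1 ∧ n • p ∉ U ∧
      ∀ s ∈ Ioc n 1, s • p ∈ U := by
    set A := {s : ℝ | s • p ∉ U} ∩ Icc 0 1 with hA
    have hAc : IsClosed A := hclosed.inter isClosed_Icc
    have hAb : BddAbove A := ⟨1, fun s hs => hs.2.2⟩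
    have hAne : A.Nonempty := by
      by_contra hcon
      rw [not_nonempty_iff_eq_empty] at hcon
      have hdown : ∀ s ∈ Icc (0 : ℝ) 1, s • p ∈ U := fun s hs => by
        by_contra h
        exact (hcon ▸ (⟨h, hs⟩ : s ∈ A) : s ∈ (∅ : Set ℝ))
      -- If the inward ray reached the origin inside `U`, the angular component would vanish both
      -- there and at `s₁`.
      refine hinj (s₁ := 0) le_rfl (zero_lt_one.trans hs₁') (fun s hs => hUΩ ?_) ?_
      · rcases le_total s 1 with h | h
        · exact hdown s ⟨hs.1, h⟩
        · exact hup s ⟨h, hs.2⟩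
      · rw [hz₁]; simp
    have hmem := hAc.csSup_mem hAne hAb
    refine ⟨sSup A, lt_of_le_of_ne hmem.2.1 fun h => ?_, lt_of_le_of_ne hmem.2.2 fun h => ?_,
      hmem.1, fun s hs => ?_⟩
    · have := hmem.1
      rw [← h] at this
      simp [h0] at this
    · have := hmem.1
      rw [h] at this
      simp [hp] at this
    · by_contra hcon
      exact absurd (le_csSup hAb ⟨hcon, hmem.2.1.trans hs.1.le, hs.2⟩) (not_le.2 hs.1)
  have hnΩ : n • p ∈ Ω := hexit (a := n) (b := 1) (by
    rw [closure_Ioo hn1.ne]; exact left_mem_Icc.2 hn1.le) fun s hs => hnseg s ⟨hs.1, hs.2.le⟩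
  have hI : ∀ t ∈ Ico (0 : ℝ) 1, 1 + t * (n - 1) ∈ Ioc n 1 := fun t ht =>
    ⟨by nlinarith [ht.2], by nlinarith [ht.1]⟩
  refine ⟨n, hn0, ⟨hnΩ, hnU⟩, fun t ht => hnseg _ (hI t ht), fun t ht hcon => ?_⟩
  have ht' := hI t ht
  refine hinj (s₂ := s₁) (hn0.le.trans ht'.1.le) (ht'.2.trans_lt hs₁') (fun s hs => hUΩ ?_)
    (hcon.trans hz₁.symm)
  rcases le_total s 1 with h | h
  · exact hnseg s ⟨ht'.1.trans_le hs.1, h⟩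
  · exact hup s ⟨h, hs.2⟩

/-- A self-map of a planar region that fixes the boundary and preserves a one-form without radial
component and with non-vanishing exterior derivative is the identity. -/
theorem eqOn_id (hΩ : IsCompact Ω) (hU : IsOpen U) (hUΩ : U ⊆ Ω) (hcl : Ω ⊆ closure U)
    (h0 : (0 : ℂ) ∈ U) (hGc : ContinuousOn G Ω) (hGΩ : MapsTo G Ω Ω)
    (hGb : ∀ p ∈ Ω \ U, G p = p) (hθ : ∀ p ∈ Ω, ContDiffAt ℝ 1 θ p) (hrad : ∀ p ∈ Ω, θ p p = 0)
    (hω : ∀ p ∈ Ω, ∀ v ≠ 0, fderiv ℝ θ p v (I * v) ≠ fderiv ℝ θ p (I * v) v)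
    (hG : ∀ p ∈ U, ∀ v, ∃ g, HasDerivAt (fun s : ℝ => G (p + s • v)) g 0 ∧ θ (G p) g = θ p v) :
    EqOn G id Ω := by
  have hrad' : ∀ p ∈ Ω, ∀ v, θ p v + fderiv ℝ θ p v p = 0 := fun p hp v =>
    apply_add_fderiv_eq_zero hU hUΩ hcl hθ hrad hp v
  have hray : ∀ p ∈ U, θ p (I * p) ≠ 0 →
      ∃ r : ℝ, 0 < r ∧ G p = r • p ∧ ∀ s ∈ uIcc 1 r, s • p ∈ Ω := fun p hp hap => by
    have hp0 : p ≠ 0 := fun h => hap (by simp [h])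
    obtain ⟨m, hm0, hm, hseg, ha⟩ := exists_ray_to_boundary hΩ hU hUΩ h0 hθ hrad' hω hp hp0 hap
    exact exists_smul_of_ray hGc hGΩ hUΩ hGb hrad hrad' hG hp0 hm0 hm hseg ha
  have hθc : ContinuousOn (fun p => θ p (I * p)) Ω := by
    have hc : ContinuousOn θ Ω := fun q hq => (hθ q hq).continuousAt.continuousWithinAt
    exact hc.clm_apply (by fun_prop)
  have hfix : ∀ p ∈ U, θ p (I * p) ≠ 0 → G p = p := fun p hp hap => by
    have hp0 : p ≠ 0 := fun h => hap (by simp [h])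
    obtain ⟨r, hr0, hr, hseg⟩ := hray p hp hap
    obtain ⟨g, hg, hg'⟩ := hG p hp (I * p)
    have hq : HasDerivAt (fun s : ℝ => p + s • (I * p)) (I * p) 0 := by
      simpa using ((hasDerivAt_id (0 : ℝ)).smul_const (I * p)).const_add p
    have hk := hg.div hq (by simpa using hp0)
    have hnear : ∀ᶠ s : ℝ in 𝓝 0, p + s • (I * p) ∈ U ∧
        θ (p + s • (I * p)) (I * (p + s • (I * p))) ≠ 0 := by
      have hc : Tendsto (fun s : ℝ => p + s • (I * p)) (𝓝 0) (𝓝 p) := by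
        simpa using hq.continuousAt.tendsto
      have h1 : ∀ᶠ q in 𝓝 p, q ∈ U ∧ θ q (I * q) ≠ 0 := by
        filter_upwards [hU.mem_nhds hp,
          ((hθc.mono hUΩ).continuousAt (hU.mem_nhds hp)).eventually_ne hap] with q h1 h2
        exact ⟨h1, h2⟩
      exact hc.eventually h1
    -- This is the derivative of `G q / q` in the angular direction; the quotient is real near `p`
    -- because `G` preserves rays, so `d` is real.
    set d := (g * (p + (0 : ℝ) • (I * p)) - G (p + (0 : ℝ) • (I * p)) * (I * p)) /
      (p + (0 : ℝ) • (I * p)) ^ 2 with hd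
    have hdim : d.im = 0 := by
      have h1 : HasDerivAt (fun s : ℝ => (G (p + s • (I * p)) / (p + s • (I * p))).im) d.im 0 :=
        imCLM.hasFDerivAt.comp_hasDerivAt (0 : ℝ) hk
      have h2 : (fun s : ℝ => (G (p + s • (I * p)) / (p + s • (I * p))).im) =ᶠ[𝓝 0]
          fun _ => (0 : ℝ) := by
        filter_upwards [hnear] with s hs
        obtain ⟨r', -, hr', -⟩ := hray _ hs.1 hs.2
        have hne : p + s • (I * p) ≠ 0 := fun h => hs.2 (by rw [h]; simp)
        rw [hr', real_smul, mul_div_assoc, div_self hne]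
        simp
      exact h1.unique ((hasDerivAt_const (0 : ℝ) (0 : ℝ)).congr_of_eventuallyEq h2)
    have hgd : g = (d + r * I) * p := by
      simp only [zero_smul, add_zero, hr, real_smul] at hd
      rw [hd]; field_simp; ring
    have hI := hrad _ (hUΩ hp)
    have hGp : θ (r • p) p = 0 := by
      have := hrad _ (hr ▸ hGΩ (hUΩ hp))
      rw [map_smul, smul_eq_mul] at this
      exact (mul_eq_zero.1 this).resolve_left hr0.ne'
    -- The part `d * p` of `g` is radial and invisible to `θ`, which leaves the angular part `r * I
    -- * p`.
    have hval : θ ((1 : ℝ) • p) (I * ((1 : ℝ) • p)) = θ (r • p) (I * (r • p)) := by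
      rw [one_smul, ← hg', hr, hgd, apply_mul, hGp, mul_smul_comm, map_smul, smul_eq_mul]
      simp [hdim]
    rcases lt_trichotomy 1 r with h | h | h
    · exact absurd hval (ray_injective hθ hrad' hω hp0 zero_le_one h
        fun s hs => hseg s (by rwa [uIcc_of_le h.le]))
    · rw [hr, ← h, one_smul]
    · exact absurd hval.symm (ray_injective hθ hrad' hω hp0 hr0.le h
        fun s hs => hseg s (by rwa [uIcc_of_ge h.le]))
  -- Moving outwards from a zero along its ray makes the angular component nonzero at once; from the
  -- origin any direction serves, here `1`.
  have hdense : U ⊆ closure {p | p ∈ U ∧ θ p (I * p) ≠ 0} := fun p hp => by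
    by_cases hap : θ p (I * p) = 0
    swap
    · exact subset_closure ⟨hp, hap⟩
    obtain ⟨e, s₀, he, hs₀, rfl⟩ : ∃ (e : ℂ) (s₀ : ℝ), e ≠ 0 ∧ 0 ≤ s₀ ∧ s₀ • e = p := by
      by_cases h : p = 0
      · exact ⟨1, 0, one_ne_zero, le_rfl, by simp [h]⟩
      · exact ⟨p, 1, h, zero_le_one, one_smul _ _⟩
    have hc : Continuous fun s : ℝ => s • e := by fun_prop
    obtain ⟨δ, hδ, hball⟩ := Metric.isOpen_iff.1 (hU.preimage hc) s₀ hp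
    have hin : ∀ s ∈ Ico s₀ (s₀ + δ), s • e ∈ U := fun s hs => hball (by
      rw [mem_ball, Real.dist_eq, abs_of_nonneg (by linarith [hs.1])]; linarith [hs.2])
    have hcl' : s₀ ∈ closure (Ioo s₀ (s₀ + δ)) := by
      rw [closure_Ioo (by linarith)]; exact ⟨le_rfl, by linarith⟩
    refine map_mem_closure (f := fun s : ℝ => s • e) hc hcl' fun s hs => ⟨hin s ⟨hs.1.le, hs.2⟩, fun h => ?_⟩
    exact ray_injective hθ hrad' hω he hs₀ hs.1
      (fun s' hs' => hUΩ (hin s' ⟨hs'.1, hs'.2.trans_lt hs.2⟩)) (hap.trans h.symm)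
  have hon : EqOn G id {p | p ∈ U ∧ θ p (I * p) ≠ 0} := fun p hp => hfix p hp.1 hp.2
  refine hon.of_subset_closure hGc continuousOn_id (fun p hp => hUΩ hp.1) ?_
  exact hcl.trans (closure_minimal hdense isClosed_closure)

end RadialForm

/-! ### Transverse fields on the solid cylinder and their flow -/

namespace Cylinder

open E3

/-- The horizontal part of a vector of space, as a complex number. -/
noncomputable def plane : E3 →L[ℝ] ℂ :=
  Complex.equivRealProdCLM.symm.toContinuousLinearMap.comp
    ((EuclideanSpace.proj (0 : Fin 3) : E3 →L[ℝ] ℝ).prod (EuclideanSpace.proj (1 : Fin 3)))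

/-- The vertical unit vector. -/
noncomputable def vert : E3 := EuclideanSpace.single 2 1

/-- The inclusion of the plane as the horizontal vectors of space. -/
noncomputable def lift : ℂ →L[ℝ] E3 :=
  (Complex.reCLM.smulRight (EuclideanSpace.single 0 1 : E3)) +
    Complex.imCLM.smulRight (EuclideanSpace.single 1 1 : E3)

/-- The point of space over `x` at height `t`. -/
noncomputable def embed (x : ℂ) (t : ℝ) : E3 := lift x + t • vert

@[simp] theorem plane_re (y : E3) : (plane y).re = y 0 := by simp [plane]
@[simp] theorem plane_im (y : E3) : (plane y).im = y 1 := by simp [plane]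
@[simp] theorem lift_zero (x : ℂ) : lift x 0 = x.re := by simp [lift]
@[simp] theorem lift_one (x : ℂ) : lift x 1 = x.im := by simp [lift]
@[simp] theorem lift_two (x : ℂ) : lift x 2 = 0 := by simp [lift]
@[simp] theorem vert_zero : vert 0 = 0 := by simp [vert]
@[simp] theorem vert_one : vert 1 = 0 := by simp [vert]
@[simp] theorem vert_two : vert 2 = 1 := by simp [vert]
@[simp] theorem embed_zero (x : ℂ) (t : ℝ) : embed x t 0 = x.re := by simp [embed]
@[simp] theorem embed_one (x : ℂ) (t : ℝ) : embed x t 1 = x.im := by simp [embed]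
@[simp] theorem embed_two (x : ℂ) (t : ℝ) : embed x t 2 = t := by simp [embed]

theorem ext3 {y z : E3} (h0 : y 0 = z 0) (h1 : y 1 = z 1) (h2 : y 2 = z 2) : y = z := by
  ext i; fin_cases i <;> assumption

@[simp] theorem plane_lift (x : ℂ) : plane (lift x) = x := by
  apply Complex.ext <;> simp

@[simp] theorem plane_embed (x : ℂ) (t : ℝ) : plane (embed x t) = x := by
  apply Complex.ext <;> simp

@[simp] theorem plane_vert : plane vert = 0 := by
  apply Complex.ext <;> simp

theorem embed_plane (y : E3) : embed (plane y) (y 2) = y := by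
  apply ext3 <;> simp

theorem lift_plane {y : E3} (h : y 2 = 0) : lift (plane y) = y := by
  apply ext3 <;> simp [h]

theorem norm_lift (x : ℂ) : ‖lift x‖ = ‖x‖ := by
  rw [EuclideanSpace.norm_eq, Complex.norm_def, Complex.normSq_apply]
  simp [Fin.sum_univ_three, sq]

theorem norm_plane_sq (y : E3) : ‖plane y‖ ^ 2 = y 0 ^ 2 + y 1 ^ 2 := by
  rw [Complex.sq_norm, Complex.normSq_apply]; simp [sq]

theorem norm_plane_le_one_iff (y : E3) : ‖plane y‖ ≤ 1 ↔ y 0 ^ 2 + y 1 ^ 2 ≤ 1 := by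
  rw [← norm_plane_sq, sq_le_one_iff₀ (norm_nonneg _)]

theorem norm_plane_lt_one_iff (y : E3) : ‖plane y‖ < 1 ↔ y 0 ^ 2 + y 1 ^ 2 < 1 := by
  rw [← norm_plane_sq, sq_lt_one_iff₀ (norm_nonneg _)]

theorem mem_solidCylinder {y : E3} :
    y ∈ solidCylinder ↔ ‖plane y‖ ≤ 1 ∧ y 2 ∈ Icc (0 : ℝ) 1 := by
  rw [norm_plane_le_one_iff]; rfl

theorem embed_mem {x : ℂ} (hx : x ∈ closedBall (0 : ℂ) 1) {t : ℝ} (ht : t ∈ Icc (0 : ℝ) 1) :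
    embed x t ∈ solidCylinder := by
  rw [mem_solidCylinder]; simpa using ⟨by simpa using hx, ht⟩

theorem plane_mem {y : E3} (hy : y ∈ solidCylinder) : plane y ∈ closedBall (0 : ℂ) 1 := by
  simpa using (mem_solidCylinder.1 hy).1

theorem continuous_embed : Continuous fun p : ℂ × ℝ => embed p.1 p.2 := by
  unfold embed; fun_prop

theorem hasDerivAt_embed (x : ℂ) (t : ℝ) : HasDerivAt (embed x) vert t :=
  (((hasDerivAt_id t).smul_const vert).const_add (lift x)).congr_deriv (one_smul _ _)

theorem hasFDerivAt_embed (x : ℂ) (t : ℝ) : HasFDerivAt (fun x => embed x t) lift x := by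
  simpa [embed] using lift.hasFDerivAt.add_const (t • vert)

theorem hasDerivAt_expI (ψ : ℝ) : HasDerivAt (fun s : ℝ => Complex.exp (s * Complex.I))
    (Complex.I * Complex.exp (ψ * Complex.I)) ψ := by
  have := ((Complex.ofRealCLM.hasDerivAt (x := ψ)).mul_const Complex.I).cexp
  simpa [mul_comm] using this

theorem isCompact_solidCylinder : IsCompact solidCylinder := by
  have : solidCylinder = (fun p : ℂ × ℝ => embed p.1 p.2) '' (closedBall 0 1 ×ˢ Icc 0 1) := by
    ext y
    constructor
    · intro hy
      exact ⟨(plane y, y 2), ⟨plane_mem hy, hy.2⟩, embed_plane y⟩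
    · rintro ⟨p, hp, rfl⟩
      exact embed_mem hp.1 hp.2
  rw [this]
  exact ((isCompact_closedBall _ _).prod isCompact_Icc).image continuous_embed

theorem convex_solidCylinder : Convex ℝ solidCylinder := by
  have : solidCylinder = plane ⁻¹' closedBall 0 1 ∩
      (EuclideanSpace.proj (2 : Fin 3) : E3 →L[ℝ] ℝ) ⁻¹' Icc 0 1 := by
    ext y; rw [mem_solidCylinder]; simp
  rw [this]
  exact ((convex_closedBall _ _).is_linear_preimage plane.isBoundedLinearMap.toIsLinearMap).inter
    ((convex_Icc _ _).is_linear_preimage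
      (EuclideanSpace.proj (2 : Fin 3) : E3 →L[ℝ] ℝ).isBoundedLinearMap.toIsLinearMap)

/-- A continuously differentiable vector field on the solid cylinder with unit vertical component,
tangent to the side. -/
structure IsTransverseField (u : E3 → E3) : Prop where
  contDiff : ∀ y ∈ solidCylinder, ContDiffAt ℝ 1 u y
  vertical : ∀ y ∈ solidCylinder, ∀ᶠ z in 𝓝 y, u z 2 = 1
  tangent : ∀ y ∈ solidCylinder, ‖plane y‖ = 1 → inner ℝ (plane y) (plane (u y)) = 0

/-- The integral curves of a transverse field. -/
structure IsFlowLine (u : E3 → E3) (x : ℂ) (η : ℝ → E3) : Prop where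
  start : η 0 = embed x 0
  mem : ∀ t ∈ Icc (0 : ℝ) 1, η t ∈ solidCylinder
  deriv : ∀ t ∈ Icc (0 : ℝ) 1, HasDerivWithinAt η (u (η t)) (Icc 0 1) t

variable {u : E3 → E3} {x : ℂ} {η : ℝ → E3}

theorem IsTransverseField.exists_isFlowLine (hu : IsTransverseField u)
    (hx : x ∈ closedBall (0 : ℂ) 1) : ∃ η, IsFlowLine u x η := by
  have hC : ∀ y ∈ solidCylinder, ContDiffAt ℝ 1 (fun y => plane (u y)) y := fun y hy =>
    plane.contDiff.contDiffAt.comp y (hu.contDiff y hy)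
  have hcont : ContinuousOn (fun y => plane (u y)) solidCylinder := fun y hy =>
    (hC y hy).continuousAt.continuousWithinAt
  obtain ⟨K, -, hK⟩ := exists_lipschitzOnWith_of_contDiffAt isCompact_solidCylinder
    convex_solidCylinder hC
  obtain ⟨L, hL⟩ := isCompact_solidCylinder.exists_bound_of_continuousOn hcont
  obtain ⟨γ, h0, hγ⟩ := ODEBall.exists_solution_of_inward
    (f := fun t x => plane (u (embed x t))) (K := K) (L := L.toNNReal)
    (fun t ht => LipschitzOnWith.of_dist_le_mul fun x hx y hy => by
      refine (hK.dist_le_mul _ (embed_mem hx ht) _ (embed_mem hy ht)).trans_eq ?_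
      rw [embed, embed, dist_add_right, dist_eq_norm, ← map_sub, norm_lift, dist_eq_norm])
    (fun x hx => hcont.comp (Continuous.continuousOn (by unfold embed; fun_prop))
      fun t ht => embed_mem hx ht)
    (fun t ht x hx => (hL _ (embed_mem hx ht)).trans (Real.le_coe_toNNReal L))
    (fun t ht x hx => by
      have := hu.tangent (embed x t) (embed_mem (by simp [hx]) ht) (by simpa using hx)
      simpa using this.le) hx
  refine ⟨fun t => embed (γ t) t, by simp [h0], fun t ht => embed_mem (hγ t ht).1 ht,
    fun t ht => ?_⟩
  have h1 : HasDerivWithinAt (fun t => embed (γ t) t)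
      (lift (plane (u (embed (γ t) t))) + (1 : ℝ) • vert) (Icc 0 1) t :=
    (lift.hasFDerivAt.comp_hasDerivWithinAt t (hγ t ht).2).add
      ((hasDerivWithinAt_id t _).smul_const vert)
  refine h1.congr_deriv ?_
  have := (hu.vertical _ (embed_mem (hγ t ht).1 ht)).self_of_nhds
  rw [← this]
  exact embed_plane _

theorem IsFlowLine.continuousOn (h : IsFlowLine u x η) : ContinuousOn η (Icc 0 1) := fun t ht =>
  (h.deriv t ht).continuousWithinAt

/-- Grönwall with a Lipschitz constant of `u` on the convex cylinder. One `K` serves all pairs,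
which yields both uniqueness of flow lines and continuity of the flow map. -/
theorem IsTransverseField.dist_flowLine_le (hu : IsTransverseField u) :
    ∃ K : ℝ≥0, ∀ {x x' : ℂ} {η η' : ℝ → E3}, IsFlowLine u x η → IsFlowLine u x' η' →
      ∀ t ∈ Icc (0 : ℝ) 1, dist (η t) (η' t) ≤ K * dist x x' := by
  obtain ⟨K, -, hK⟩ := exists_lipschitzOnWith_of_contDiffAt isCompact_solidCylinder
    convex_solidCylinder hu.contDiff
  have hIco : ∀ {t : ℝ}, t ∈ Ico (0 : ℝ) 1 → t ∈ Icc (0 : ℝ) 1 := fun h => ⟨h.1, h.2.le⟩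
  refine ⟨(Real.exp K).toNNReal, fun {x x' η η'} h h' t ht => ?_⟩
  have := dist_le_of_trajectories_ODE_of_mem (v := fun _ => u) (s := fun _ => solidCylinder)
      (K := K) (a := 0) (b := 1) (fun _ _ => hK) h.continuousOn
      (fun t ht => ODEBall.hasDerivWithinAt_Ici (h.deriv t (hIco ht)) ht)
      (fun t ht => h.mem t (hIco ht)) h'.continuousOn
      (fun t ht => ODEBall.hasDerivWithinAt_Ici (h'.deriv t (hIco ht)) ht)
      (fun t ht => h'.mem t (hIco ht)) le_rfl t ht
  refine this.trans ?_
  rw [h.start, h'.start, embed, embed, dist_add_right, dist_eq_norm, ← map_sub, norm_lift,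
    ← dist_eq_norm, mul_comm]
  rw [Real.coe_toNNReal _ (by positivity)]
  gcongr
  nlinarith [ht.2, K.coe_nonneg]

theorem IsFlowLine.eqOn (hu : IsTransverseField u) {η' : ℝ → E3} (h : IsFlowLine u x η)
    (h' : IsFlowLine u x η') : EqOn η η' (Icc 0 1) := fun t ht => by
  obtain ⟨K, hK⟩ := hu.dist_flowLine_le
  simpa using hK h h' t ht

theorem IsFlowLine.height (hu : IsTransverseField u) (h : IsFlowLine u x η) {t : ℝ}
    (ht : t ∈ Icc (0 : ℝ) 1) : η t 2 = t := by
  have hd : ∀ t ∈ Icc (0 : ℝ) 1, HasDerivWithinAt (fun t => η t 2 - t) 0 (Icc 0 1) t :=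
    fun t ht => by
      have h1 := (EuclideanSpace.proj (2 : Fin 3) : E3 →L[ℝ] ℝ).hasFDerivAt.comp_hasDerivWithinAt t
        (h.deriv t ht)
      have h2 := h1.sub (hasDerivWithinAt_id t _)
      refine h2.congr_deriv ?_
      simp [(hu.vertical _ (h.mem t ht)).self_of_nhds]
  have := constant_of_has_deriv_right_zero (fun t ht => (hd t ht).continuousWithinAt)
    (fun t ht => ODEBall.hasDerivWithinAt_Ici (hd t ⟨ht.1, ht.2.le⟩) ht) t ht
  simp only [h.start, embed_two] at this
  linarith

theorem IsFlowLine.embed_plane_eq (hu : IsTransverseField u) (h : IsFlowLine u x η) {t : ℝ}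
    (ht : t ∈ Icc (0 : ℝ) 1) : embed (plane (η t)) t = η t := by
  conv_rhs => rw [← embed_plane (η t), h.height hu ht]

/-- Flow lines starting on the side boundary stay there. -/
theorem IsFlowLine.norm_plane_eq_one (hu : IsTransverseField u) (h : IsFlowLine u x η)
    (hx : ‖x‖ = 1) {t : ℝ} (ht : t ∈ Icc (0 : ℝ) 1) : ‖plane (η t)‖ = 1 := by
  set φ : E3 → ℝ := fun y => inner ℝ (plane y) (plane (u y)) with hφ
  have hC : ∀ y ∈ solidCylinder, ContDiffAt ℝ 1 φ y := fun y hy =>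
    (plane.contDiff.contDiffAt).inner ℝ (plane.contDiff.contDiffAt.comp y (hu.contDiff y hy))
  obtain ⟨K, -, hK⟩ := exists_lipschitzOnWith_of_contDiffAt isCompact_solidCylinder
    convex_solidCylinder hC
  -- The outward speed is Lipschitz and vanishes on the side, hence is controlled by the distance to
  -- it; the squared defect then satisfies a homogeneous Grönwall inequality with zero initial
  -- value.
  have hbound : ∀ y ∈ solidCylinder, |φ y| ≤ K * |1 - ‖plane y‖ ^ 2| := fun y hy => by
    have hle : ‖plane y‖ ≤ 1 := (mem_solidCylinder.1 hy).1
    rcases eq_or_ne (plane y) 0 with h0 | h0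
    · have : φ y = 0 := by simp only [hφ, h0, inner_zero_left]
      rw [this, abs_zero]; positivity
    have hn : ‖plane y‖ ≠ 0 := norm_ne_zero_iff.2 h0
    set p : ℂ := ‖plane y‖⁻¹ • plane y with hp
    have hp1 : ‖p‖ = 1 := by rw [hp, norm_smul, norm_inv, norm_norm, inv_mul_cancel₀ hn]
    have hpm : embed p (y 2) ∈ solidCylinder := embed_mem (by simp [hp1]) hy.2
    have hz : φ (embed p (y 2)) = 0 := hu.tangent _ hpm (by simpa using hp1)
    have hd := hK.dist_le_mul _ hy _ hpm
    rw [hz, Real.dist_eq, sub_zero] at hd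
    have hdist : dist y (embed p (y 2)) = 1 - ‖plane y‖ := by
      have he : y - embed p (y 2) = lift (plane y - p) := by apply ext3 <;> simp
      rw [dist_eq_norm, he, norm_lift]
      have : plane y - p = -((1 - ‖plane y‖) • p) := by
        rw [hp, smul_smul, sub_mul, mul_inv_cancel₀ hn, one_mul, sub_smul, one_smul]; abel
      rw [this, norm_neg, norm_smul, hp1, mul_one, Real.norm_of_nonneg (by linarith)]
    rw [hdist] at hd
    refine hd.trans (mul_le_mul_of_nonneg_left ?_ K.coe_nonneg)
    refine le_trans ?_ (le_abs_self _)
    nlinarith [norm_nonneg (plane y)]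
  have hd : ∀ t ∈ Icc (0 : ℝ) 1, HasDerivWithinAt (fun t => 1 - ‖plane (η t)‖ ^ 2)
      (-(2 * φ (η t))) (Icc 0 1) t := fun t ht =>
    ((plane.hasFDerivAt.comp_hasDerivWithinAt t (h.deriv t ht)).norm_sq).const_sub 1
  have := eq_zero_of_abs_deriv_le_mul_abs_self_of_eq_zero_right (K := 2 * K)
    (fun t ht => (hd t ht).continuousWithinAt)
    (fun t ht => ODEBall.hasDerivWithinAt_Ici (hd t ⟨ht.1, ht.2.le⟩) ht)
    (by simp [h.start, hx])
    (fun t ht => by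
      have := hbound _ (h.mem t ⟨ht.1, ht.2.le⟩)
      rw [norm_neg, norm_mul, Real.norm_eq_abs, Real.norm_eq_abs, Real.norm_eq_abs, abs_two]
      linarith) t ht
  have h1 : ‖plane (η t)‖ ^ 2 = 1 := by linarith
  exact (pow_eq_one_iff_of_nonneg (norm_nonneg _) two_ne_zero).1 h1

/-! ### Reversal of the flow, providing the inverse of the flow map -/

section Reverse

/-- The reflection of the cylinder exchanging its two ends. -/
noncomputable def reflect (y : E3) : E3 := embed (plane y) (1 - y 2)

/-- The linear part of the reflection, with the opposite sign. -/
noncomputable def flip : E3 →L[ℝ] E3 :=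
  (EuclideanSpace.proj (2 : Fin 3) : E3 →L[ℝ] ℝ).smulRight vert - lift.comp plane

/-- The transverse field whose flow lines are those of `u` travelled downwards. -/
noncomputable def reverse (u : E3 → E3) (y : E3) : E3 := flip (u (reflect y))

theorem flip_apply (y : E3) : flip y = embed (-plane y) (y 2) := by
  simp [flip, embed]; abel

theorem flip_flip (y : E3) : flip (flip y) = y := by
  simp [flip_apply, embed_plane]

@[simp] theorem reflect_reflect (y : E3) : reflect (reflect y) = y := by
  simp [reflect, embed_plane]

theorem reverse_reverse (u : E3 → E3) : reverse (reverse u) = u := by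
  ext1 y; simp [reverse, flip_flip]

theorem reflect_eq (y : E3) : reflect y = vert - flip y := by
  apply ext3 <;> simp [reflect, flip_apply]

theorem reflect_mem {y : E3} (hy : y ∈ solidCylinder) : reflect y ∈ solidCylinder :=
  embed_mem (plane_mem hy) ⟨by linarith [hy.2.2], by linarith [hy.2.1]⟩

theorem contDiff_reflect : ContDiff ℝ 1 reflect := by
  have : reflect = fun y => vert - flip y := funext reflect_eq
  rw [this]; fun_prop

theorem IsTransverseField.reverse (hu : IsTransverseField u) :
    IsTransverseField (Cylinder.reverse u) where
  contDiff y hy := flip.contDiff.contDiffAt.comp y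
    ((hu.contDiff _ (reflect_mem hy)).comp y contDiff_reflect.contDiffAt)
  vertical y hy := by
    filter_upwards [contDiff_reflect.continuous.continuousAt.eventually
      (hu.vertical _ (reflect_mem hy))] with z hz
    simpa [Cylinder.reverse, flip_apply] using hz
  tangent y hy h := by
    have := hu.tangent _ (reflect_mem hy) (by simpa [reflect] using h)
    rw [reflect, plane_embed] at this
    rw [Cylinder.reverse, flip_apply, plane_embed, inner_neg_right, reflect, this, neg_zero]

/-- As `reflect y = vert - flip y`, the sign from reversing time and the one in front of `flip`
cancel. -/
theorem IsFlowLine.reverse (hu : IsTransverseField u) (h : IsFlowLine u x η) :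
    IsFlowLine (Cylinder.reverse u) (plane (η 1)) (fun t => reflect (η (1 - t))) where
  start := by simp [reflect, h.height hu]
  mem t ht := reflect_mem (h.mem _ ⟨by linarith [ht.2], by linarith [ht.1]⟩)
  deriv t ht := by
    have ht' : 1 - t ∈ Icc (0 : ℝ) 1 := ⟨by linarith [ht.2], by linarith [ht.1]⟩
    have h1 : HasDerivWithinAt (fun t => η (1 - t)) ((-1 : ℝ) • u (η (1 - t))) (Icc 0 1) t :=
      (h.deriv _ ht').scomp t ((hasDerivWithinAt_id t _).const_sub 1)
        fun s hs => ⟨by linarith [hs.2], by linarith [hs.1]⟩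
    have h2 := (flip.hasFDerivAt.comp_hasDerivWithinAt t h1).const_sub vert
    simp only [Function.comp_def, ← reflect_eq] at h2
    refine h2.congr_deriv ?_
    simp [Cylinder.reverse]

end Reverse

/-- The flow line of `u` rooted at `x`. -/
noncomputable def flowLine (u : E3 → E3) (x : ℂ) : ℝ → E3 := Classical.epsilon (IsFlowLine u x)

/-- The map from the bottom to the top of the cylinder along the flow lines of `u`. -/
noncomputable def flowMap (u : E3 → E3) (x : ℂ) : ℂ := plane (flowLine u x 1)

theorem IsTransverseField.isFlowLine (hu : IsTransverseField u) (hx : x ∈ closedBall (0 : ℂ) 1) :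
    IsFlowLine u x (flowLine u x) :=
  Classical.epsilon_spec (hu.exists_isFlowLine hx)

theorem IsTransverseField.flowMap_mem (hu : IsTransverseField u) (hx : x ∈ closedBall (0 : ℂ) 1) :
    flowMap u x ∈ closedBall (0 : ℂ) 1 :=
  plane_mem ((hu.isFlowLine hx).mem 1 (by simp))

theorem IsTransverseField.norm_flowMap (hu : IsTransverseField u) (hx : ‖x‖ = 1) :
    ‖flowMap u x‖ = 1 :=
  (hu.isFlowLine (by simp [hx])).norm_plane_eq_one hu hx (by simp)

theorem IsTransverseField.embed_flowMap (hu : IsTransverseField u)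
    (hx : x ∈ closedBall (0 : ℂ) 1) : embed (flowMap u x) 1 = flowLine u x 1 :=
  (hu.isFlowLine hx).embed_plane_eq hu (by simp)

theorem IsTransverseField.flowMap_reverse (hu : IsTransverseField u)
    (hx : x ∈ closedBall (0 : ℂ) 1) : flowMap (Cylinder.reverse u) (flowMap u x) = x := by
  have h := (hu.isFlowLine hx).reverse hu
  have h' := hu.reverse.isFlowLine (hu.flowMap_mem hx)
  have := h'.eqOn hu.reverse h (right_mem_Icc.2 zero_le_one)
  rw [flowMap, this]
  simp [reflect, (hu.isFlowLine hx).start]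

theorem IsTransverseField.flowMap_reverse' (hu : IsTransverseField u)
    (hx : x ∈ closedBall (0 : ℂ) 1) : flowMap u (flowMap (Cylinder.reverse u) x) = x := by
  have := hu.reverse.flowMap_reverse hx
  rwa [reverse_reverse] at this

theorem norm_plane_le (y : E3) : ‖plane y‖ ≤ ‖y‖ := by
  rw [← sq_le_sq₀ (norm_nonneg _) (norm_nonneg _), norm_plane_sq, EuclideanSpace.norm_sq_eq,
    Fin.sum_univ_three]
  simp [sq_nonneg]

theorem IsTransverseField.continuousOn_flowMap (hu : IsTransverseField u) :
    ContinuousOn (flowMap u) (closedBall 0 1) := by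
  obtain ⟨K, hK⟩ := hu.dist_flowLine_le
  have : LipschitzOnWith K (flowMap u) (closedBall 0 1) :=
    LipschitzOnWith.of_dist_le_mul fun x hx x' hx' => by
      refine le_trans ?_ (hK (hu.isFlowLine hx) (hu.isFlowLine hx') 1 (by simp))
      rw [flowMap, flowMap, dist_eq_norm, ← map_sub, dist_eq_norm]
      exact norm_plane_le _
  exact this.continuousOn

/-- The integral of the one-form `a` along the flow line of `u` rooted at `x`. -/
noncomputable def lineIntegral (a : E3 → E3 →L[ℝ] ℝ) (u : E3 → E3) (x : ℂ) : ℝ :=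
  ∫ t in (0 : ℝ)..1, a (flowLine u x t) (u (flowLine u x t))

theorem hasDerivWithinAt_integral {φ : ℝ → ℝ} (hφ : ContinuousOn φ (Icc 0 1)) {t : ℝ}
    (ht : t ∈ Icc (0 : ℝ) 1) :
    HasDerivWithinAt (fun t => ∫ τ in (0 : ℝ)..t, φ τ) (φ t) (Icc 0 1) t := by
  have := ODE.hasDerivWithinAt_picard_Icc (f := fun _ x => x) (t₀ := 0) (u := univ)
    (tmin := 0) (tmax := 1) (by simp) (by fun_prop) hφ (fun _ _ => mem_univ _) (0 : ℝ) ht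
  have he : ODE.picard (fun _ x => x) 0 (0 : ℝ) φ = fun t => ∫ τ in (0 : ℝ)..t, φ τ :=
    funext fun t => by rw [ODE.picard_apply, zero_add]
  rwa [he] at this

/-- The first variation of the flow map and of the integral of a one-form along the flow lines:
when the exterior derivative of the form is annihilated by `u`, only end terms remain. -/
theorem IsTransverseField.variation (hu : IsTransverseField u) {a : E3 → E3 →L[ℝ] ℝ}
    (ha : ∀ y ∈ solidCylinder, ContDiffAt ℝ 1 a y)
    (hclosed : ∀ y ∈ solidCylinder, ∀ v, fderiv ℝ a y v (u y) = fderiv ℝ a y (u y) v)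
    {S : Set ℝ} {s₀ : ℝ} (hs₀ : s₀ ∈ S) {c : ℝ → ℂ} {c' : ℂ}
    (hc : ∀ s ∈ S, c s ∈ closedBall (0 : ℂ) 1) (hc' : HasDerivWithinAt c c' S s₀) :
    ∃ f' : ℂ, HasDerivWithinAt (fun s => flowMap u (c s)) f' S s₀ ∧
      HasDerivWithinAt (fun s => lineIntegral a u (c s))
        (a (embed (flowMap u (c s₀)) 1) (lift f') - a (embed (c s₀) 0) (lift c')) S s₀ := by
  -- Adjoining the running integral as a fourth coordinate lets one dependence theorem differentiate
  -- the flow and the integral together.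
  set g : E3 → E3 × ℝ := fun y => (u y, a y (u y)) with hg
  have hgC : ∀ y ∈ solidCylinder, ContDiffAt ℝ 1 g y := fun y hy =>
    (hu.contDiff y hy).prodMk ((ha y hy).clm_apply (hu.contDiff y hy))
  have hud : ∀ y ∈ solidCylinder, HasFDerivAt u (fderiv ℝ u y) y := fun y hy =>
    ((hu.contDiff y hy).differentiableAt one_ne_zero).hasFDerivAt
  have had : ∀ y ∈ solidCylinder, HasFDerivAt a (fderiv ℝ a y) y := fun y hy =>
    ((ha y hy).differentiableAt one_ne_zero).hasFDerivAt
  have hg' : ∀ y ∈ solidCylinder, ∀ v, fderiv ℝ g y v =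
      (fderiv ℝ u y v, fderiv ℝ a y (u y) v + a y (fderiv ℝ u y v)) := fun y hy v => by
    rw [((hud y hy).prodMk ((had y hy).clm_apply (hud y hy))).fderiv]
    simp [hclosed y hy v, add_comm]
  obtain ⟨K, hK', hK⟩ := exists_lipschitzOnWith_of_contDiffAt isCompact_solidCylinder
    convex_solidCylinder hgC
  have hline : ∀ s ∈ S, IsFlowLine u (c s) (flowLine u (c s)) := fun s hs =>
    hu.isFlowLine (hc s hs)
  have hη := hline s₀ hs₀
  set η := flowLine u (c s₀) with hηd
  obtain ⟨w, hw0, hw⟩ := ODEBall.exists_solution_linear (M := fun t => fderiv ℝ u (η t))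
    ((continuousOn_fderiv_of_contDiffAt hu.contDiff).comp hη.continuousOn hη.mem) (lift c')
  -- The vertical component of `u` is constant near the cylinder, so a variation that starts
  -- horizontal remains so.
  have hw2 : w 1 2 = 0 := by
    have hd : ∀ t ∈ Icc (0 : ℝ) 1, HasDerivWithinAt (fun t => w t 2) 0 (Icc 0 1) t :=
      fun t ht => by
        refine ((EuclideanSpace.proj (2 : Fin 3) : E3 →L[ℝ] ℝ).hasFDerivAt.comp_hasDerivWithinAt t
          (hw t ht)).congr_deriv ?_
        have h1 := (EuclideanSpace.proj (2 : Fin 3) : E3 →L[ℝ] ℝ).hasFDerivAt.comp (η t)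
          (hud _ (hη.mem t ht))
        have h2 : HasFDerivAt (fun z => u z 2) (0 : E3 →L[ℝ] ℝ) (η t) :=
          (hasFDerivAt_const (1 : ℝ) (η t)).congr_of_eventuallyEq (hu.vertical _ (hη.mem t ht))
        exact DFunLike.congr_fun (h1.unique h2) (w t)
    have := constant_of_has_deriv_right_zero (fun t ht => (hd t ht).continuousWithinAt)
      (fun t ht => ODEBall.hasDerivWithinAt_Ici (hd t ⟨ht.1, ht.2.le⟩) ht) 1 (by simp)
    rw [this, hw0, lift_two]
  have key := ODEBall.hasDerivWithinAt_solution (E := E3 × ℝ) (f := fun z => g z.1)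
    (f' := fun z => (fderiv ℝ g z.1).comp (ContinuousLinearMap.fst ℝ E3 ℝ))
    (C := solidCylinder ×ˢ univ) (K := K)
    (LipschitzOnWith.of_dist_le_mul fun z hz z' hz' =>
      (hK.dist_le_mul _ hz.1 _ hz'.1).trans
        (mul_le_mul_of_nonneg_left (le_max_left _ _) K.coe_nonneg))
    (fun z hz => (ContinuousLinearMap.opNorm_comp_le _ _).trans
      ((mul_le_of_le_one_right (norm_nonneg _) (ContinuousLinearMap.norm_fst_le ℝ E3 ℝ)).trans
        (hK' _ hz.1)))
    (fun ε hε => by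
      obtain ⟨δ, hδ, h⟩ := uniform_differentiability isCompact_solidCylinder
        convex_solidCylinder hgC hε
      refine ⟨δ, hδ, fun z hz z' hz' hzz' => ?_⟩
      have hn : ‖z.1 - z'.1‖ ≤ ‖z - z'‖ := norm_fst_le (z - z')
      exact (h _ hz.1 _ hz'.1 (hn.trans_lt hzz')).trans (mul_le_mul_of_nonneg_left hn hε.le))
    hs₀
    (y := fun s t => (flowLine u (c s) t,
      ∫ τ in (0 : ℝ)..t, a (flowLine u (c s) τ) (u (flowLine u (c s) τ))))
    (fun s hs t ht => ⟨(hline s hs).mem t ht, mem_univ _⟩)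
    (fun s hs t ht => ((hline s hs).deriv t ht).prodMk (hasDerivWithinAt_integral (fun τ hτ => by
      have hm := (hline s hs).mem τ hτ
      have h1 : ContinuousWithinAt (fun y => a y (u y)) solidCylinder _ :=
        ((ha _ hm).continuousAt.clm_apply (hu.contDiff _ hm).continuousAt).continuousWithinAt
      exact h1.comp ((hline s hs).continuousOn τ hτ) (hline s hs).mem) ht))
    -- Thanks to `hclosed`, the time derivative of `a(w)` equals the derivative of `a(u)` in the
    -- direction `w`, so this pair solves the linearized system and its last component is a pure end
    -- term.
    (w := fun t => (w t, a (η t) (w t) - a (η 0) (w 0)))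
    (fun t ht => by
      have hm := hη.mem t ht
      have h1 : HasDerivWithinAt (fun t => a (η t)) (fderiv ℝ a (η t) (u (η t))) (Icc 0 1) t :=
        (had _ hm).comp_hasDerivWithinAt t (hη.deriv t ht)
      refine ((hw t ht).prodMk ((h1.clm_apply (hw t ht)).sub_const _)).congr_deriv ?_
      exact (hg' _ hm _).symm)
    (by
      have h1 : HasDerivWithinAt (fun s => (embed (c s) 0, (0 : ℝ))) (lift c', (0 : ℝ)) S s₀ :=
        ((hasFDerivAt_embed _ 0).comp_hasDerivWithinAt s₀ hc').prodMk (hasDerivWithinAt_const _ _ _)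
      refine (h1.congr (fun s hs => ?_) ?_).congr_deriv ?_
      · simp [(hline s hs).start]
      · simp [(hline s₀ hs₀).start]
      · simp [hw0])
    (t := 1) (by simp)
  have k1 := (ContinuousLinearMap.fst ℝ E3 ℝ).hasFDerivAt.comp_hasDerivWithinAt s₀ key
  have k2 := (ContinuousLinearMap.snd ℝ E3 ℝ).hasFDerivAt.comp_hasDerivWithinAt s₀ key
  refine ⟨plane (w 1), plane.hasFDerivAt.comp_hasDerivWithinAt s₀ k1, k2.congr_deriv ?_⟩
  rw [lift_plane hw2, hu.embed_flowMap (hc s₀ hs₀), ← hw0, ← hη.start]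
  rfl

/-- Differentiability of the flow map along curves. -/
theorem IsTransverseField.hasDerivWithinAt_flowMap (hu : IsTransverseField u)
    {S : Set ℝ} {s₀ : ℝ} (hs₀ : s₀ ∈ S) {c : ℝ → ℂ} {c' : ℂ}
    (hc : ∀ s ∈ S, c s ∈ closedBall (0 : ℂ) 1) (hc' : HasDerivWithinAt c c' S s₀) :
    ∃ f' : ℂ, HasDerivWithinAt (fun s => flowMap u (c s)) f' S s₀ := by
  -- The zero form meets the closedness condition; only the statement about the flow map is kept.
  obtain ⟨f', h, -⟩ := hu.variation (a := 0) (fun _ _ => contDiffAt_const)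
    (by simp [fderiv_zero]) hs₀ hc hc'
  exact ⟨f', h⟩

end Cylinder

/-! ### Vector products, curl, and pull-backs of one-forms -/

namespace E3

open Cylinder

theorem inner_eq (x y : E3) : inner ℝ x y = x 0 * y 0 + x 1 * y 1 + x 2 * y 2 := by
  simp [PiLp.inner_apply, Fin.sum_univ_three, mul_comm]

@[simp] theorem cross_zero (a b : E3) : cross a b 0 = a 1 * b 2 - a 2 * b 1 := by
  simp [cross, cross_apply]

@[simp] theorem cross_one (a b : E3) : cross a b 1 = a 2 * b 0 - a 0 * b 2 := by
  simp [cross, cross_apply]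

@[simp] theorem cross_two (a b : E3) : cross a b 2 = a 0 * b 1 - a 1 * b 0 := by
  simp [cross, cross_apply]

theorem inner_cross_eq_det (x y z : E3) :
    inner ℝ x (cross y z) = (EuclideanSpace.basisFun (Fin 3) ℝ).toBasis.det ![x, y, z] := by
  rw [Module.Basis.det_apply, Matrix.det_fin_three, inner_eq]
  simp [Module.Basis.toMatrix_apply]
  ring

/-- The triple product of the images of three vectors under an invertible linear map. -/
theorem exists_inner_cross_map {M N : E3 →L[ℝ] E3} (h : ∀ x, N (M x) = x) :
    ∃ d : ℝ, d ≠ 0 ∧ ∀ x y z, inner ℝ (M x) (cross (M y) (M z)) = d * inner ℝ x (cross y z) := by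
  refine ⟨LinearMap.det (M : E3 →ₗ[ℝ] E3), fun h0 => ?_, fun x y z => ?_⟩
  · have : (N : E3 →ₗ[ℝ] E3) ∘ₗ (M : E3 →ₗ[ℝ] E3) = LinearMap.id := LinearMap.ext h
    have := congrArg LinearMap.det this
    rw [LinearMap.det_comp, h0, mul_zero, LinearMap.det_id] at this
    exact zero_ne_one this
  · rw [inner_cross_eq_det, inner_cross_eq_det, ← Module.Basis.det_comp]
    congr 1
    exact funext fun i => match i with
      | 0 => rfl
      | 1 => rfl
      | 2 => rfl

theorem cross_left_inner_self (x y : E3) (c : ℝ) : inner ℝ x (cross y (c • x)) = 0 := by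
  simp [inner_eq]; ring

theorem inner_cross_lift_vert (b : E3) (c : ℂ) :
    inner ℝ b (cross (lift (Complex.I * c)) vert) = inner ℝ c (plane b) := by
  simp [inner_eq]

theorem inner_cross_lift_lift (b : E3) (c : ℂ) :
    inner ℝ b (cross (lift c) (lift (Complex.I * c))) = b 2 * ‖c‖ ^ 2 := by
  rw [Complex.sq_norm, Complex.normSq_apply]
  simp [inner_eq]

/-- If `n × d = 0` with `n ≠ 0`, then `d` is orthogonal to all the vectors orthogonal to `n`. -/
theorem inner_eq_of_cross_eq {n a a' X : E3} (hn : n ≠ 0) (h : cross n a = cross n a')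
    (hX : inner ℝ n X = 0) : inner ℝ a X = inner ℝ a' X := by
  have h0 := congrArg (fun v : E3 => v 0) h
  have h1 := congrArg (fun v : E3 => v 1) h
  have h2 := congrArg (fun v : E3 => v 2) h
  simp only [cross_zero, cross_one, cross_two] at h0 h1 h2
  have hnn : inner ℝ n n ≠ 0 := inner_self_ne_zero.2 hn
  rw [inner_eq] at hX hnn
  refine mul_left_cancel₀ hnn ?_
  rw [inner_eq, inner_eq]
  -- Lagrange's identity with `d = a - a'`: `(n·n)(d·X) = (n×d)·(n×X) + (n·d)(n·X)`.
  linear_combination (n 1 * X 2 - n 2 * X 1) * h0 + (n 2 * X 0 - n 0 * X 2) * h1 +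
    (n 0 * X 1 - n 1 * X 0) * h2 +
    (n 0 * (a 0 - a' 0) + n 1 * (a 1 - a' 1) + n 2 * (a 2 - a' 2)) * hX

/-- The antisymmetrized derivative is the exterior derivative of the dual one-form, and in three
dimensions it is the flux form of the curl. -/
theorem inner_fderiv_sub (A : E3 → E3) (x X Y : E3) :
    inner ℝ (fderiv ℝ A x X) Y - inner ℝ (fderiv ℝ A x Y) X =
      inner ℝ (curl A x) (cross X Y) := by
  have hexp : ∀ (X : E3) (j : Fin 3), fderiv ℝ A x X j = X 0 * partialDeriv A 0 j x +
      X 1 * partialDeriv A 1 j x + X 2 * partialDeriv A 2 j x := fun X j => by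
    have : X = X 0 • EuclideanSpace.single 0 1 + X 1 • EuclideanSpace.single 1 1 +
        X 2 • (EuclideanSpace.single 2 1 : E3) := by apply ext3 <;> simp
    conv_lhs => rw [this]
    simp [partialDeriv]
  simp only [inner_eq, hexp, cross_zero, cross_one, cross_two, curl]
  simp
  ring

/-- The pull-back under `Φ` of the one-form dual to the vector field `A`. -/
noncomputable def pull (A Φ : E3 → E3) (y : E3) : E3 →L[ℝ] ℝ :=
  (innerSL ℝ (A (Φ y))).comp (fderiv ℝ Φ y)

theorem pull_apply (A Φ : E3 → E3) (y v : E3) :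
    pull A Φ y v = inner ℝ (A (Φ y)) (fderiv ℝ Φ y v) := rfl

variable {A Φ : E3 → E3} {y : E3}

theorem two_le_infty : (2 : WithTop ℕ∞) ≤ ∞ := WithTop.coe_le_coe.2 le_top

theorem contDiffAt_fderiv (hΦ : ContDiffAt ℝ ∞ Φ y) : ContDiffAt ℝ 1 (fderiv ℝ Φ) y :=
  hΦ.fderiv_right (by rw [one_add_one_eq_two]; exact two_le_infty)

theorem contDiffAt_pull (hΦ : ContDiffAt ℝ ∞ Φ y) (hA : ContDiffAt ℝ 1 A (Φ y)) :
    ContDiffAt ℝ 1 (pull A Φ) y :=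
  ((innerSL ℝ).contDiff.contDiffAt.comp y
    (hA.comp y (hΦ.of_le (by exact_mod_cast le_top)))).clm_comp (contDiffAt_fderiv hΦ)

/-- The exterior derivative of the pull-back. -/
theorem fderiv_pull_sub (hΦ : ContDiffAt ℝ ∞ Φ y) (hA : ContDiffAt ℝ 1 A (Φ y)) (v w : E3) :
    fderiv ℝ (pull A Φ) y v w - fderiv ℝ (pull A Φ) y w v =
      inner ℝ (curl A (Φ y)) (cross (fderiv ℝ Φ y v) (fderiv ℝ Φ y w)) := by
  have hΦ1 : HasFDerivAt Φ (fderiv ℝ Φ y) y := (hΦ.differentiableAt (by simp)).hasFDerivAt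
  have hΦ2 : HasFDerivAt (fderiv ℝ Φ) (fderiv ℝ (fderiv ℝ Φ) y) y :=
    ((contDiffAt_fderiv hΦ).differentiableAt one_ne_zero).hasFDerivAt
  have hA1 : HasFDerivAt A (fderiv ℝ A (Φ y)) (Φ y) :=
    (hA.differentiableAt one_ne_zero).hasFDerivAt
  have hA2 : HasFDerivAt (fun y => innerSL ℝ (A (Φ y)))
      ((innerSL ℝ).comp ((fderiv ℝ A (Φ y)).comp (fderiv ℝ Φ y))) y :=
    (innerSL ℝ : E3 →L[ℝ] E3 →L[ℝ] ℝ).hasFDerivAt.comp y (hA1.comp y hΦ1)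
  -- Symmetry of second derivatives cancels the terms in which `Φ` is differentiated twice.
  have hsymm : fderiv ℝ (fderiv ℝ Φ) y v w = fderiv ℝ (fderiv ℝ Φ) y w v :=
    (hΦ.isSymmSndFDerivAt (by simpa using two_le_infty)) v w
  have hd := (hA2.clm_comp hΦ2).fderiv
  change fderiv ℝ (pull A Φ) y = _ at hd
  rw [hd, ← inner_fderiv_sub]
  simp [hsymm]

end E3

/-! ### Mutually inverse derivatives of a diffeomorphism -/

section Diffeomorphism

open E3 Cylinder

variable {e : OpenPartialHomeomorph E3 E3} {y : E3}

theorem contDiffAt_of_mem_source (h : ContDiffOn ℝ ∞ e e.source) (hy : y ∈ e.source) :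
    ContDiffAt ℝ ∞ e y := h.contDiffAt (e.open_source.mem_nhds hy)

theorem contDiffAt_symm_of_mem_target (h : ContDiffOn ℝ ∞ e.symm e.target) (hy : y ∈ e.target) :
    ContDiffAt ℝ ∞ e.symm y := h.contDiffAt (e.open_target.mem_nhds hy)

theorem fderiv_symm_apply (h : ContDiffOn ℝ ∞ e e.source) (h' : ContDiffOn ℝ ∞ e.symm e.target)
    (hy : y ∈ e.source) (v : E3) : fderiv ℝ e.symm (e y) (fderiv ℝ e y v) = v := by
  have h1 : HasFDerivAt e (fderiv ℝ e y) y :=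
    ((contDiffAt_of_mem_source h hy).differentiableAt (by simp)).hasFDerivAt
  have h2 : HasFDerivAt e.symm (fderiv ℝ e.symm (e y)) (e y) :=
    ((contDiffAt_symm_of_mem_target h' (e.map_source hy)).differentiableAt (by simp)).hasFDerivAt
  have h3 : HasFDerivAt (fun y => e.symm (e y)) (ContinuousLinearMap.id ℝ E3) y :=
    (hasFDerivAt_id y).congr_of_eventuallyEq (e.eventually_left_inverse hy)
  exact DFunLike.congr_fun ((h2.comp y h1).unique h3) v

theorem fderiv_apply_symm (h : ContDiffOn ℝ ∞ e e.source) (h' : ContDiffOn ℝ ∞ e.symm e.target)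
    (hy : y ∈ e.target) (v : E3) : fderiv ℝ e (e.symm y) (fderiv ℝ e.symm y v) = v := by
  have := fderiv_symm_apply (e := e.symm) h' (by simpa using h) hy v
  simpa using this

end Diffeomorphism

/-! ### Transport of the tube, its coordinates and its braids to the cylinder -/

namespace FluxTube

open E3 Cylinder

variable {T : FluxTube} {y q x : E3} {B A A' Aref : E3 → E3}

theorem tube_contDiffAt (hy : y ∈ solidCylinder) : ContDiffAt ℝ ∞ T.tube y :=
  contDiffAt_of_mem_source T.tube_smooth (T.cylinder_subset hy)

theorem tube_hasFDerivAt (hy : y ∈ solidCylinder) :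
    HasFDerivAt T.tube (fderiv ℝ T.tube y) y :=
  ((tube_contDiffAt hy).differentiableAt (by simp)).hasFDerivAt

theorem tube_mem (hy : y ∈ solidCylinder) : T.tube y ∈ T.V := mem_image_of_mem _ hy

theorem mem_coord_target (hx : x ∈ T.V) : x ∈ T.coord.target := T.tube_subset hx

theorem symm_mem (hx : x ∈ T.V) : T.tube.symm x ∈ solidCylinder := by
  obtain ⟨y, hy, rfl⟩ := hx
  rwa [T.tube.left_inv (T.cylinder_subset hy)]

theorem tube_symm (hx : x ∈ T.V) : T.tube (T.tube.symm x) = x := by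
  obtain ⟨y, hy, rfl⟩ := hx
  rw [T.tube.left_inv (T.cylinder_subset hy)]

theorem symm_tube (hy : y ∈ solidCylinder) : T.tube.symm (T.tube y) = y :=
  T.tube.left_inv (T.cylinder_subset hy)

theorem height_tube_eq (hy : y ∈ solidCylinder) : T.height (T.tube y) = y 2 := T.height_tube y hy

theorem symm_two (hx : x ∈ T.V) : (T.tube.symm x) 2 = T.height x := by
  conv_rhs => rw [← tube_symm hx, height_tube_eq (symm_mem hx)]

theorem fderiv_symm_tube (hy : y ∈ solidCylinder) (v : E3) :
    fderiv ℝ T.tube.symm (T.tube y) (fderiv ℝ T.tube y v) = v :=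
  fderiv_symm_apply T.tube_smooth T.tube_symm_smooth (T.cylinder_subset hy) v

theorem fderiv_tube_symm (hy : y ∈ solidCylinder) (v : E3) :
    fderiv ℝ T.tube y (fderiv ℝ T.tube.symm (T.tube y) v) = v := by
  have := fderiv_apply_symm T.tube_smooth T.tube_symm_smooth
    (T.tube.map_source (T.cylinder_subset hy)) v
  rwa [symm_tube hy] at this

theorem coord_symm_contDiffAt (hx : x ∈ T.V) : ContDiffAt ℝ ∞ T.coord.symm x :=
  contDiffAt_symm_of_mem_target T.coord_symm_smooth (mem_coord_target hx)

theorem coord_symm_hasFDerivAt (hx : x ∈ T.V) :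
    HasFDerivAt T.coord.symm (fderiv ℝ T.coord.symm x) x :=
  ((coord_symm_contDiffAt hx).differentiableAt (by simp)).hasFDerivAt

theorem coord_contDiffAt (hq : q ∈ T.coord.source) : ContDiffAt ℝ ∞ T.coord q :=
  contDiffAt_of_mem_source T.coord_smooth hq

theorem coord_hasFDerivAt (hq : q ∈ T.coord.source) :
    HasFDerivAt T.coord (fderiv ℝ T.coord q) q :=
  ((coord_contDiffAt hq).differentiableAt (by simp)).hasFDerivAt

theorem fderiv_symm_coord (hq : q ∈ T.coord.source) (v : E3) :
    fderiv ℝ T.coord.symm (T.coord q) (fderiv ℝ T.coord q v) = v :=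
  fderiv_symm_apply T.coord_smooth T.coord_symm_smooth hq v

theorem fderiv_coord_symm (hq : q ∈ T.coord.source) (v : E3) :
    fderiv ℝ T.coord q (fderiv ℝ T.coord.symm (T.coord q) v) = v := by
  have := fderiv_apply_symm T.coord_smooth T.coord_symm_smooth (T.coord.map_source hq) v
  rwa [T.coord.left_inv hq] at this

theorem interior_solidCylinder_nonempty : (interior solidCylinder).Nonempty := by
  have hopen : IsOpen ((fun y : E3 => ‖plane y‖) ⁻¹' Iio 1 ∩ (fun y : E3 => y 2) ⁻¹' Ioo 0 1) :=
    (isOpen_Iio.preimage (by fun_prop)).inter (isOpen_Ioo.preimage (by fun_prop))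
  refine ⟨embed 0 (1 / 2), interior_maximal (fun y hy => ?_) hopen ?_⟩
  · exact mem_solidCylinder.2 ⟨le_of_lt hy.1, Ioo_subset_Icc_self hy.2⟩
  · simp only [mem_inter_iff, mem_preimage, plane_embed, embed_two]; norm_num

theorem uniqueDiffOn_solidCylinder : UniqueDiffOn ℝ solidCylinder :=
  uniqueDiffOn_convex convex_solidCylinder interior_solidCylinder_nonempty

/-- The change of variables from the coordinates of the cylinder to the curvilinear coordinates. -/
theorem transition_hasFDerivAt (hy : y ∈ solidCylinder) :
    HasFDerivAt (fun y => T.coord.symm (T.tube y))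
      ((fderiv ℝ T.coord.symm (T.tube y)).comp (fderiv ℝ T.tube y)) y :=
  (coord_symm_hasFDerivAt (tube_mem hy)).comp y (tube_hasFDerivAt hy)

/-- Heights are compared only on the cylinder itself, so at its boundary the conclusion rests on
uniqueness of derivatives within a convex set with interior. -/
theorem fderiv_height (hy : y ∈ solidCylinder) (v : E3) :
    (fderiv ℝ T.coord.symm (T.tube y) (fderiv ℝ T.tube y v)) 2 = v 2 := by
  set π : E3 →L[ℝ] ℝ := EuclideanSpace.proj (2 : Fin 3)
  have h1 : HasFDerivWithinAt (fun y => π (T.coord.symm (T.tube y)))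
      (π.comp ((fderiv ℝ T.coord.symm (T.tube y)).comp (fderiv ℝ T.tube y))) solidCylinder y :=
    (π.hasFDerivAt.comp y (transition_hasFDerivAt hy)).hasFDerivWithinAt
  have h2 : HasFDerivWithinAt (fun y => π (T.coord.symm (T.tube y))) π solidCylinder y :=
    π.hasFDerivWithinAt.congr (fun z hz => T.height_tube z hz) (T.height_tube y hy)
  exact DFunLike.congr_fun ((uniqueDiffOn_solidCylinder y hy).eq h1 h2) v

theorem cyl_eq (ρ ψ z : ℝ) : cyl ρ ψ z = embed (ρ • Complex.exp (ψ * Complex.I)) z := by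
  apply ext3 <;> simp [cyl, Complex.exp_re, Complex.exp_im]

theorem cyl_polar (q : E3) : cyl ‖plane q‖ (plane q).arg (q 2) = q := by
  rw [cyl_eq, Complex.real_smul, Complex.norm_mul_exp_arg_mul_I, embed_plane]

theorem cyl_hasDerivAt_radius (ρ ψ z : ℝ) :
    HasDerivAt (fun s => cyl s ψ z) (lift (Complex.exp (ψ * Complex.I))) ρ := by
  simp only [cyl_eq]
  have h : HasDerivAt (fun s : ℝ => s • Complex.exp (ψ * Complex.I))
      (Complex.exp (ψ * Complex.I)) ρ := by
    simpa using (hasDerivAt_id ρ).smul_const (Complex.exp (ψ * Complex.I))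
  exact (hasFDerivAt_embed _ z).comp_hasDerivAt ρ h

theorem cyl_hasDerivAt_angle (ρ ψ z : ℝ) :
    HasDerivAt (fun s => cyl ρ s z) (lift (ρ • (Complex.I * Complex.exp (ψ * Complex.I)))) ψ := by
  simp only [cyl_eq]
  exact (hasFDerivAt_embed _ z).comp_hasDerivAt ψ ((hasDerivAt_expI ψ).const_smul ρ)

theorem cyl_hasDerivAt_height (ρ ψ z : ℝ) : HasDerivAt (fun s => cyl ρ ψ s) vert z := by
  simp only [cyl_eq]
  exact hasDerivAt_embed _ z

theorem deriv_radius {ρ ψ z : ℝ} (h : cyl ρ ψ z ∈ T.coord.source) :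
    deriv (fun s => T.coord (cyl s ψ z)) ρ =
      fderiv ℝ T.coord (cyl ρ ψ z) (lift (Complex.exp (ψ * Complex.I))) :=
  ((coord_hasFDerivAt h).comp_hasDerivAt ρ (cyl_hasDerivAt_radius ρ ψ z)).deriv

theorem deriv_angle {ρ ψ z : ℝ} (h : cyl ρ ψ z ∈ T.coord.source) :
    deriv (fun s => T.coord (cyl ρ s z)) ψ =
      fderiv ℝ T.coord (cyl ρ ψ z) (lift (ρ • (Complex.I * Complex.exp (ψ * Complex.I)))) :=
  ((coord_hasFDerivAt h).comp_hasDerivAt ψ (cyl_hasDerivAt_angle ρ ψ z)).deriv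

theorem deriv_height {ρ ψ z : ℝ} (h : cyl ρ ψ z ∈ T.coord.source) :
    deriv (fun s => T.coord (cyl ρ ψ s)) z = fderiv ℝ T.coord (cyl ρ ψ z) vert :=
  ((coord_hasFDerivAt h).comp_hasDerivAt z (cyl_hasDerivAt_height ρ ψ z)).deriv

/-- The radial and angular directions span the horizontal plane once the factor `ρ > 0` of the
angular derivative is divided out. -/
theorem orthogonal_off_axis (hq : q ∈ T.coord.source) (hV : T.coord q ∈ T.V) (h0 : plane q ≠ 0)
    (c : ℂ) : inner ℝ (fderiv ℝ T.coord q (lift c)) (fderiv ℝ T.coord q vert) = 0 := by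
  have hρ : 0 < ‖plane q‖ := norm_pos_iff.2 h0
  have hqc := cyl_polar q
  have hmem : cyl ‖plane q‖ (plane q).arg (q 2) ∈ T.coord.source := by rwa [hqc]
  obtain ⟨-, h1, h2⟩ := T.orthogonal _ _ _ hρ hmem (by rwa [hqc])
  rw [deriv_radius hmem, deriv_height hmem, hqc] at h1
  rw [deriv_angle hmem, deriv_height hmem, hqc, map_smul, map_smul, real_inner_smul_left] at h2
  have h2 := (mul_eq_zero.1 h2).resolve_left hρ.ne'
  set ε := Complex.exp ((plane q).arg * Complex.I) with hε
  have hε0 : ε ≠ 0 := Complex.exp_ne_zero _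
  have hc : c = (c / ε).re • ε + (c / ε).im • (Complex.I * ε) := by
    conv_lhs => rw [← div_mul_cancel₀ c hε0, ← Complex.re_add_im (c / ε)]
    simp only [Complex.real_smul]; ring
  rw [hc]
  simp only [map_add, map_smul, inner_add_left, real_inner_smul_left, h1, h2]
  simp

/-- The curvilinear coordinate `z` is orthogonal to the horizontal coordinates, on the axis too. -/
theorem orthogonal_vert (hq : q ∈ T.coord.source) (hV : T.coord q ∈ T.V)
    (c : ℂ) : inner ℝ (fderiv ℝ T.coord q (lift c)) (fderiv ℝ T.coord q vert) = 0 := by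
  -- Points off the axis are dense: otherwise the horizontal coordinates would vanish on an open
  -- set, against the invertibility of the change of coordinates. Continuity then reaches the axis.
  set P := {q : E3 | q ∈ T.coord.source ∧ T.coord q ∈ T.V ∧ plane q ≠ 0} with hP
  have hcl : q ∈ closure P := by
    by_contra hcon
    have hW : (closure P)ᶜ ∈ 𝓝 q := isClosed_closure.isOpen_compl.mem_nhds hcon
    have hy := symm_mem hV
    set y := T.tube.symm (T.coord q) with hyd
    have hqy : T.coord.symm (T.tube y) = q := by rw [hyd, tube_symm hV, T.coord.left_inv hq]
    have hyc : y ∈ closure (interior solidCylinder) := by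
      rw [convex_solidCylinder.closure_interior_eq_closure_of_nonempty_interior
        interior_solidCylinder_nonempty]
      exact subset_closure hy
    have htend : Tendsto (fun z => T.coord.symm (T.tube z)) (𝓝 y) (𝓝 q) := by
      conv_rhs => rw [← hqy]
      exact (transition_hasFDerivAt hy).continuousAt.tendsto
    have hev : ∀ᶠ z in 𝓝 y, T.coord.symm (T.tube z) ∈ (closure P)ᶜ := htend.eventually hW
    obtain ⟨z, hz1, hz2⟩ := mem_closure_iff_nhds.1 hyc _ (eventually_eventually_nhds.2 hev)
    have hz : z ∈ solidCylinder := interior_subset hz2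
    have hzero : (fun z => plane (T.coord.symm (T.tube z))) =ᶠ[𝓝 z] fun _ => 0 := by
      filter_upwards [hz1, mem_interior_iff_mem_nhds.1 hz2] with w hw1 hw2
      by_contra h
      refine hw1 (subset_closure ⟨T.coord.map_target (mem_coord_target (tube_mem hw2)), ?_, h⟩)
      rw [T.coord.right_inv (mem_coord_target (tube_mem hw2))]
      exact tube_mem hw2
    have h1 : HasFDerivAt (fun z => plane (T.coord.symm (T.tube z))) _ z :=
      plane.hasFDerivAt.comp z (transition_hasFDerivAt (T := T) hz)
    have h2 : HasFDerivAt (fun z => plane (T.coord.symm (T.tube z))) (0 : E3 →L[ℝ] ℂ) z :=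
      (hasFDerivAt_const (0 : ℂ) z).congr_of_eventuallyEq hzero
    have h3 := DFunLike.congr_fun (h1.unique h2) (fderiv ℝ T.tube.symm (T.tube z)
      (fderiv ℝ T.coord (T.coord.symm (T.tube z)) (lift 1)))
    have h4 := fderiv_symm_coord (T.coord.map_target (mem_coord_target (tube_mem hz))) (lift 1)
    rw [T.coord.right_inv (mem_coord_target (tube_mem hz))] at h4
    simp only [ContinuousLinearMap.comp_apply, fderiv_tube_symm hz, h4, plane_lift] at h3
    simp at h3
  have hon : MapsTo (fun q => inner ℝ (fderiv ℝ T.coord q (lift c)) (fderiv ℝ T.coord q vert)) P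
      {0} := fun q hq => orthogonal_off_axis hq.1 hq.2.1 hq.2.2 c
  have hc : ContinuousAt
      (fun q => inner ℝ (fderiv ℝ T.coord q (lift c)) (fderiv ℝ T.coord q vert)) q := by
    have h := (contDiffAt_fderiv (coord_contDiffAt hq)).continuousAt
    exact (h.clm_apply continuousAt_const).inner (h.clm_apply continuousAt_const)
  simpa using hc.continuousWithinAt.mem_closure hcl hon

theorem fderiv_vert_ne_zero (hq : q ∈ T.coord.source) : fderiv ℝ T.coord q vert ≠ 0 := fun h => by
  have := fderiv_symm_coord hq vert
  rw [h, map_zero] at this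
  simpa using congrArg (fun v : E3 => v 2) this

/-- Horizontal directions are orthogonal to `∂r/∂z`, so conditions on `X · e_z` become conditions on
the `z`-coordinate of `X`. -/
theorem inner_fderiv_vert (hq : q ∈ T.coord.source) (hV : T.coord q ∈ T.V) (X : E3) :
    inner ℝ X (fderiv ℝ T.coord q vert) =
      (fderiv ℝ T.coord.symm (T.coord q) X) 2 * ‖fderiv ℝ T.coord q vert‖ ^ 2 := by
  conv_lhs => rw [← fderiv_coord_symm hq X, ← embed_plane (fderiv ℝ T.coord.symm (T.coord q) X)]
  rw [embed, map_add, map_smul, inner_add_left, orthogonal_vert hq hV, real_inner_smul_left,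
    real_inner_self_eq_norm_sq, zero_add]

theorem isCoord (hq : q ∈ T.coord.source) (hV : T.coord q ∈ T.V) :
    T.IsCoord ‖plane q‖ (plane q).arg (q 2) := by
  refine ⟨norm_nonneg _, ?_, ?_⟩
  · rwa [cyl_polar]
  · rwa [pos, cyl_polar]

theorem eZ_eq {ρ ψ z : ℝ} (h : cyl ρ ψ z ∈ T.coord.source) :
    T.eZ ρ ψ z = ‖fderiv ℝ T.coord (cyl ρ ψ z) vert‖⁻¹ • fderiv ℝ T.coord (cyl ρ ψ z) vert := by
  have : deriv (fun s => T.pos ρ ψ s) z = _ := deriv_height h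
  rw [eZ, this]

theorem eRho_eq {ρ ψ z : ℝ} (h : cyl ρ ψ z ∈ T.coord.source) :
    T.eRho ρ ψ z = ‖fderiv ℝ T.coord (cyl ρ ψ z) (lift (Complex.exp (ψ * Complex.I)))‖⁻¹ •
      fderiv ℝ T.coord (cyl ρ ψ z) (lift (Complex.exp (ψ * Complex.I))) := by
  have : deriv (fun s => T.pos s ψ z) ρ = _ := deriv_radius h
  rw [eRho, this]

theorem IsMagneticBraid.coord_pos (hB : T.IsMagneticBraid B) (hq : q ∈ T.coord.source)
    (hV : T.coord q ∈ T.V) : 0 < (fderiv ℝ T.coord.symm (T.coord q) (B (T.coord q))) 2 := by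
  have h := hB.z_pos _ _ _ (isCoord hq hV)
  have hmem : cyl ‖plane q‖ (plane q).arg (q 2) ∈ T.coord.source := by rwa [cyl_polar]
  rw [eZ_eq hmem, pos, cyl_polar, real_inner_smul_right, inner_fderiv_vert hq hV] at h
  have h1 : 0 < ‖fderiv ℝ T.coord q vert‖ := norm_pos_iff.2 (fderiv_vert_ne_zero hq)
  by_contra hcon
  push Not at hcon
  have h2 : 0 < ‖fderiv ℝ T.coord q vert‖⁻¹ := inv_pos.2 h1
  have h3 := mul_nonneg h2.le (mul_nonneg (neg_nonneg.2 hcon) (sq_nonneg ‖fderiv ℝ T.coord q vert‖))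
  linarith

/-- The vector field `B` in the coordinates of the cylinder. -/
noncomputable def pullField (T : FluxTube) (B : E3 → E3) (y : E3) : E3 :=
  fderiv ℝ T.tube.symm (T.tube y) (B (T.tube y))

/-- The vector field `B` in the coordinates of the cylinder, rescaled to unit vertical speed. -/
noncomputable def braidField (T : FluxTube) (B : E3 → E3) (y : E3) : E3 :=
  (T.pullField B y 2)⁻¹ • T.pullField B y

theorem fderiv_pullField (hy : y ∈ solidCylinder) :
    fderiv ℝ T.tube y (T.pullField B y) = B (T.tube y) := fderiv_tube_symm hy _

theorem IsMagneticBraid.pullField_pos (hB : T.IsMagneticBraid B) (hy : y ∈ solidCylinder) :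
    0 < T.pullField B y 2 := by
  have hV := T.tube_mem hy
  have h := hB.coord_pos (T.coord.map_target (mem_coord_target hV))
    (by rwa [T.coord.right_inv (mem_coord_target hV)])
  rw [T.coord.right_inv (mem_coord_target hV)] at h
  rwa [← fderiv_height hy, fderiv_pullField hy]

theorem IsMagneticBraid.contDiffAt_pullField (hB : T.IsMagneticBraid B) (hy : y ∈ solidCylinder) :
    ContDiffAt ℝ 1 (T.pullField B) y := by
  have ht : ContDiffAt ℝ 1 T.tube y := (tube_contDiffAt hy).of_le (by exact_mod_cast le_top)
  have h1 : ContDiffAt ℝ 1 (fderiv ℝ T.tube.symm) (T.tube y) :=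
    contDiffAt_fderiv (contDiffAt_symm_of_mem_target T.tube_symm_smooth
      (T.tube.map_source (T.cylinder_subset hy)))
  exact (h1.comp y ht).clm_apply ((hB.contDiff _ (tube_mem hy)).comp y ht)

theorem side_eq (θ t : ℝ) : T.side θ t = T.tube (embed (Complex.exp (θ * Complex.I)) t) := by
  rw [side, cyl_eq, one_smul]

theorem embed_exp_mem (θ : ℝ) {t : ℝ} (ht : t ∈ Icc (0 : ℝ) 1) :
    embed (Complex.exp (θ * Complex.I)) t ∈ solidCylinder :=
  embed_mem (by simp [Complex.norm_exp_ofReal_mul_I]) ht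

theorem sideNormal_eq (θ : ℝ) {t : ℝ} (ht : t ∈ Icc (0 : ℝ) 1) :
    T.sideNormal θ t = cross
      (fderiv ℝ T.tube (embed (Complex.exp (θ * Complex.I)) t)
        (lift (Complex.I * Complex.exp (θ * Complex.I))))
      (fderiv ℝ T.tube (embed (Complex.exp (θ * Complex.I)) t) vert) := by
  have h := tube_hasFDerivAt (T := T) (embed_exp_mem θ ht)
  have h1 := h.comp_hasDerivAt θ ((hasFDerivAt_embed _ t).comp_hasDerivAt θ (hasDerivAt_expI θ))
  have h2 := h.comp_hasDerivAt t (hasDerivAt_embed _ t)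
  have e1 : (fun s => T.side s t) = fun s : ℝ => T.tube (embed (Complex.exp (s * Complex.I)) t) :=
    funext fun s => side_eq s t
  have e2 : (fun s => T.side θ s) = fun s => T.tube (embed (Complex.exp (θ * Complex.I)) s) :=
    funext fun s => side_eq θ s
  rw [sideNormal, e1, e2]
  exact congrArg₂ cross h1.deriv h2.deriv

theorem exists_angle {c : ℂ} (hc : ‖c‖ = 1) : ∃ θ : ℝ, Complex.exp (θ * Complex.I) = c :=
  ⟨c.arg, by rw [← one_mul (Complex.exp _), ← Complex.ofReal_one, ← hc,
    Complex.norm_mul_exp_arg_mul_I]⟩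

theorem exists_side (hy : y ∈ solidCylinder) (h1 : ‖plane y‖ = 1) :
    ∃ θ t : ℝ, t ∈ Icc (0 : ℝ) 1 ∧ embed (Complex.exp (θ * Complex.I)) t = y := by
  obtain ⟨θ, hθ⟩ := exists_angle h1
  exact ⟨θ, y 2, hy.2, by rw [hθ, embed_plane]⟩

/-- Tangency passes to the cylinder because the triple product of the field with two tangent vectors
of the side only gains a nonzero determinant. -/
theorem IsMagneticBraid.isTransverseField (hB : T.IsMagneticBraid B) :
    IsTransverseField (T.braidField B) where
  contDiff y hy := by
    have h := hB.contDiffAt_pullField hy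
    have h2 : ContDiffAt ℝ 1 (fun y => T.pullField B y 2) y :=
      (EuclideanSpace.proj (2 : Fin 3) : E3 →L[ℝ] ℝ).contDiff.contDiffAt.comp y h
    exact (h2.inv (hB.pullField_pos hy).ne').smul h
  vertical y hy := by
    have h2 : ContinuousAt (fun y => T.pullField B y 2) y :=
      (EuclideanSpace.proj (2 : Fin 3) : E3 →L[ℝ] ℝ).continuous.continuousAt.comp
        (hB.contDiffAt_pullField hy).continuousAt
    filter_upwards [h2.eventually_ne (hB.pullField_pos hy).ne'] with z hz
    simp [braidField, inv_mul_cancel₀ hz]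
  tangent y hy h1 := by
    obtain ⟨θ, t, ht, rfl⟩ := exists_side hy h1
    have h := hB.tangent_side θ t ht
    obtain ⟨d, hd, hdet⟩ := exists_inner_cross_map (fderiv_symm_tube (T := T) hy)
    rw [side_eq, sideNormal_eq θ ht, ← fderiv_pullField (B := B) hy, hdet, inner_cross_lift_vert] at h
    rw [braidField, map_smul, real_inner_smul_right, plane_embed, (mul_eq_zero.1 h).resolve_left hd,
      mul_zero]

theorem fderiv_braidField (hy : y ∈ solidCylinder) :
    fderiv ℝ T.tube y (T.braidField B y) = (T.pullField B y 2)⁻¹ • B (T.tube y) := by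
  rw [braidField, map_smul, fderiv_pullField hy]

/-! ### Field lines and flux functions in the coordinates of the cylinder -/

section FieldLines

variable {p : ℂ}

theorem isFieldLine_of_isFlowLine (hB : T.IsMagneticBraid B) {η : ℝ → E3}
    (h : IsFlowLine (T.braidField B) p η) :
    T.IsFieldLine B (T.tube (embed p 0)) (fun t => T.tube (η t)) where
  start := by simp [h.start]
  mem t ht := tube_mem (h.mem t ht)
  height_eq t ht := by rw [height_tube_eq (h.mem t ht), h.height hB.isTransverseField ht]
  tangent t ht := ⟨_, ((tube_hasFDerivAt (h.mem t ht)).comp_hasDerivWithinAt t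
    (h.deriv t ht)).congr_deriv (fderiv_braidField (h.mem t ht))⟩

/-- The tangency factor `c` is forced: differentiating the height along the curve shows that `c`
times the vertical component of the field is 1. -/
theorem isFlowLine_of_isFieldLine {γ : ℝ → E3}
    (hp : p ∈ closedBall (0 : ℂ) 1) (h : T.IsFieldLine B (T.tube (embed p 0)) γ) :
    IsFlowLine (T.braidField B) p (fun t => T.tube.symm (γ t)) where
  start := by rw [h.start, symm_tube (embed_mem hp (by simp))]
  mem t ht := symm_mem (h.mem t ht)
  deriv t ht := by
    obtain ⟨c, hc⟩ := h.tangent t ht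
    have hm := symm_mem (h.mem t ht)
    have hγ := tube_symm (h.mem t ht)
    have h1 : HasFDerivAt T.tube.symm (fderiv ℝ T.tube.symm (γ t)) (γ t) :=
      ((contDiffAt_symm_of_mem_target T.tube_symm_smooth (by
        rw [← hγ]; exact T.tube.map_source (T.cylinder_subset hm))).differentiableAt
          (by simp)).hasFDerivAt
    have h2 := h1.comp_hasDerivWithinAt t hc
    have he : fderiv ℝ T.tube.symm (γ t) (c • B (γ t)) =
        c • T.pullField B (T.tube.symm (γ t)) := by
      rw [map_smul, pullField, hγ]
    rw [he] at h2
    have h3 := (EuclideanSpace.proj (2 : Fin 3) : E3 →L[ℝ] ℝ).hasFDerivAt.comp_hasDerivWithinAt t h2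
    have h4 : HasDerivWithinAt (fun t => (T.tube.symm (γ t)) 2) 1 (Icc 0 1) t :=
      (hasDerivWithinAt_id t _).congr
        (fun s hs => by rw [symm_two (h.mem s hs), h.height_eq s hs]; rfl)
        (by rw [symm_two (h.mem t ht), h.height_eq t ht]; rfl)
    have h5 : c * T.pullField B (T.tube.symm (γ t)) 2 = 1 :=
      (uniqueDiffOn_Icc zero_lt_one t ht).eq_deriv _ h3 h4
    have h6 : c = (T.pullField B (T.tube.symm (γ t)) 2)⁻¹ :=
      eq_inv_of_mul_eq_one_left h5
    refine h2.congr_deriv ?_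
    rw [braidField, ← h6]

/-- Uniqueness on the cylinder pins down the curve chosen by `epsilon`, but only for heights in `[0,
1]`. -/
theorem fieldLine_eq (hB : T.IsMagneticBraid B) (hp : p ∈ closedBall (0 : ℂ) 1) {t : ℝ}
    (ht : t ∈ Icc (0 : ℝ) 1) :
    T.fieldLine B (T.tube (embed p 0)) t = T.tube (flowLine (T.braidField B) p t) := by
  have hf := hB.isTransverseField.isFlowLine hp
  have h : T.IsFieldLine B (T.tube (embed p 0)) (T.fieldLine B (T.tube (embed p 0))) :=
    Classical.epsilon_spec (p := T.IsFieldLine B (T.tube (embed p 0)))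
      ⟨_, isFieldLine_of_isFlowLine hB hf⟩
  rw [← (isFlowLine_of_isFieldLine hp h).eqOn hB.isTransverseField hf ht, tube_symm (h.mem t ht)]

theorem fieldLineMap_eq (hB : T.IsMagneticBraid B) (hp : p ∈ closedBall (0 : ℂ) 1) :
    T.fieldLineMap B (T.tube (embed p 0)) = T.tube (embed (flowMap (T.braidField B) p) 1) := by
  rw [fieldLineMap, fieldLine_eq hB hp (by simp), hB.isTransverseField.embed_flowMap hp]

theorem topologicalFlux_eq (hB : T.IsMagneticBraid B) (hp : p ∈ closedBall (0 : ℂ) 1) :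
    T.topologicalFlux B A (T.tube (embed p 0)) =
      lineIntegral (pull A T.tube) (T.braidField B) p := by
  refine intervalIntegral.integral_congr fun t ht => ?_
  rw [uIcc_of_le zero_le_one] at ht
  have hf := hB.isTransverseField.isFlowLine hp
  have h1 : HasDerivWithinAt (T.fieldLine B (T.tube (embed p 0)))
      (fderiv ℝ T.tube (flowLine (T.braidField B) p t)
        (T.braidField B (flowLine (T.braidField B) p t))) (Icc 0 1) t :=
    ((tube_hasFDerivAt (hf.mem t ht)).comp_hasDerivWithinAt t (hf.deriv t ht)).congr
      (fun s hs => fieldLine_eq hB hp hs) (fieldLine_eq hB hp ht)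
  simp only [pull_apply]
  rw [h1.derivWithin (uniqueDiffOn_Icc zero_lt_one t ht), fieldLine_eq hB hp ht]

theorem mem_D_zero_iff : x ∈ T.D 0 ↔ ∃ p ∈ closedBall (0 : ℂ) 1, T.tube (embed p 0) = x := by
  constructor
  · rintro ⟨⟨y, hy, rfl⟩, h⟩
    rw [height_tube_eq hy] at h
    exact ⟨plane y, plane_mem hy, by rw [← h, embed_plane]⟩
  · rintro ⟨p, hp, rfl⟩
    have hm := embed_mem hp (t := 0) (by simp)
    exact ⟨tube_mem hm, by rw [height_tube_eq hm, embed_two]⟩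

end FieldLines

/-! ### Vector potentials as one-forms; consequences of the gauge conditions -/

section Potentials

theorem contDiffAt_pull_tube (hA : T.IsC1 A) (hy : y ∈ solidCylinder) :
    ContDiffAt ℝ 1 (pull A T.tube) y :=
  contDiffAt_pull (tube_contDiffAt hy) (hA _ (tube_mem hy))

theorem exists_fderiv_pull_sub (hA : T.IsVectorPotential A B) (hy : y ∈ solidCylinder) :
    ∃ d : ℝ, ∀ v w, fderiv ℝ (pull A T.tube) y v w - fderiv ℝ (pull A T.tube) y w v =
      d * inner ℝ (T.pullField B y) (cross v w) := by
  obtain ⟨d, -, hdet⟩ := exists_inner_cross_map (fderiv_symm_tube (T := T) hy)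
  refine ⟨d, fun v w => ?_⟩
  rw [fderiv_pull_sub (tube_contDiffAt hy) (hA.contDiff _ (tube_mem hy)), hA.curl_eq _ (tube_mem hy),
    ← hdet, fderiv_pullField hy]

/-- The exterior derivative is a triple product containing the field, so it vanishes when another
argument is parallel to the field. -/
theorem fderiv_pull_braidField (hA : T.IsVectorPotential A B) (hy : y ∈ solidCylinder) (v : E3) :
    fderiv ℝ (pull A T.tube) y v (T.braidField B y) =
      fderiv ℝ (pull A T.tube) y (T.braidField B y) v := by
  obtain ⟨d, hd⟩ := exists_fderiv_pull_sub hA hy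
  rw [← sub_eq_zero, hd, braidField, cross_left_inner_self, mul_zero]

/-- The pull-back of a vector potential is closed on the side boundary. -/
theorem fderiv_pull_side (hB : T.IsMagneticBraid B) (hA : T.IsVectorPotential A B) (θ : ℝ) {t : ℝ}
    (ht : t ∈ Icc (0 : ℝ) 1) :
    fderiv ℝ (pull A T.tube) (embed (Complex.exp (θ * Complex.I)) t)
        (lift (Complex.I * Complex.exp (θ * Complex.I))) vert =
      fderiv ℝ (pull A T.tube) (embed (Complex.exp (θ * Complex.I)) t) vert
        (lift (Complex.I * Complex.exp (θ * Complex.I))) := by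
  have hy := embed_exp_mem θ ht
  obtain ⟨d, hd⟩ := exists_fderiv_pull_sub hA hy
  rw [← sub_eq_zero, hd, inner_cross_lift_vert]
  have h := hB.isTransverseField.tangent _ hy (by simp [Complex.norm_exp_ofReal_mul_I])
  rw [braidField, map_smul, real_inner_smul_right, plane_embed] at h
  rw [(mul_eq_zero.1 h).resolve_left (inv_ne_zero (hB.pullField_pos hy).ne'), mul_zero]

/-- The normal is nonzero since the derivative of `tube` is invertible, and `n × A` determines `A`
on the tangent plane. -/
theorem pull_side_eq (hgauge : T.MatchesOnBoundary A Aref) (θ : ℝ) {t : ℝ}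
    (ht : t ∈ Icc (0 : ℝ) 1) :
    (pull A T.tube (embed (Complex.exp (θ * Complex.I)) t)
        (lift (Complex.I * Complex.exp (θ * Complex.I))) =
      pull Aref T.tube (embed (Complex.exp (θ * Complex.I)) t)
        (lift (Complex.I * Complex.exp (θ * Complex.I)))) ∧
    pull A T.tube (embed (Complex.exp (θ * Complex.I)) t) vert =
      pull Aref T.tube (embed (Complex.exp (θ * Complex.I)) t) vert := by
  have hy := embed_exp_mem θ ht
  have h := hgauge _ _ (Or.inl ⟨θ, t, ht, rfl, rfl⟩)
  obtain ⟨d, hd, hdet⟩ := exists_inner_cross_map (fderiv_symm_tube (T := T) hy)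
  rw [sideNormal_eq θ ht, side_eq] at h
  set n := cross (fderiv ℝ T.tube (embed (Complex.exp (θ * Complex.I)) t)
        (lift (Complex.I * Complex.exp (θ * Complex.I))))
      (fderiv ℝ T.tube (embed (Complex.exp (θ * Complex.I)) t) vert) with hn
  have hn0 : n ≠ 0 := fun h0 => by
    have := hdet (lift (Complex.exp (θ * Complex.I))) (lift (Complex.I * Complex.exp (θ * Complex.I)))
      vert
    rw [← hn, h0, inner_zero_right, inner_cross_lift_vert, plane_lift,
      real_inner_self_eq_norm_sq, Complex.norm_exp_ofReal_mul_I] at this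
    exact hd (by linarith)
  refine ⟨inner_eq_of_cross_eq hn0 h ?_, inner_eq_of_cross_eq hn0 h ?_⟩
  · rw [real_inner_comm, hn]; simp [inner_eq]; ring
  · rw [real_inner_comm, hn]; simp [inner_eq]; ring

theorem inner_end_eq (hgauge : T.MatchesOnBoundary A Aref) (hq : q ∈ T.coord.source)
    (hV : T.coord q ∈ T.V) (hz : q 2 = 0 ∨ q 2 = 1) {X : E3}
    (hX : (fderiv ℝ T.coord.symm (T.coord q) X) 2 = 0) :
    inner ℝ (A (T.coord q)) X = inner ℝ (Aref (T.coord q)) X := by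
  have hmem : cyl ‖plane q‖ (plane q).arg (q 2) ∈ T.coord.source := by rwa [cyl_polar]
  have h := hgauge _ _ (Or.inr ⟨_, _, _, isCoord hq hV, hz, rfl, rfl⟩)
  rw [eZ_eq hmem, pos, cyl_polar] at h
  have hne := fderiv_vert_ne_zero hq
  refine inner_eq_of_cross_eq (smul_ne_zero (inv_ne_zero (norm_ne_zero_iff.2 hne)) hne) h ?_
  rw [real_inner_smul_left, real_inner_comm, inner_fderiv_vert hq hV, hX]
  simp

theorem pull_end_eq (hgauge : T.MatchesOnBoundary A Aref) (hy : y ∈ solidCylinder)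
    (hz : y 2 = 0 ∨ y 2 = 1) {v : E3} (hv : v 2 = 0) :
    pull A T.tube y v = pull Aref T.tube y v := by
  have ht := mem_coord_target (tube_mem (T := T) hy)
  have h := inner_end_eq hgauge (T.coord.map_target ht) (by
    rw [T.coord.right_inv ht]; exact tube_mem hy) (by
    rwa [show (T.coord.symm (T.tube y)) 2 = y 2 from T.height_tube y hy])
    (X := fderiv ℝ T.tube y v) (by rw [T.coord.right_inv ht, fderiv_height hy, hv])
  rwa [T.coord.right_inv ht] at h

/-- The vector potential in the curvilinear coordinates has no radial component on the ends. -/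
theorem pull_coord_radial (hgauge : T.MatchesOnBoundary A Aref)
    (hcanonical : T.IsCanonicalOnEnds Aref) (hq : q ∈ T.coord.source)
    (hV : T.coord q ∈ T.V) (hz : q 2 = 0 ∨ q 2 = 1) :
    pull A T.coord q (lift (plane q)) = 0 := by
  rw [pull_apply, inner_end_eq hgauge hq hV hz (by rw [fderiv_symm_coord hq, lift_two])]
  rcases eq_or_ne (plane q) 0 with h0 | h0
  · simp [h0]
  have hρ : 0 < ‖plane q‖ := norm_pos_iff.2 h0
  have hmem : cyl ‖plane q‖ (plane q).arg (q 2) ∈ T.coord.source := by rwa [cyl_polar]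
  have h := hcanonical _ _ _ hρ (isCoord hq hV) hz
  rw [eRho_eq hmem, pos, cyl_polar, real_inner_smul_right] at h
  set ε := Complex.exp ((plane q).arg * Complex.I) with hε
  have hne : fderiv ℝ T.coord q (lift ε) ≠ 0 := fun h' => by
    have := fderiv_symm_coord hq (lift ε)
    rw [h', map_zero] at this
    have := congrArg plane this
    rw [map_zero, plane_lift] at this
    exact Complex.exp_ne_zero _ this.symm
  have h1 := (mul_eq_zero.1 h).resolve_left (inv_ne_zero (norm_ne_zero_iff.2 hne))
  have h2 : plane q = ‖plane q‖ • ε := by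
    rw [Complex.real_smul, hε, Complex.norm_mul_exp_arg_mul_I]
  rw [h2, map_smul, map_smul, real_inner_smul_right, h1, mul_zero]

end Potentials

end FluxTube

/-! ### Closed one-forms on the side of the cylinder -/

namespace Cylinder

open E3

/-- A continuous angle of a differentiable curve on the unit circle is differentiable. -/
theorem exists_hasDerivWithinAt_angle {θ : ℝ → ℝ} {s : Set ℝ} {t : ℝ} {c' : ℂ} (ht : t ∈ s)
    (hθ : ContinuousWithinAt θ s t)
    (h : HasDerivWithinAt (fun t => Complex.exp (θ t * Complex.I)) c' s t) :
    ∃ θ' : ℝ, HasDerivWithinAt θ θ' s t := by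
  have hsin : ∀ r, Real.sin (θ r - θ t) =
      (Complex.exp (θ r * Complex.I) * Complex.exp (-(θ t * Complex.I))).im := fun r => by
    rw [← Complex.exp_add, ← Complex.exp_ofReal_mul_I_im]
    push_cast; ring_nf
  have h1 : HasDerivWithinAt (fun r => Real.sin (θ r - θ t))
      (c' * Complex.exp (-(θ t * Complex.I))).im s t :=
    (Complex.imCLM.hasFDerivAt.comp_hasDerivWithinAt t
      (h.mul_const (Complex.exp (-(θ t * Complex.I))))).congr (fun r _ => hsin r) (hsin t)
  have h2 : HasDerivAt Real.arcsin (1 / √(1 - 0 ^ 2)) (Real.sin (θ t - θ t)) := by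
    rw [sub_self, Real.sin_zero]
    exact Real.hasDerivAt_arcsin (by norm_num) (by norm_num)
  have h3 := (h2.comp_hasDerivWithinAt t h1).const_add (θ t)
  -- By continuity the increment of the angle is eventually below `π / 2`, where `arcsin` inverts
  -- the sine.
  refine ⟨_, h3.congr_of_eventuallyEq_of_mem ?_ ht⟩
  have h4 : ∀ᶠ r in 𝓝[s] t, |θ r - θ t| < Real.pi / 2 := by
    have : Tendsto (fun r => |θ r - θ t|) (𝓝[s] t) (𝓝 0) := by
      simpa using (hθ.tendsto.sub_const (θ t)).abs
    exact this.eventually (gt_mem_nhds (by positivity))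
  filter_upwards [h4] with r hr
  have := abs_lt.1 hr
  simp only [Function.comp_apply]
  rw [Real.arcsin_sin this.1.le this.2.le]
  ring

/-- The parametrization of the side of the cylinder by the angle and the height. -/
noncomputable def sidePoint (z : ℝ × ℝ) : E3 := embed (Complex.exp (z.1 * Complex.I)) z.2

/-- The horizontal tangent vector to the side of the cylinder. -/
noncomputable def sideTangent (z : ℝ × ℝ) : E3 := lift (Complex.I * Complex.exp (z.1 * Complex.I))

/-- The pull-back of a one-form to the strip parametrizing the side of the cylinder. -/
noncomputable def sideForm (a : E3 → E3 →L[ℝ] ℝ) (z : ℝ × ℝ) : ℝ × ℝ →L[ℝ] ℝ :=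
  a (sidePoint z) (sideTangent z) • ContinuousLinearMap.fst ℝ ℝ ℝ +
    a (sidePoint z) vert • ContinuousLinearMap.snd ℝ ℝ ℝ

theorem sidePoint_mem {z : ℝ × ℝ} (hz : z.2 ∈ Icc (0 : ℝ) 1) : sidePoint z ∈ solidCylinder :=
  embed_mem (by simp [Complex.norm_exp_ofReal_mul_I]) hz

theorem hasFDerivAt_sidePoint (z : ℝ × ℝ) : HasFDerivAt sidePoint
    ((ContinuousLinearMap.fst ℝ ℝ ℝ).smulRight (sideTangent z) +
      (ContinuousLinearMap.snd ℝ ℝ ℝ).smulRight vert) z := by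
  have h1 : HasFDerivAt (fun z : ℝ × ℝ => lift (Complex.exp (z.1 * Complex.I))) _ z :=
    lift.hasFDerivAt.comp z ((hasDerivAt_expI z.1).hasFDerivAt.comp z hasFDerivAt_fst)
  have h2 : HasFDerivAt (fun z : ℝ × ℝ => z.2 • vert) _ z :=
    (hasFDerivAt_snd (𝕜 := ℝ) (p := z)).smul_const vert
  refine (h1.add h2).congr_fderiv ?_
  ext <;> simp [sideTangent]

theorem exists_hasFDerivAt_sideTangent (z : ℝ × ℝ) : ∃ L : ℝ × ℝ →L[ℝ] E3,
    HasFDerivAt sideTangent L z ∧ L (0, 1) = 0 := by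
  have h1 : HasFDerivAt sideTangent _ z :=
    lift.hasFDerivAt.comp z
      (((hasDerivAt_expI z.1).const_mul Complex.I).hasFDerivAt.comp z hasFDerivAt_fst)
  exact ⟨_, h1, by simp⟩

/-- A one-form that is closed on the side of the cylinder has a primitive there, as a function of
the angle and the height. -/
theorem exists_side_primitive {a : E3 → E3 →L[ℝ] ℝ}
    (ha : ∀ y ∈ solidCylinder, ContDiffAt ℝ 1 a y)
    (hclosed : ∀ z : ℝ × ℝ, z.2 ∈ Icc (0 : ℝ) 1 →
      fderiv ℝ a (sidePoint z) (sideTangent z) vert = fderiv ℝ a (sidePoint z) vert (sideTangent z)) :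
    ∃ Φ : ℝ × ℝ → ℝ, ∀ z ∈ univ ×ˢ Icc (0 : ℝ) 1,
      HasFDerivWithinAt Φ (sideForm a z) (univ ×ˢ Icc (0 : ℝ) 1) z := by
  have hderiv : ∀ z : ℝ × ℝ, ∃ L : ℝ × ℝ →L[ℝ] (ℝ × ℝ →L[ℝ] ℝ), z ∈ univ ×ˢ Icc (0 : ℝ) 1 →
      HasFDerivAt (sideForm a) L z ∧ ∀ v w, L v w = L w v := fun z => by
    by_cases hz : z ∈ univ ×ˢ Icc (0 : ℝ) 1
    swap
    -- Off the strip any value will do; 0 makes the later choice a total function.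
    · exact ⟨0, fun h => absurd h hz⟩
    have h1 : HasFDerivAt (fun z => a (sidePoint z)) _ z :=
      ((ha _ (sidePoint_mem hz.2)).differentiableAt one_ne_zero).hasFDerivAt.comp z
        (hasFDerivAt_sidePoint z)
    obtain ⟨L, hL, hL0⟩ := exists_hasFDerivAt_sideTangent z
    have hP := h1.clm_apply hL
    have hQ := h1.clm_apply (hasFDerivAt_const vert z)
    refine ⟨_, fun _ => ⟨(hP.smul_const (ContinuousLinearMap.fst ℝ ℝ ℝ)).add
      (hQ.smul_const (ContinuousLinearMap.snd ℝ ℝ ℝ)), fun v w => ?_⟩⟩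
    have hv : ∀ v : ℝ × ℝ, L v = v.1 • L (1, 0) := fun v => by
      have : v = v.1 • ((1 : ℝ), (0 : ℝ)) + v.2 • ((0 : ℝ), (1 : ℝ)) := by ext <;> simp
      conv_lhs => rw [this, map_add, map_smul, map_smul, hL0, smul_zero, add_zero]
    have hc := hclosed z hz.2
    simp only [add_apply, ContinuousLinearMap.smulRight_apply,
      ContinuousLinearMap.comp_apply, ContinuousLinearMap.flip_apply,
      ContinuousLinearMap.coe_fst', ContinuousLinearMap.coe_snd', hv v, hv w,
      smul_apply, map_add, map_smul, smul_eq_mul,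
      zero_apply, map_zero]
    rw [hc]
    ring
  choose L hL using hderiv
  exact (convex_univ.prod (convex_Icc 0 1)).exists_forall_hasFDerivWithinAt_of_hasFDerivWithinAt_symmetric
    (fun z hz => (hL z hz).1.hasFDerivWithinAt) (fun z hz v _ w _ => (hL z hz).2 v w)

/-- The integral of a one-form along a curve on the side is the increment of a primitive. -/
theorem integral_side {a : E3 → E3 →L[ℝ] ℝ} {u : E3 → E3} (hu : IsTransverseField u)
    (ha : ∀ y ∈ solidCylinder, ContDiffAt ℝ 1 a y) {Φ : ℝ × ℝ → ℝ}
    (hΦ : ∀ z ∈ univ ×ˢ Icc (0 : ℝ) 1,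
      HasFDerivWithinAt Φ (sideForm a z) (univ ×ˢ Icc (0 : ℝ) 1) z)
    {x : ℂ} {η : ℝ → E3} (hη : IsFlowLine u x η) {θ : ℝ → ℝ} (hθ : ContinuousOn θ (Icc 0 1))
    (hηθ : ∀ t ∈ Icc (0 : ℝ) 1, η t = sidePoint (θ t, t)) :
    ∫ t in (0 : ℝ)..1, a (η t) (u (η t)) = Φ (θ 1, 1) - Φ (θ 0, 0) := by
  have hcont : ContinuousOn (fun t => a (η t) (u (η t))) (Icc 0 1) := fun t ht => by
    have hm := hη.mem t ht
    have h1 : ContinuousWithinAt (fun y => a y (u y)) solidCylinder _ :=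
      ((ha _ hm).continuousAt.clm_apply (hu.contDiff _ hm).continuousAt).continuousWithinAt
    exact h1.comp (hη.continuousOn t ht) hη.mem
  have hd : ∀ t ∈ Icc (0 : ℝ) 1, HasDerivWithinAt (fun t => Φ (θ t, t)) (a (η t) (u (η t)))
      (Icc 0 1) t := fun t ht => by
    have h1 : HasDerivWithinAt (fun t => Complex.exp (θ t * Complex.I)) _ (Icc 0 1) t :=
      (plane.hasFDerivAt.comp_hasDerivWithinAt t (hη.deriv t ht)).congr
        (fun r hr => by simp only [Function.comp_apply, hηθ r hr, sidePoint, plane_embed])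
        (by simp only [Function.comp_apply, hηθ t ht, sidePoint, plane_embed])
    obtain ⟨θ', hθ'⟩ := exists_hasDerivWithinAt_angle ht (hθ t ht) h1
    have h2 : HasDerivWithinAt (fun t => (θ t, t)) (θ', (1 : ℝ)) (Icc 0 1) t :=
      hθ'.prodMk (hasDerivWithinAt_id t _)
    have h3 : HasDerivWithinAt η (θ' • sideTangent (θ t, t) + vert) (Icc 0 1) t := by
      have := ((hasFDerivAt_sidePoint (θ t, t)).comp_hasDerivWithinAt (f := fun t => (θ t, t)) t h2).congr hηθ (hηθ t ht)
      simpa using this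
    have h4 := (uniqueDiffOn_Icc zero_lt_one t ht).eq_deriv _ (hη.deriv t ht) h3
    have h5 := (hΦ (θ t, t) ⟨mem_univ _, ht⟩).comp_hasDerivWithinAt (f := fun t => (θ t, t)) t h2
      (fun r hr => ⟨mem_univ _, hr⟩)
    refine h5.congr_deriv ?_
    rw [h4, hηθ t ht]
    simp [sideForm, mul_comm]
  exact intervalIntegral.integral_eq_sub_of_hasDeriv_right_of_le zero_le_one
    (fun t ht => (hd t ht).continuousWithinAt)
    (fun t ht => ((hd t (Ioo_subset_Icc_self ht)).hasDerivAt (Icc_mem_nhds ht.1 ht.2)).hasDerivWithinAt)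
    (hcont.intervalIntegrable_of_Icc zero_le_one)

end Cylinder

/-! ### Equality of the fluxes on the side boundary -/

namespace FluxTube

open E3 Cylinder

variable {T : FluxTube} {B B' A A' Aref : E3 → E3} {p : ℂ}

theorem sideForm_pull_eq (hgauge : T.MatchesOnBoundary A Aref)
    (hgauge' : T.MatchesOnBoundary A' Aref) {z : ℝ × ℝ} (hz : z.2 ∈ Icc (0 : ℝ) 1) :
    sideForm (pull A T.tube) z = sideForm (pull A' T.tube) z := by
  have h := pull_side_eq hgauge z.1 hz
  have h' := pull_side_eq hgauge' z.1 hz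
  rw [sideForm, sideForm]
  unfold sidePoint sideTangent
  rw [h.1, h.2, h'.1, h'.2]

theorem exists_angle_of_hasWindingNumber (hB : T.IsMagneticBraid B)
    (hp : p ∈ closedBall (0 : ℂ) 1) {w : ℝ}
    (hw : T.HasWindingNumber (T.fieldLine B (T.tube (embed p 0))) w) :
    ∃ θ : ℝ → ℝ, ContinuousOn θ (Icc 0 1) ∧
      (∀ t ∈ Icc (0 : ℝ) 1, flowLine (T.braidField B) p t = sidePoint (θ t, t)) ∧
      θ 1 - θ 0 = w * (2 * Real.pi) := by
  obtain ⟨θ, hθ, h, rfl⟩ := hw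
  refine ⟨θ, hθ, fun t ht => ?_, by field_simp⟩
  have h1 := h t ht
  rw [fieldLine_eq hB hp ht, side_eq] at h1
  exact T.tube.injOn (T.cylinder_subset ((hB.isTransverseField.isFlowLine hp).mem t ht))
    (T.cylinder_subset (sidePoint_mem (z := (θ t, t)) ht)) h1

/-- Field lines on the side boundary with a common root that wind equally often have the same
topological flux. -/
theorem lineIntegral_eq_of_sameWinding (hB : T.IsMagneticBraid B) (hB' : T.IsMagneticBraid B')
    (hA : T.IsVectorPotential A B) (hA' : T.IsVectorPotential A' B')
    (hgauge : T.MatchesOnBoundary A Aref) (hgauge' : T.MatchesOnBoundary A' Aref)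
    (hwind : T.SameWinding B B') (hp : ‖p‖ = 1) :
    lineIntegral (pull A T.tube) (T.braidField B) p =
      lineIntegral (pull A' T.tube) (T.braidField B') p := by
  have hpb : p ∈ closedBall (0 : ℂ) 1 := by simp [hp]
  obtain ⟨φ, hφ⟩ := exists_angle hp
  obtain ⟨w, hw, hw'⟩ := hwind (T.tube (embed p 0)) ⟨φ, by rw [← hφ]; exact side_eq φ 0⟩
  obtain ⟨θ, hθ, h, hθw⟩ := exists_angle_of_hasWindingNumber hB hpb hw
  obtain ⟨θ', hθ', h', hθw'⟩ := exists_angle_of_hasWindingNumber hB' hpb hw'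
  have hf := hB.isTransverseField.isFlowLine hpb
  have hf' := hB'.isTransverseField.isFlowLine hpb
  have hexp : Complex.exp (θ 0 * Complex.I) = Complex.exp (θ' 0 * Complex.I) := by
    have h1 := (h 0 (by simp)).symm.trans (hf.start.trans (hf'.start.symm.trans (h' 0 (by simp))))
    simpa [sidePoint] using congrArg plane h1
  -- The two angles of the common root may differ by whole turns; shifting one by `n` turns makes
  -- the paths in the strip start together, and equal winding makes them end together.
  obtain ⟨n, hn⟩ := Complex.exp_eq_exp_iff_exists_int.1 hexp
  have hn' : θ 0 = θ' 0 + n * (2 * Real.pi) := by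
    have h1 : (θ 0 : ℂ) = θ' 0 + n * (2 * Real.pi) := by
      refine mul_right_cancel₀ Complex.I_ne_zero ?_
      rw [hn]; ring
    exact_mod_cast h1
  obtain ⟨Φ, hΦ⟩ := exists_side_primitive
    (fun y hy => contDiffAt_pull_tube hA.contDiff hy)
    (fun z hz => fderiv_pull_side hB hA z.1 hz)
  have hΦ' : ∀ z ∈ univ ×ˢ Icc (0 : ℝ) 1,
      HasFDerivWithinAt Φ (sideForm (pull A' T.tube) z) (univ ×ˢ Icc (0 : ℝ) 1) z := fun z hz => by
    rw [← sideForm_pull_eq hgauge hgauge' hz.2]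
    exact hΦ z hz
  have e1 := integral_side hB.isTransverseField (fun y hy => contDiffAt_pull_tube hA.contDiff hy)
    hΦ hf hθ h
  have e2 := integral_side hB'.isTransverseField
    (fun y hy => contDiffAt_pull_tube hA'.contDiff hy) hΦ' hf'
    (θ := fun t => θ' t + n * (2 * Real.pi)) (hθ'.add continuousOn_const) (fun t ht => by
      rw [h' t ht, sidePoint, sidePoint]
      congr 1
      refine Complex.exp_eq_exp_iff_exists_int.2 ⟨-n, ?_⟩
      push_cast; ring)
  rw [lineIntegral, lineIntegral, e1, e2, ← hn']
  congr 3
  linarith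

end FluxTube

/-! ### The two implications in the coordinates of the disc -/

namespace FluxTube

open E3 Cylinder

variable {T : FluxTube} {B B' A A' Aref : E3 → E3} {p q : ℂ}

theorem tube_embed_injOn {t : ℝ} (ht : t ∈ Icc (0 : ℝ) 1) :
    InjOn (fun p => T.tube (embed p t)) (closedBall 0 1) := fun p hp q hq h => by
  have := T.tube.injOn (T.cylinder_subset (embed_mem hp ht)) (T.cylinder_subset (embed_mem hq ht)) h
  simpa using congrArg plane this

theorem fieldLineMap_eq_iff (hB : T.IsMagneticBraid B) (hB' : T.IsMagneticBraid B')
    (hp : p ∈ closedBall (0 : ℂ) 1) :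
    T.fieldLineMap B (T.tube (embed p 0)) = T.fieldLineMap B' (T.tube (embed p 0)) ↔
      flowMap (T.braidField B) p = flowMap (T.braidField B') p := by
  rw [fieldLineMap_eq hB hp, fieldLineMap_eq hB' hp]
  exact (tube_embed_injOn (by simp)).eq_iff (hB.isTransverseField.flowMap_mem hp)
    (hB'.isTransverseField.flowMap_mem hp)

/-- Vector potentials in the same gauge agree on horizontal vectors at the ends. -/
theorem pull_lift_eq (hgauge : T.MatchesOnBoundary A Aref) (hgauge' : T.MatchesOnBoundary A' Aref)
    (hp : p ∈ closedBall (0 : ℂ) 1) {t : ℝ} (ht : t = 0 ∨ t = 1) (v : ℂ) :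
    pull A T.tube (embed p t) (lift v) = pull A' T.tube (embed p t) (lift v) := by
  have hm : embed p t ∈ solidCylinder := embed_mem hp (by rcases ht with rfl | rfl <;> simp)
  have ht' : embed p t 2 = 0 ∨ embed p t 2 = 1 := by simpa using ht
  rw [pull_end_eq hgauge hm ht' (lift_two v), pull_end_eq hgauge' hm ht' (lift_two v)]

/-- The topological flux functions of braids with the same field line mapping and the same winding
on the side agree. -/
theorem lineIntegral_eq_of_flowMap_eq (hB : T.IsMagneticBraid B) (hB' : T.IsMagneticBraid B')
    (hwind : T.SameWinding B B')
    (hA : T.IsVectorPotential A B) (hA' : T.IsVectorPotential A' B')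
    (hgauge : T.MatchesOnBoundary A Aref) (hgauge' : T.MatchesOnBoundary A' Aref)
    (hF : EqOn (flowMap (T.braidField B)) (flowMap (T.braidField B')) (closedBall 0 1))
    (hp : p ∈ closedBall (0 : ℂ) 1) :
    lineIntegral (pull A T.tube) (T.braidField B) p =
      lineIntegral (pull A' T.tube) (T.braidField B') p := by
  -- A segment to the boundary point `1`, where the fluxes are already known to agree.
  set c : ℝ → ℂ := fun s => p + s • (1 - p) with hc
  have hcm : ∀ s ∈ Icc (0 : ℝ) 1, c s ∈ closedBall (0 : ℂ) 1 := fun s hs =>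
    (convex_closedBall (0 : ℂ) 1).add_smul_sub_mem hp (by simp) hs
  have hcd : ∀ s, HasDerivWithinAt c (1 - p) (Icc 0 1) s := fun s => by
    exact (((hasDerivAt_id s).smul_const (1 - p)).const_add p).hasDerivWithinAt.congr_deriv
      (one_smul _ _)
  have hd : ∀ s ∈ Icc (0 : ℝ) 1, HasDerivWithinAt
      (fun s => lineIntegral (pull A T.tube) (T.braidField B) (c s) -
        lineIntegral (pull A' T.tube) (T.braidField B') (c s)) 0 (Icc 0 1) s := fun s hs => by
    obtain ⟨f, hf, h⟩ := hB.isTransverseField.variation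
      (fun y hy => contDiffAt_pull_tube hA.contDiff hy)
      (fun y hy v => fderiv_pull_braidField hA hy v) hs hcm (hcd s)
    obtain ⟨f', hf', h'⟩ := hB'.isTransverseField.variation
      (fun y hy => contDiffAt_pull_tube hA'.contDiff hy)
      (fun y hy v => fderiv_pull_braidField hA' hy v) hs hcm (hcd s)
    have hff : f = f' := (uniqueDiffOn_Icc zero_lt_one s hs).eq_deriv _ hf
      (hf'.congr (fun r hr => hF (hcm r hr)) (hF (hcm s hs)))
    refine (h.sub h').congr_deriv ?_
    rw [← hff, ← hF (hcm s hs),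
      pull_lift_eq hgauge hgauge' (hB.isTransverseField.flowMap_mem (hcm s hs)) (Or.inr rfl),
      pull_lift_eq hgauge hgauge' (hcm s hs) (Or.inl rfl), sub_self]
  have h := constant_of_has_deriv_right_zero (fun s hs => (hd s hs).continuousWithinAt)
    (fun s hs => ODEBall.hasDerivWithinAt_Ici (hd s ⟨hs.1, hs.2.le⟩) hs) 1 (by simp)
  have hc0 : c 0 = p := by simp [hc]
  have hc1 : c 1 = 1 := by simp [hc]
  rw [hc0, hc1, lineIntegral_eq_of_sameWinding hB hB' hA hA' hgauge hgauge' hwind (by simp),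
    sub_self] at h
  exact sub_eq_zero.1 h.symm

/-! ### Curvilinear coordinates on the end `z = 1` -/

section EndChart

/-- The passage from the unit disc to the horizontal curvilinear coordinates on the end `z = 1`. -/
noncomputable def endChart (T : FluxTube) (p : ℂ) : ℂ := plane (T.coord.symm (T.tube (embed p 1)))

/-- The inverse of `endChart`. -/
noncomputable def endChartInv (T : FluxTube) (q : ℂ) : ℂ := plane (T.tube.symm (T.coord (embed q 1)))

/-- The derivative of `endChart`. -/
noncomputable def endChartDeriv (T : FluxTube) (p : ℂ) : ℂ →L[ℝ] ℂ :=
  plane.comp (((fderiv ℝ T.coord.symm (T.tube (embed p 1))).comp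
    (fderiv ℝ T.tube (embed p 1))).comp lift)

theorem embed_one_mem (hp : p ∈ closedBall (0 : ℂ) 1) : embed p 1 ∈ solidCylinder :=
  embed_mem hp (by simp)

theorem embed_endChart (hp : p ∈ closedBall (0 : ℂ) 1) :
    embed (T.endChart p) 1 = T.coord.symm (T.tube (embed p 1)) := by
  have h := T.height_tube _ (embed_one_mem hp)
  rw [embed_two] at h
  have h' := embed_plane (T.coord.symm (T.tube (embed p 1)))
  rwa [h] at h'

theorem embed_endChart_mem (hp : p ∈ closedBall (0 : ℂ) 1) :
    embed (T.endChart p) 1 ∈ T.coord.source := by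
  rw [embed_endChart hp]
  exact T.coord.map_target (mem_coord_target (tube_mem (embed_one_mem hp)))

theorem coord_endChart (hp : p ∈ closedBall (0 : ℂ) 1) :
    T.coord (embed (T.endChart p) 1) = T.tube (embed p 1) := by
  rw [embed_endChart hp, T.coord.right_inv (mem_coord_target (tube_mem (embed_one_mem hp)))]

theorem coord_endChart_mem (hp : p ∈ closedBall (0 : ℂ) 1) :
    T.coord (embed (T.endChart p) 1) ∈ T.V := by
  rw [coord_endChart hp]; exact tube_mem (embed_one_mem hp)

theorem endChartInv_endChart (hp : p ∈ closedBall (0 : ℂ) 1) :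
    T.endChartInv (T.endChart p) = p := by
  rw [endChartInv, coord_endChart hp, symm_tube (embed_one_mem hp), plane_embed]

theorem hasFDerivAt_endChart (hp : p ∈ closedBall (0 : ℂ) 1) :
    HasFDerivAt T.endChart (T.endChartDeriv p) p :=
  plane.hasFDerivAt.comp p
    (HasFDerivAt.comp (f := fun p => embed p 1) p
      (transition_hasFDerivAt (embed_one_mem hp)) (hasFDerivAt_embed p 1))

theorem hasStrictFDerivAt_endChart (hp : p ∈ closedBall (0 : ℂ) 1) :
    HasStrictFDerivAt T.endChart (T.endChartDeriv p) p := by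
  have h1 : ContDiffAt ℝ ∞ (fun p => embed p 1) p := by
    unfold embed; fun_prop
  have h2 : ContDiffAt ℝ ∞ T.endChart p :=
    plane.contDiff.contDiffAt.comp p ((coord_symm_contDiffAt (tube_mem (embed_one_mem hp))).comp p
      (ContDiffAt.comp (f := fun p => embed p 1) p (tube_contDiffAt (embed_one_mem hp)) h1))
  exact h2.hasStrictFDerivAt' (hasFDerivAt_endChart hp) (by simp)

theorem lift_endChartDeriv (hp : p ∈ closedBall (0 : ℂ) 1) (v : ℂ) :
    lift (T.endChartDeriv p v) = fderiv ℝ T.coord.symm (T.tube (embed p 1))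
      (fderiv ℝ T.tube (embed p 1) (lift v)) :=
  lift_plane ((fderiv_height (embed_one_mem hp) (lift v)).trans (lift_two v))

theorem endChartDeriv_surjective (hp : p ∈ closedBall (0 : ℂ) 1) :
    Function.Surjective (T.endChartDeriv p) := fun c => by
  have hm := embed_one_mem hp
  have hc : fderiv ℝ T.coord.symm (T.tube (embed p 1))
      (fderiv ℝ T.coord (embed (T.endChart p) 1) (lift c)) = lift c := by
    rw [← coord_endChart hp]
    exact fderiv_symm_coord (embed_endChart_mem hp) _
  set w := fderiv ℝ T.tube.symm (T.tube (embed p 1))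
    (fderiv ℝ T.coord (embed (T.endChart p) 1) (lift c)) with hw
  have hDw : fderiv ℝ T.tube (embed p 1) w =
      fderiv ℝ T.coord (embed (T.endChart p) 1) (lift c) := fderiv_tube_symm hm _
  have hw2 : w 2 = 0 := by
    rw [← fderiv_height (T := T) hm, hDw, hc, lift_two]
  refine ⟨plane w, ?_⟩
  have := lift_endChartDeriv hp (T := T) (plane w)
  rw [lift_plane hw2, hDw, hc] at this
  simpa using congrArg plane this

theorem isOpen_image_endChart : IsOpen (T.endChart '' ball 0 1) := by
  rw [isOpen_iff_mem_nhds]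
  rintro _ ⟨p, hp, rfl⟩
  rw [← (hasStrictFDerivAt_endChart (ball_subset_closedBall hp)).map_nhds_eq_of_surj
    (LinearMap.range_eq_top.2 (endChartDeriv_surjective (ball_subset_closedBall hp)))]
  exact image_mem_map (isOpen_ball.mem_nhds hp)

theorem continuousOn_endChart : ContinuousOn T.endChart (closedBall 0 1) := fun _ hp =>
  (hasFDerivAt_endChart hp).continuousAt.continuousWithinAt

theorem zero_mem_image_endChart : (0 : ℂ) ∈ T.endChart '' ball 0 1 := by
  obtain ⟨h0, y, ⟨hy, hy2⟩, hT⟩ := T.axis 1 (by simp)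
  refine ⟨plane y, by simpa using (norm_plane_lt_one_iff y).2 hy, ?_⟩
  rw [endChart, ← hy2, embed_plane, hT, T.coord.left_inv h0]
  apply Complex.ext <;> simp

theorem exists_hasFDerivAt_endChartInv (hp : p ∈ closedBall (0 : ℂ) 1) :
    ∃ L : ℂ →L[ℝ] ℂ, HasFDerivAt T.endChartInv L (T.endChart p) := by
  have h1 : HasFDerivAt T.tube.symm (fderiv ℝ T.tube.symm (T.coord (embed (T.endChart p) 1)))
      (T.coord (embed (T.endChart p) 1)) := by
    rw [coord_endChart hp]
    exact ((contDiffAt_symm_of_mem_target T.tube_symm_smooth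
      (T.tube.map_source (T.cylinder_subset (embed_one_mem hp)))).differentiableAt
        (by simp)).hasFDerivAt
  exact ⟨_, plane.hasFDerivAt.comp _ (HasFDerivAt.comp (f := fun q => T.coord (embed q 1)) _ h1
    (HasFDerivAt.comp (f := fun q => embed q 1) _ (coord_hasFDerivAt (embed_endChart_mem hp))
      (hasFDerivAt_embed _ 1)))⟩

/-- The one-form of the vector potential on the end `z = 1`, in the curvilinear coordinates. -/
noncomputable def endForm (T : FluxTube) (A : E3 → E3) (q : ℂ) : ℂ →L[ℝ] ℝ :=
  (pull A T.coord (embed q 1)).comp lift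

/-- Both sides pair `A` with the same tangent vector of the end in space, so the end form is the
disc form transported by the chart. -/
theorem endForm_endChart (hp : p ∈ closedBall (0 : ℂ) 1) (v : ℂ) :
    T.endForm A (T.endChart p) (T.endChartDeriv p v) = pull A T.tube (embed p 1) (lift v) := by
  have h := fderiv_coord_symm (embed_endChart_mem (T := T) hp) (fderiv ℝ T.tube (embed p 1) (lift v))
  rw [coord_endChart hp, ← lift_endChartDeriv hp] at h
  rw [endForm, ContinuousLinearMap.comp_apply, pull_apply, h, coord_endChart hp, pull_apply]

theorem contDiffAt_pull_coord (hA : T.IsC1 A) (hp : p ∈ closedBall (0 : ℂ) 1) :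
    ContDiffAt ℝ 1 (pull A T.coord) (embed (T.endChart p) 1) :=
  contDiffAt_pull (coord_contDiffAt (embed_endChart_mem hp)) (hA _ (coord_endChart_mem hp))

theorem contDiffAt_endForm (hA : T.IsC1 A) (hp : p ∈ closedBall (0 : ℂ) 1) :
    ContDiffAt ℝ 1 (T.endForm A) (T.endChart p) := by
  have h1 : ContDiffAt ℝ 1 (fun q => embed q 1) (T.endChart p) := by
    unfold embed; fun_prop
  exact (ContDiffAt.comp (f := fun q => embed q 1) _ (contDiffAt_pull_coord hA hp) h1).clm_comp
    contDiffAt_const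

theorem fderiv_endForm (hA : T.IsC1 A) (hp : p ∈ closedBall (0 : ℂ) 1) (v w : ℂ) :
    fderiv ℝ (T.endForm A) (T.endChart p) v w =
      fderiv ℝ (pull A T.coord) (embed (T.endChart p) 1) (lift v) (lift w) := by
  have h1 : HasFDerivAt (fun q => pull A T.coord (embed q 1)) _ (T.endChart p) :=
    HasFDerivAt.comp (f := fun q => embed q 1) _
      ((contDiffAt_pull_coord hA hp).differentiableAt one_ne_zero).hasFDerivAt (hasFDerivAt_embed _ 1)
  have h2 : HasFDerivAt (fun q => T.endForm A q w) _ (T.endChart p) :=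
    h1.clm_apply (hasFDerivAt_const (lift w) _)
  have h3 : HasFDerivAt (fun q => T.endForm A q w) _ (T.endChart p) :=
    (((contDiffAt_endForm hA hp).differentiableAt one_ne_zero).hasFDerivAt).clm_apply
      (hasFDerivAt_const w _)
  simpa using DFunLike.congr_fun (h3.unique h2) v

/-- The flux through the end of the tube is non-degenerate. -/
theorem fderiv_endForm_ne (hB : T.IsMagneticBraid B) (hA : T.IsVectorPotential A B)
    (hp : p ∈ closedBall (0 : ℂ) 1) {v : ℂ} (hv : v ≠ 0) :
    fderiv ℝ (T.endForm A) (T.endChart p) v (Complex.I * v) ≠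
      fderiv ℝ (T.endForm A) (T.endChart p) (Complex.I * v) v := by
  have hq := embed_endChart_mem (T := T) hp
  have hV := coord_endChart_mem (T := T) hp
  rw [fderiv_endForm hA.contDiff hp, fderiv_endForm hA.contDiff hp, ← sub_ne_zero,
    fderiv_pull_sub (coord_contDiffAt hq) (hA.contDiff _ hV), hA.curl_eq _ hV]
  -- On `v`, `iv` the exterior derivative is this determinant times the `z`-coordinate of `B` times
  -- `‖v‖ ^ 2`.
  obtain ⟨d, hd, hdet⟩ := exists_inner_cross_map (fderiv_symm_coord (T := T) hq)
  rw [← fderiv_coord_symm hq (B _), hdet, inner_cross_lift_lift]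
  exact mul_ne_zero hd (mul_ne_zero (hB.coord_pos hq hV).ne' (by simpa using hv))

end EndChart

/-- Braids with the same field line mapping on the side and the same topological flux function, in
the canonical gauge, have the same field line mapping. -/
theorem flowMap_eq_of_lineIntegral_eq (hB : T.IsMagneticBraid B) (hB' : T.IsMagneticBraid B')
    (hF : ∀ p : ℂ, ‖p‖ = 1 → flowMap (T.braidField B) p = flowMap (T.braidField B') p)
    (hA : T.IsVectorPotential A B) (hA' : T.IsVectorPotential A' B')
    (hgauge : T.MatchesOnBoundary A Aref) (hgauge' : T.MatchesOnBoundary A' Aref)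
    (hcanonical : T.IsCanonicalOnEnds Aref)
    (hflux : ∀ p ∈ closedBall (0 : ℂ) 1, lineIntegral (pull A T.tube) (T.braidField B) p =
      lineIntegral (pull A' T.tube) (T.braidField B') p)
    (hp : p ∈ closedBall (0 : ℂ) 1) :
    flowMap (T.braidField B) p = flowMap (T.braidField B') p := by
  have hu := hB.isTransverseField
  have hu' := hB'.isTransverseField
  set u := T.braidField B with hud
  set u' := T.braidField B' with hud'
  -- Down the first braid and up the second: `F' ∘ F⁻¹` on the top end, in the coordinates where `θ`
  -- has no radial component.
  set G : ℂ → ℂ := fun q => T.endChart (flowMap u' (flowMap (reverse u) (T.endChartInv q))) with hGd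
  have hN : MapsTo T.endChartInv (T.endChart '' closedBall 0 1) (closedBall 0 1) := by
    rintro _ ⟨p, hp, rfl⟩
    rwa [endChartInv_endChart hp]
  have hR : MapsTo (flowMap (reverse u)) (closedBall 0 1) (closedBall 0 1) := fun r hr =>
    hu.reverse.flowMap_mem hr
  have hF' : MapsTo (flowMap u') (closedBall 0 1) (closedBall 0 1) := fun r hr =>
    hu'.flowMap_mem hr
  have hUΩ : T.endChart '' ball 0 1 ⊆ T.endChart '' closedBall 0 1 :=
    image_mono ball_subset_closedBall
  have hid : EqOn G id (T.endChart '' closedBall 0 1) := by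
    refine RadialForm.eqOn_id (U := T.endChart '' ball 0 1) (θ := T.endForm A)
      ((isCompact_closedBall _ _).image_of_continuousOn continuousOn_endChart)
      isOpen_image_endChart hUΩ ?_ zero_mem_image_endChart ?_ ?_ ?_ ?_ ?_ ?_ ?_
    · rw [← closure_ball (0 : ℂ) one_ne_zero]
      refine ContinuousOn.image_closure ?_
      rw [closure_ball (0 : ℂ) one_ne_zero]
      exact continuousOn_endChart
    · have h1 : ContinuousOn T.endChartInv (T.endChart '' closedBall 0 1) := by
        rintro _ ⟨p, hp, rfl⟩
        obtain ⟨L, hL⟩ := exists_hasFDerivAt_endChartInv (T := T) hp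
        exact hL.continuousAt.continuousWithinAt
      exact continuousOn_endChart.comp (hu'.continuousOn_flowMap.comp
        (hu.reverse.continuousOn_flowMap.comp h1 hN) (hR.comp hN)) (hF'.comp (hR.comp hN))
    · exact fun q hq => mem_image_of_mem _ (hF' (hR (hN hq)))
    · rintro _ ⟨⟨p, hp, rfl⟩, hpU⟩
      have hp1 : ‖p‖ = 1 := by
        refine le_antisymm (by simpa using hp) (not_lt.1 fun h => hpU ⟨p, by simpa using h, rfl⟩)
      simp only [hGd]
      rw [endChartInv_endChart hp, ← hF _ (hu.reverse.norm_flowMap hp1), hu.flowMap_reverse' hp]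
    · rintro _ ⟨p, hp, rfl⟩
      exact contDiffAt_endForm hA.contDiff hp
    · rintro _ ⟨p, hp, rfl⟩
      have := pull_coord_radial hgauge hcanonical (embed_endChart_mem (T := T) hp)
        (coord_endChart_mem hp) (Or.inr (by simp))
      simpa [endForm] using this
    · rintro _ ⟨p, hp, rfl⟩ v hv
      exact fderiv_endForm_ne hB hA hp hv
    · rintro q hqU v
      obtain ⟨p, hp, rfl⟩ := hUΩ hqU
      set S : Set ℝ := {s | T.endChart p + s • v ∈ T.endChart '' closedBall 0 1} with hS
      have hline : HasDerivAt (fun s : ℝ => T.endChart p + s • v) v 0 := by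
        simpa using ((hasDerivAt_id (0 : ℝ)).smul_const v).const_add (T.endChart p)
      have hl0 : T.endChart p + (0 : ℝ) • v = T.endChart p := by simp
      have hSn : S ∈ 𝓝 (0 : ℝ) := by
        have : Tendsto (fun s : ℝ => T.endChart p + s • v) (𝓝 0) (𝓝 (T.endChart p)) := by
          simpa using hline.continuousAt.tendsto
        exact this (mem_of_superset (isOpen_image_endChart.mem_nhds hqU) hUΩ)
      have h0S : (0 : ℝ) ∈ S := mem_of_mem_nhds hSn
      obtain ⟨L, hL⟩ := exists_hasFDerivAt_endChartInv (T := T) hp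
      set k : ℝ → ℂ := fun s => T.endChartInv (T.endChart p + s • v) with hk
      have hk0 : k 0 = p := by
        simp only [hk]; rw [hl0, endChartInv_endChart hp]
      have hkm : ∀ s ∈ S, k s ∈ closedBall (0 : ℂ) 1 := fun s hs => hN hs
      have hkd : HasDerivAt k (L v) 0 := by
        rw [← hl0] at hL
        exact hL.comp_hasDerivAt (0 : ℝ) hline
      -- The straight line through the end point is pulled down to a curve of feet, along which both
      -- flux functions can be varied.
      set c : ℝ → ℂ := fun s => flowMap (reverse u) (k s) with hc
      have hcm : ∀ s ∈ S, c s ∈ closedBall (0 : ℂ) 1 := fun s hs => hR (hkm s hs)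
      obtain ⟨c', hc'⟩ := hu.reverse.hasDerivWithinAt_flowMap h0S hkm hkd.hasDerivWithinAt
      obtain ⟨f, hf, h⟩ := hu.variation (fun y hy => contDiffAt_pull_tube hA.contDiff hy)
        (fun y hy v => fderiv_pull_braidField hA hy v) h0S hcm hc'
      obtain ⟨f', hf', h'⟩ := hu'.variation (fun y hy => contDiffAt_pull_tube hA'.contDiff hy)
        (fun y hy v => fderiv_pull_braidField hA' hy v) h0S hcm hc'
      have hback : ∀ s ∈ S, flowMap u (c s) = k s := fun s hs => hu.flowMap_reverse' (hkm s hs)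
      have hfk : f = L v := ((hf.congr (fun s hs => (hback s hs).symm) (hback 0 h0S).symm).hasDerivAt
        hSn).unique hkd
      have heq := (h.hasDerivAt hSn).unique ((h'.congr (fun s hs => hflux _ (hcm s hs))
        (hflux _ (hcm 0 h0S))).hasDerivAt hSn)
      have hr := hF' (hcm 0 h0S)
      -- Equal fluxes have equal variations; the bottom terms agree by the gauge and cancel, leaving
      -- the equality of the top terms, which is preservation of `θ` by `G`.
      rw [pull_lift_eq hgauge hgauge' (hcm 0 h0S) (Or.inl rfl), sub_left_inj, hback 0 h0S, hk0, hfk,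
        ← pull_lift_eq hgauge hgauge' hr (Or.inr rfl)] at heq
      have hG0 : G (T.endChart p) = T.endChart (flowMap u' (c 0)) := by
        simp only [hGd, hc, hk]
        rw [hl0]
      have hv : T.endChartDeriv p (L v) = v := by
        have hd := hasFDerivAt_endChart (T := T) hp
        rw [← hk0] at hd
        have h1 := hd.comp_hasDerivAt (0 : ℝ) hkd
        rw [hk0] at h1
        refine h1.unique (hline.congr_of_eventuallyEq ?_)
        filter_upwards [hSn] with s hs
        obtain ⟨r, hr, hrs⟩ := hs
        simp only [Function.comp_apply, hk]
        rw [← hrs, endChartInv_endChart hr]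
      have hg : HasDerivAt (fun s => T.endChart (flowMap u' (c s)))
          (T.endChartDeriv (flowMap u' (c 0)) f') 0 :=
        HasFDerivAt.comp_hasDerivAt (f := fun s => flowMap u' (c s)) (0 : ℝ)
          (hasFDerivAt_endChart hr) (hf'.hasDerivAt hSn)
      refine ⟨_, hg, ?_⟩
      rw [hG0, endForm_endChart hr, ← heq, ← endForm_endChart hp, hv]
  have h1 := hid (mem_image_of_mem T.endChart (hu.flowMap_mem hp))
  simp only [hGd, id] at h1
  rw [endChartInv_endChart (hu.flowMap_mem hp), hu.flowMap_reverse hp] at h1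
  have h2 := congrArg T.endChartInv h1
  rw [endChartInv_endChart (hu'.flowMap_mem hp), endChartInv_endChart (hu.flowMap_mem hp)] at h2
  exact h2.symm

end FluxTube

end

theorem theorem1 (T : FluxTube) (B B' A A' Aref : E3 → E3)
    (hB : T.IsMagneticBraid B) (hB' : T.IsMagneticBraid B')
    (hF : EqOn (T.fieldLineMap B) (T.fieldLineMap B') (T.boundaryD 0))
    (hwind : T.SameWinding B B')
    (hA : T.IsVectorPotential A B) (hA' : T.IsVectorPotential A' B')
    (href : T.IsReferencePotential Aref B) (href' : T.IsReferencePotential Aref B')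
    (hgauge : T.MatchesOnBoundary A Aref) (hgauge' : T.MatchesOnBoundary A' Aref)
    (hcanonical : T.IsCanonicalOnEnds Aref) :
    EqOn (T.topologicalFlux B A) (T.topologicalFlux B' A') (T.D 0) ↔
      EqOn (T.fieldLineMap B) (T.fieldLineMap B') (T.D 0) := by
  constructor
  · intro h x hx
    obtain ⟨p, hp, rfl⟩ := FluxTube.mem_D_zero_iff.1 hx
    rw [FluxTube.fieldLineMap_eq_iff hB hB' hp]
    refine FluxTube.flowMap_eq_of_lineIntegral_eq hB hB' (fun p hp => ?_) hA hA' hgauge hgauge'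
      hcanonical (fun p hp => ?_) hp
    · rw [← FluxTube.fieldLineMap_eq_iff hB hB' (by simp [hp])]
      obtain ⟨φ, rfl⟩ := FluxTube.exists_angle hp
      exact hF ⟨φ, FluxTube.side_eq φ 0⟩
    · rw [← FluxTube.topologicalFlux_eq hB hp, ← FluxTube.topologicalFlux_eq hB' hp]
      exact h (FluxTube.mem_D_zero_iff.2 ⟨p, hp, rfl⟩)
  · intro h x hx
    obtain ⟨p, hp, rfl⟩ := FluxTube.mem_D_zero_iff.1 hx
    rw [FluxTube.topologicalFlux_eq hB hp, FluxTube.topologicalFlux_eq hB' hp]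
    refine FluxTube.lineIntegral_eq_of_flowMap_eq hB hB' hwind hA hA' hgauge hgauge'
      (fun r hr => ?_) hp
    rw [← FluxTube.fieldLineMap_eq_iff hB hB' hr]
    exact h (FluxTube.mem_D_zero_iff.2 ⟨r, hr, rfl⟩)
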